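/- Let $w=(w(n))_{n\ge 0}$ be a sequence of positive real numbers, and let $X=(X_n)_{n\ge 0}$ be the vertex reinforced random walk (VRRW) on $\mathbb{Z}$ with weight sequence $w$, that is, a random process with $X_0=0$ almost surely and, for all $n\ge 0$, $$\mathbb{P}\{X_{n+1}=X_n\pm 1\mid \sigma(X_0,\dots,X_n)\}=\frac{w(Z_n(X_n\pm 1))}{w(Z_n(X_n+1))+w(Z_n(X_n-1))}\quad\text{almost surely},\qquad Z_n(y):=\sum_{k=0}^{n}1_{\{X_k=y\}}.$$ Let $R':=\{x\in\mathbb{Z} : \lim_{n\to\infty} Z_n(x)=\infty\}$ be the set of sites visited infinitely often by $X$, and let $|R'|\in\{0,1,2,\dots\}\cup\{\infty\}$ be its cardinality. 1. If $\sum_{k\ge 0} 1/w(k)=\infty$, then almost surely $|R'|\neq 2$. 2. If $\sum_{k\ge 0} 1/w(k)<\infty$ and $w$ is non-decreasing, then almost surely $|R'|=2$. -/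

import Mathlib

open MeasureTheory ProbabilityTheory Filter

/-- Local time `Z_n(y) = ∑_{k=0}^{n} 1_{X_k = y}` of a path (trivial initial configuration). -/
def localTime {Ω : Type*} (X : ℕ → Ω → ℤ) (n : ℕ) (y : ℤ) (ω : Ω) : ℕ :=
  ∑ k ∈ Finset.range (n + 1), if X k ω = y then 1 else 0

/-- `X` is, under `μ`, a vertex reinforced random walk on `ℤ` with weight sequence `w`,
started from `0` with the trivial initial local time configuration. The conditional
probabilities are taken with respect to the natural filtration `σ(X_0, …, X_n)`. -/
structure IsVRRW {Ω : Type*} [MeasurableSpace Ω] (w : ℕ → ℝ) (X : ℕ → Ω → ℤ)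
    (μ : Measure Ω) : Prop where
  measurable : ∀ n, Measurable (X n)
  start : ∀ᵐ ω ∂μ, X 0 ω = 0
  right : ∀ n,
    μ⟦{ω | X (n + 1) ω = X n ω + 1} |
        Filtration.natural X (fun k => (measurable k).stronglyMeasurable) n⟧ =ᵐ[μ]
      fun ω => w (localTime X n (X n ω + 1) ω) /
        (w (localTime X n (X n ω + 1) ω) + w (localTime X n (X n ω - 1) ω))
  left : ∀ n,
    μ⟦{ω | X (n + 1) ω = X n ω - 1} |
        Filtration.natural X (fun k => (measurable k).stronglyMeasurable) n⟧ =ᵐ[μ]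
      fun ω => w (localTime X n (X n ω - 1) ω) /
        (w (localTime X n (X n ω + 1) ω) + w (localTime X n (X n ω - 1) ω))

/-- The set `R'` of sites visited infinitely often, i.e. `{x | Z_∞(x) = ∞}`. -/
def visitedInfinitelyOften {Ω : Type*} (X : ℕ → Ω → ℤ) (ω : Ω) : Set ℤ :=
  {x | Tendsto (fun n => localTime X n x ω) atTop atTop}

/-! The walk is realised from independent uniform labels, one for each site and each rank of visit:
the departure of rank `k` from `x` goes left exactly when `u (x, k)` lies below the reinforced left
probability. The transition probabilities determine the law (`IsVRRW.map_eq`), so both statements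
reduce to this driven walk.

Suppose `∑ 1 / w` diverges and exactly two sites are visited infinitely often. The walk then ends by
alternating between some `x` and `x + 1`, and at its successive visits to `x` the left probability
is `w a / (w a + w (c + i))` with `a` and `c` fixed. This is not summable in `i`, so by
Borel–Cantelli some label breaks the alternation.

Suppose `∑ 1 / w` converges and `w` is monotone. Each site other than the origin turns the walk back
at every visit with probability bounded below, so the walk is bounded and its recurrent sites form a
finite interval `[a, b]` (`ae_drivenWalk_bounded`). It remains to exclude `a + 2 ≤ b`. Give each
departure from the interior of `[a, b]` the value `1 / w Z` if it goes left and `-1 / w Z` if it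
goes right, where `Z` counts the earlier visits to its target. The sum `M` of these values after a
time `n` is a martingale limit, because `p / w a = (1 - p) / w b` for the left probability `p`.

Two monotonicities now conflict. Lowering a label favours a step to the left, so `M` is positively
correlated with events that are decreasing in the labels (`integral_signedStep_nonneg`). But a walk
with lower labels departs left at every positive rank at which the original one does
(`IsLeftCoupling.departsLeft`), and a return to `y` comes from the side of the preceding departure.
Hence the total weight of arrivals from the left grows when labels are lowered, while on trapped
paths `M` is a constant minus this weight (`IsTrappedIn.tsum_interiorStep`). So, up to untrapped
paths, `M < 0` is a decreasing event, on which `M` must have a nonnegative integral; this forces `M`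
to be nearly zero. That is impossible, since the second moment of `M` is comparable to the remaining
quadratic mass `σ` and its fourth moment to `σ ^ 2` (`measureReal_eq_zero_of_moments`). Lévy's
zero-one law supplies the histories that make trapping almost certain, and each of them turns out to
be null. -/

/-! ### Visit and crossing counts of nearest neighbour paths. -/

/-- Number of times `t < s` at which the path `X` is at `y`. -/
def visitsBefore (X : ℕ → ℤ) (s : ℕ) (y : ℤ) : ℕ :=
  ((Finset.range s).filter fun t => X t = y).card

/-- Number of times `t < s` at which the path `X` steps from `y` to `z`. -/
def stepsBefore (X : ℕ → ℤ) (s : ℕ) (y z : ℤ) : ℕ :=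
  ((Finset.range s).filter fun t => X t = y ∧ X (t + 1) = z).card

/-- Nearest neighbour paths on `ℤ`. -/
def IsNearestNeighbor (X : ℕ → ℤ) : Prop :=
  ∀ n, X (n + 1) = X n - 1 ∨ X (n + 1) = X n + 1

theorem visitsBefore_zero (X : ℕ → ℤ) (y : ℤ) : visitsBefore X 0 y = 0 := by
  simp [visitsBefore]

theorem visitsBefore_succ (X : ℕ → ℤ) (s : ℕ) (y : ℤ) :
    visitsBefore X (s + 1) y = visitsBefore X s y + if X s = y then 1 else 0 := by
  unfold visitsBefore
  rw [Finset.range_add_one, Finset.filter_insert]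
  split_ifs <;> simp

theorem stepsBefore_succ (X : ℕ → ℤ) (s : ℕ) (y z : ℤ) :
    stepsBefore X (s + 1) y z =
      stepsBefore X s y z + if X s = y ∧ X (s + 1) = z then 1 else 0 := by
  unfold stepsBefore
  rw [Finset.range_add_one, Finset.filter_insert]
  split_ifs <;> simp

theorem visitsBefore_mono (X : ℕ → ℤ) (y : ℤ) : Monotone fun s => visitsBefore X s y :=
  monotone_nat_of_le_succ fun s => by rw [visitsBefore_succ]; omega

theorem stepsBefore_mono (X : ℕ → ℤ) (y z : ℤ) : Monotone fun s => stepsBefore X s y z :=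
  monotone_nat_of_le_succ fun s => by rw [stepsBefore_succ]; omega

theorem localTime_eq_visitsBefore {Ω : Type*} (X : ℕ → Ω → ℤ) (n : ℕ) (y : ℤ) (ω : Ω) :
    localTime X n y ω = visitsBefore (fun k => X k ω) (n + 1) y := by
  simp [localTime, visitsBefore]

theorem visitsBefore_lt_of_visit {X : ℕ → ℤ} {y : ℤ} {s t : ℕ} (hs : X s = y) (hst : s < t) :
    visitsBefore X s y < visitsBefore X t y := by
  have h := visitsBefore_mono X y (Nat.succ_le_of_lt hst)
  have h' := visitsBefore_succ X s y
  simp only [Nat.succ_eq_add_one] at h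
  rw [if_pos hs] at h'
  omega

theorem exists_visit_of_lt {X : ℕ → ℤ} {y : ℤ} {s j : ℕ} (hj : j < visitsBefore X s y) :
    ∃ t < s, X t = y ∧ visitsBefore X t y = j := by
  induction s with
  | zero => simp [visitsBefore_zero] at hj
  | succ s ih =>
    rw [visitsBefore_succ] at hj
    by_cases hlt : j < visitsBefore X s y
    · obtain ⟨t, ht, h⟩ := ih hlt
      exact ⟨t, by omega, h⟩
    · by_cases hs : X s = y
      · rw [if_pos hs] at hj
        exact ⟨s, by omega, hs, by omega⟩
      · rw [if_neg hs] at hj; omega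

theorem visitsBefore_inj {X : ℕ → ℤ} {y : ℤ} {s t : ℕ} (hs : X s = y) (ht : X t = y)
    (h : visitsBefore X s y = visitsBefore X t y) : s = t := by
  rcases lt_trichotomy s t with hlt | heq | hlt
  · have := visitsBefore_lt_of_visit hs hlt; omega
  · exact heq
  · have := visitsBefore_lt_of_visit ht hlt; omega

/-- Balance of the crossings of the edge between `z` and `z + 1`. -/
theorem IsNearestNeighbor.crossings {X : ℕ → ℤ} (hX : IsNearestNeighbor X) (s : ℕ) (z : ℤ) :
    stepsBefore X s z (z + 1) + (if z < X 0 then 1 else 0) =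
      stepsBefore X s (z + 1) z + if z < X s then 1 else 0 := by
  induction s with
  | zero => simp [stepsBefore]
  | succ s ih =>
    rw [stepsBefore_succ, stepsBefore_succ]
    rcases hX s with h | h <;> rw [h] <;> split_ifs at ih ⊢ <;> omega

theorem eventually_ne_of_visitsBefore_le {X : ℕ → ℤ} {y : ℤ} {b : ℕ}
    (hb : ∀ t, visitsBefore X t y ≤ b) : ∃ T, ∀ t ≥ T, X t ≠ y := by
  by_contra! h
  have key : ∀ n : ℕ, ∃ t, n ≤ visitsBefore X t y := by
    intro n
    induction n with
    | zero => exact ⟨0, by omega⟩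
    | succ n ih =>
      obtain ⟨t, ht⟩ := ih
      obtain ⟨s, hs, hsy⟩ := h t
      refine ⟨s + 1, ?_⟩
      have := visitsBefore_lt_of_visit hsy (Nat.lt_succ_self s)
      have h2 := visitsBefore_mono X y hs
      simp only at h2
      simp only [Nat.succ_eq_add_one] at this
      omega
  obtain ⟨t, ht⟩ := key (b + 1)
  have := hb t
  omega

theorem IsNearestNeighbor.lt_or_gt {X : ℕ → ℤ} (hX : IsNearestNeighbor X) {y : ℤ} {T : ℕ}
    (h : ∀ t ≥ T, X t ≠ y) : (∀ t ≥ T, X t < y) ∨ ∀ t ≥ T, y < X t := by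
  rcases lt_or_gt_of_ne (h T le_rfl) with h0 | h0
  · left
    intro t ht
    induction t, ht using Nat.le_induction with
    | base => exact h0
    | succ t ht ih => have := h (t + 1) (by omega); rcases hX t with h | h <;> omega
  · right
    intro t ht
    induction t, ht using Nat.le_induction with
    | base => exact h0
    | succ t ht ih => have := h (t + 1) (by omega); rcases hX t with h | h <;> omega

theorem IsNearestNeighbor.lt_of_visitsBefore_eq {X : ℕ → ℤ} (hX : IsNearestNeighbor X) {y : ℤ}
    {s t : ℕ} (hst : s ≤ t) (hs : X s < y) (hv : visitsBefore X s y = visitsBefore X t y)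
    (ht : X t ≠ y) : X t < y := by
  induction t, hst using Nat.le_induction with
  | base => exact hs
  | succ t hst ih =>
    have h1 := visitsBefore_mono X y hst
    have h2 := visitsBefore_succ X t y
    simp only at h1
    split_ifs at h2 with h3
    · omega
    · have := ih (by omega) h3
      rcases hX t with h | h <;> omega

theorem IsNearestNeighbor.gt_of_visitsBefore_eq {X : ℕ → ℤ} (hX : IsNearestNeighbor X) {y : ℤ}
    {s t : ℕ} (hst : s ≤ t) (hs : y < X s) (hv : visitsBefore X s y = visitsBefore X t y)
    (ht : X t ≠ y) : y < X t := by
  induction t, hst using Nat.le_induction with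
  | base => exact hs
  | succ t hst ih =>
    have h1 := visitsBefore_mono X y hst
    have h2 := visitsBefore_succ X t y
    simp only at h1
    split_ifs at h2 with h3
    · omega
    · have := ih (by omega) h3
      rcases hX t with h | h <;> omega

/-! ### Comparison of two paths through the ranks of their departures. -/

/-- The set of ranks of the visits to `y` before time `s` that are followed by a step to `z`. -/
def stepRanks (X : ℕ → ℤ) (s : ℕ) (y z : ℤ) : Finset ℕ :=
  ((Finset.range s).filter fun t => X t = y ∧ X (t + 1) = z).image fun t => visitsBefore X t y

theorem card_stepRanks (X : ℕ → ℤ) (s : ℕ) (y z : ℤ) :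
    (stepRanks X s y z).card = stepsBefore X s y z := by
  unfold stepRanks stepsBefore
  apply Finset.card_image_of_injOn
  intro t ht t' ht' h
  simp only [Finset.coe_filter, Finset.mem_range, Set.mem_ofPred_eq] at ht ht'
  exact visitsBefore_inj ht.2.1 ht'.2.1 h

theorem mem_stepRanks {X : ℕ → ℤ} {s : ℕ} {y z : ℤ} {j : ℕ} :
    j ∈ stepRanks X s y z ↔ ∃ t < s, X t = y ∧ X (t + 1) = z ∧ visitsBefore X t y = j := by
  simp [stepRanks, and_assoc]

/-- Whenever `A` before time `s` and `B` before time `t` depart from `y` with the same rank, a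
departure of `A` to the left forces a departure of `B` to the left. -/
def LeftDominated (A B : ℕ → ℤ) (s t : ℕ) (y : ℤ) : Prop :=
  ∀ s' < s, ∀ t' < t, A s' = y → B t' = y → visitsBefore A s' y = visitsBefore B t' y →
    A (s' + 1) = y - 1 → B (t' + 1) = y - 1

/-- Visits to a site are determined by their ranks, so counting steps amounts to counting ranks, and
domination makes one set of ranks a subset of the other. -/
theorem LeftDominated.steps_left {A B : ℕ → ℤ} {s t : ℕ} {y : ℤ} (h : LeftDominated A B s t y)
    (hn : visitsBefore A s y ≤ visitsBefore B t y) :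
    stepsBefore A s y (y - 1) ≤ stepsBefore B t y (y - 1) := by
  rw [← card_stepRanks, ← card_stepRanks]
  apply Finset.card_le_card
  intro j hj
  obtain ⟨s', hs', h1, h2, h3⟩ := mem_stepRanks.1 hj
  have := visitsBefore_lt_of_visit h1 hs'
  obtain ⟨t', ht', h4, h5⟩ := exists_visit_of_lt (X := B) (y := y) (s := t) (j := j) (by omega)
  exact mem_stepRanks.2 ⟨t', ht', h4, h s' hs' t' ht' h1 h4 (by omega) h2, h5⟩

theorem LeftDominated.steps_right {A B : ℕ → ℤ} (hA : IsNearestNeighbor A) {s t : ℕ} {y : ℤ}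
    (h : LeftDominated A B s t y) (hn : visitsBefore B t y ≤ visitsBefore A s y) :
    stepsBefore B t y (y + 1) ≤ stepsBefore A s y (y + 1) := by
  rw [← card_stepRanks, ← card_stepRanks]
  apply Finset.card_le_card
  intro j hj
  obtain ⟨t', ht', h1, h2, h3⟩ := mem_stepRanks.1 hj
  have := visitsBefore_lt_of_visit h1 ht'
  obtain ⟨s', hs', h4, h5⟩ := exists_visit_of_lt (X := A) (y := y) (s := s) (j := j) (by omega)
  refine mem_stepRanks.2 ⟨s', hs', h4, ?_, h5⟩
  rcases hA s' with h6 | h6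
  · have := h s' hs' t' ht' h4 h1 (by omega) (by omega)
    omega
  · omega

/-- `B` steps to the left whenever `A` does, at visits of the same rank where the local
environment of `B` favours the left at least as much as that of `A`. -/
structure IsLeftCoupling (A B : ℕ → ℤ) : Prop where
  nnA : IsNearestNeighbor A
  nnB : IsNearestNeighbor B
  start : A 0 = B 0
  step : ∀ s t, A s = B t → visitsBefore A s (A s) = visitsBefore B t (A s) →
    visitsBefore A s (A s - 1) ≤ visitsBefore B t (A s - 1) →
    visitsBefore B t (A s + 1) ≤ visitsBefore A s (A s + 1) →
    A (s + 1) = A s - 1 → B (t + 1) = A s - 1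

/-- This is the induction that keeps the coupling alive: at visits of equal rank the environment of
`B` favours the left, so `step` applies again. Domination at all earlier pairs of times is converted
into visit counts by balancing edge crossings. -/
theorem IsLeftCoupling.compare {A B : ℕ → ℤ} (h : IsLeftCoupling A B) (s t : ℕ) (z : ℤ)
    (hA : A s = z) (hB : B t = z) (hv : visitsBefore A s z = visitsBefore B t z) :
    visitsBefore A s (z - 1) ≤ visitsBefore B t (z - 1) ∧
      visitsBefore B t (z + 1) ≤ visitsBefore A s (z + 1) := by
  induction hn : s + t using Nat.strong_induction_on generalizing s t z with
  | _ n ih =>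
  have dom : ∀ y, LeftDominated A B s t y := by
    intro y s' hs' t' ht' h1 h2 h3 h4
    obtain ⟨h5, h6⟩ := ih (s' + t') (by omega) s' t' y h1 h2 h3 rfl
    have := h.step s' t' (by omega) (by rw [h1]; exact h3) (by rw [h1]; exact h5)
      (by rw [h1]; exact h6) (by omega)
    omega
  have h0 := h.start
  constructor
  · by_contra! hlt
    -- Stop `A` at the visit to `z - 1` whose rank is the count of `B`. Up to then `A` has made at
    -- least as many steps from `z - 1` to `z` as `B`, and at most as many back. But `A` is now left
    -- of this edge and `B` right of it, which contradicts the crossing balance.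
    obtain ⟨s0, hs0, hs1, hs2⟩ := exists_visit_of_lt hlt
    have h1 := (dom z).steps_left hv.le
    have h2 : LeftDominated A B s0 t (z - 1) := fun s' hs' => dom (z - 1) s' (by omega)
    have h3 := h2.steps_right h.nnA hs2.ge
    have c1 := h.nnA.crossings s (z - 1)
    have c2 := h.nnB.crossings t (z - 1)
    have c3 := h.nnA.crossings s0 (z - 1)
    have m1 := stepsBefore_mono A z (z - 1) hs0.le
    simp only [sub_add_cancel] at *
    rw [hA] at c1
    rw [hB] at c2
    rw [hs1] at c3
    rw [h0] at c1 c3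
    split_ifs at c1 c2 c3 <;> omega
  · by_contra! hlt
    obtain ⟨t0, ht0, ht1, ht2⟩ := exists_visit_of_lt hlt
    have h1 := (dom z).steps_right h.nnA hv.ge
    have h2 : LeftDominated A B s t0 (z + 1) :=
      fun s' hs' t' ht' => dom (z + 1) s' hs' t' (by omega)
    have h3 := h2.steps_left ht2.ge
    have c1 := h.nnA.crossings s z
    have c2 := h.nnB.crossings t z
    have c3 := h.nnB.crossings t0 z
    have m1 := stepsBefore_mono B z (z + 1) ht0.le
    simp only [add_sub_cancel_right] at *
    rw [hA] at c1
    rw [hB] at c2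
    rw [ht1] at c3
    rw [h0] at c1
    split_ifs at c1 c2 c3 <;> omega

theorem IsLeftCoupling.leftDominated {A B : ℕ → ℤ} (h : IsLeftCoupling A B) (s t : ℕ) (y : ℤ) :
    LeftDominated A B s t y := by
  intro s' _ t' _ h1 h2 h3 h4
  obtain ⟨h5, h6⟩ := h.compare s' t' y h1 h2 h3
  have := h.step s' t' (by omega) (by rw [h1]; exact h3) (by rw [h1]; exact h5)
    (by rw [h1]; exact h6) (by omega)
  omega

/-- Infinite descent. If `B` ended to the right of `z`, crossing balance would give it fewer visits
to `z + 1` in all than `A` makes before `s`. So `B` would also end to the right of `z + 1`, with an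
earlier visit of `A` to `z + 1` as the new witness. -/
theorem IsLeftCoupling.not_eventually_gt {A B : ℕ → ℤ} (h : IsLeftCoupling A B) (s : ℕ) (z : ℤ)
    (hA : A s = z) (hv : ∀ t, visitsBefore B t z ≤ visitsBefore A s z) (T : ℕ) :
    ¬ ∀ t ≥ T, z < B t := by
  induction s using Nat.strong_induction_on generalizing z T with
  | _ s ih =>
  intro hT
  have h0 := h.start
  have hlt : ∀ t, visitsBefore B t (z + 1) < visitsBefore A s (z + 1) := by
    intro t
    by_contra! hle
    have hle' : visitsBefore A s (z + 1) ≤ visitsBefore B (max t T) (z + 1) :=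
      hle.trans (visitsBefore_mono B (z + 1) (le_max_left t T))
    have h1 := (h.leftDominated s (max t T) z).steps_right h.nnA (hv _)
    have h2 := (h.leftDominated s (max t T) (z + 1)).steps_left hle'
    have c1 := h.nnA.crossings s z
    have c2 := h.nnB.crossings (max t T) z
    have h3 := hT _ (le_max_right t T)
    simp only [add_sub_cancel_right] at *
    rw [hA] at c1
    rw [h0] at c1
    split_ifs at c1 c2 <;> omega
  have h0 := hlt 0
  obtain ⟨s0, hs0, hs1, hs2⟩ := exists_visit_of_lt (X := A) (y := z + 1) (s := s)
    (j := visitsBefore A s (z + 1) - 1) (by omega)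
  have hb : ∀ t, visitsBefore B t (z + 1) ≤ visitsBefore A s0 (z + 1) := fun t => by
    have := hlt t; omega
  obtain ⟨T', hT'⟩ := eventually_ne_of_visitsBefore_le hb
  refine ih s0 hs0 (z + 1) hs1 hb (max T T') fun t ht => ?_
  have h1 := hT t (le_trans (le_max_left _ _) ht)
  have h2 := hT' t (le_trans (le_max_right _ _) ht)
  omega

/-- The same descent with left and right, and the two paths, exchanged. -/
theorem IsLeftCoupling.not_eventually_lt {A B : ℕ → ℤ} (h : IsLeftCoupling A B) (t : ℕ) (z : ℤ)
    (hB : B t = z) (hv : ∀ s, visitsBefore A s z ≤ visitsBefore B t z) (T : ℕ) :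
    ¬ ∀ s ≥ T, A s < z := by
  induction t using Nat.strong_induction_on generalizing z T with
  | _ t ih =>
  intro hT
  have h0 := h.start
  have hlt : ∀ s, visitsBefore A s (z - 1) < visitsBefore B t (z - 1) := by
    intro s
    by_contra! hle
    have hle' : visitsBefore B t (z - 1) ≤ visitsBefore A (max s T) (z - 1) :=
      hle.trans (visitsBefore_mono A (z - 1) (le_max_left s T))
    have h1 := (h.leftDominated (max s T) t z).steps_left (hv _)
    have h2 := (h.leftDominated (max s T) t (z - 1)).steps_right h.nnA hle'
    have c1 := h.nnB.crossings t (z - 1)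
    have c2 := h.nnA.crossings (max s T) (z - 1)
    have h3 := hT _ (le_max_right s T)
    simp only [sub_add_cancel] at *
    rw [hB] at c1
    rw [h0] at c2
    split_ifs at c1 c2 <;> omega
  have h0 := hlt 0
  obtain ⟨t0, ht0, ht1, ht2⟩ := exists_visit_of_lt (X := B) (y := z - 1) (s := t)
    (j := visitsBefore B t (z - 1) - 1) (by omega)
  have hb : ∀ s, visitsBefore A s (z - 1) ≤ visitsBefore B t0 (z - 1) := fun s => by
    have := hlt s; omega
  obtain ⟨T', hT'⟩ := eventually_ne_of_visitsBefore_le hb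
  refine ih t0 ht0 (z - 1) ht1 hb (max T T') fun s hs => ?_
  have h1 := hT s (le_trans (le_max_left _ _) hs)
  have h2 := hT' s (le_trans (le_max_right _ _) hs)
  omega

/-! ### Departures completed by the final side of the path. -/

/-- The departure of rank `j` from `y` is to the left, where the sequence of departures is
extended by the side of `y` on which the path finally stays. -/
def DepartsLeft (X : ℕ → ℤ) (y : ℤ) (j : ℕ) : Prop :=
  ∃ T, X T < y ∧ visitsBefore X T y ≤ j ∧ (visitsBefore X T y = j ∨ ∀ s ≥ T, X s < y)

/-- Mirror image of `DepartsLeft`. -/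
def DepartsRight (X : ℕ → ℤ) (y : ℤ) (j : ℕ) : Prop :=
  ∃ T, y < X T ∧ visitsBefore X T y ≤ j ∧ (visitsBefore X T y = j ∨ ∀ s ≥ T, y < X s)

theorem visitsBefore_eq_of_ne {X : ℕ → ℤ} {y : ℤ} {T : ℕ} (h : ∀ t ≥ T, X t ≠ y) :
    ∀ t ≥ T, visitsBefore X t y = visitsBefore X T y := by
  intro t ht
  induction t, ht using Nat.le_induction with
  | base => rfl
  | succ t ht ih => rw [visitsBefore_succ, if_neg (h t ht), ih, add_zero]

/-- Either the step after the `j`-th visit exhibits a side, or there are fewer than `j` visits and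
the path settles on one side. Rank `0` is excluded because a path that starts at `y` is never off
`y` with no visit recorded. -/
theorem IsNearestNeighbor.departsLeft_or_departsRight {X : ℕ → ℤ} (hX : IsNearestNeighbor X)
    (y : ℤ) {j : ℕ} (hj : 1 ≤ j) : DepartsLeft X y j ∨ DepartsRight X y j := by
  by_cases hex : ∃ T, X T ≠ y ∧ visitsBefore X T y = j
  · obtain ⟨T, hT, hv⟩ := hex
    rcases lt_or_gt_of_ne hT with h | h
    · exact Or.inl ⟨T, h, hv.le, Or.inl hv⟩
    · exact Or.inr ⟨T, h, hv.le, Or.inl hv⟩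
  · push Not at hex
    have hlt : ∀ t, visitsBefore X t y < j := by
      intro t
      by_contra! hle
      obtain ⟨s, _, hs, hsv⟩ := exists_visit_of_lt (X := X) (y := y) (s := t) (j := j - 1)
        (by omega)
      have h1 : X (s + 1) ≠ y := by rcases hX s with h | h <;> omega
      have h2 := visitsBefore_succ X s y
      rw [if_pos hs] at h2
      exact hex (s + 1) h1 (by omega)
    obtain ⟨T, hT⟩ := eventually_ne_of_visitsBefore_le fun t => (hlt t).le
    rcases hX.lt_or_gt hT with h | h
    · exact Or.inl ⟨T, h T le_rfl, (hlt T).le, Or.inr h⟩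
    · exact Or.inr ⟨T, h T le_rfl, (hlt T).le, Or.inr h⟩

theorem IsLeftCoupling.departsLeft {A B : ℕ → ℤ} (h : IsLeftCoupling A B) {y : ℤ} {j : ℕ}
    (hj : 1 ≤ j) (hL : DepartsLeft A y j) : DepartsLeft B y j := by
  refine (h.nnB.departsLeft_or_departsRight y hj).resolve_right ?_
  rintro ⟨t, htB, htj, ht⟩
  obtain ⟨s, hsA, hsj, hs⟩ := hL
  have h0 := h.start
  have vA : (∀ s' ≥ s, A s' < y) → ∀ s', visitsBefore A s' y ≤ visitsBefore A s y := by
    intro hf s'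
    rcases le_total s s' with hle | hle
    · exact (visitsBefore_eq_of_ne (fun k hk => (hf k hk).ne) s' hle).le
    · exact visitsBefore_mono A y hle
  have vB : (∀ s' ≥ t, y < B s') → ∀ s', visitsBefore B s' y ≤ visitsBefore B t y := by
    intro hf s'
    rcases le_total t s' with hle | hle
    · exact (visitsBefore_eq_of_ne (fun k hk => (hf k hk).ne') s' hle).le
    · exact visitsBefore_mono B y hle
  -- With unequal counts, the path with fewer visits must already be on its final side, which the
  -- two descent lemmas forbid. With equal counts the last departures from `y` are compared, or the
  -- common starting point if there are none.
  rcases lt_trichotomy (visitsBefore A s y) (visitsBefore B t y) with hlt | heq | hlt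
  · have hf := hs.resolve_left (by omega)
    obtain ⟨t0, _, ht1, ht2⟩ := exists_visit_of_lt (X := B) (y := y) (s := t)
      (j := visitsBefore B t y - 1) (by omega)
    exact h.not_eventually_lt t0 y ht1 (fun s' => by have := vA hf s'; omega) s hf
  · rcases Nat.eq_zero_or_pos (visitsBefore A s y) with hz | hpos
    · have c1 := h.nnA.crossings s (y - 1)
      have c2 := h.nnB.crossings t y
      have z1 : stepsBefore A s y (y - 1) = 0 := by
        have : stepsBefore A s y (y - 1) ≤ visitsBefore A s y :=
          Finset.card_le_card fun k hk => by simp at hk ⊢; omega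
        omega
      have z2 : stepsBefore B t y (y + 1) = 0 := by
        have : stepsBefore B t y (y + 1) ≤ visitsBefore B t y :=
          Finset.card_le_card fun k hk => by simp at hk ⊢; omega
        omega
      simp only [sub_add_cancel] at *
      split_ifs at c1 c2 <;> omega
    · obtain ⟨s0, hs0, hs1, hs2⟩ := exists_visit_of_lt (X := A) (y := y) (s := s)
        (j := visitsBefore A s y - 1) (by omega)
      obtain ⟨t0, ht0, ht1, ht2⟩ := exists_visit_of_lt (X := B) (y := y) (s := t)
        (j := visitsBefore B t y - 1) (by omega)
      have v1 := visitsBefore_succ A s0 y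
      have v2 := visitsBefore_succ B t0 y
      rw [if_pos hs1] at v1
      rw [if_pos ht1] at v2
      have sideA : A (s0 + 1) = y - 1 := by
        rcases h.nnA s0 with h1 | h1
        · omega
        · have := h.nnA.gt_of_visitsBefore_eq (y := y) (show s0 + 1 ≤ s by omega) (by omega)
            (by omega) hsA.ne
          omega
      have sideB : B (t0 + 1) = y + 1 := by
        rcases h.nnB t0 with h1 | h1
        · have := h.nnB.lt_of_visitsBefore_eq (y := y) (show t0 + 1 ≤ t by omega) (by omega)
            (by omega) htB.ne'
          omega
        · omega
      have := h.leftDominated (s0 + 1) (t0 + 1) y s0 (by omega) t0 (by omega) hs1 ht1 (by omega)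
        sideA
      omega
  · have hf := ht.resolve_left (by omega)
    obtain ⟨s0, _, hs1, hs2⟩ := exists_visit_of_lt (X := A) (y := y) (s := s)
      (j := visitsBefore A s y - 1) (by omega)
    exact h.not_eventually_gt s0 y hs1 (fun s' => by have := vB hf s'; omega) t hf

/-! ### The walk driven by labels. -/

/-- Probability of a step to the left when the left and right neighbours have been visited
`a` and `b` times. -/
noncomputable def leftProb (w : ℕ → ℝ) (a b : ℕ) : ℝ := w a / (w a + w b)

theorem leftProb_pos {w : ℕ → ℝ} (hw : ∀ n, 0 < w n) (a b : ℕ) : 0 < leftProb w a b :=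
  div_pos (hw a) (add_pos (hw a) (hw b))

theorem one_sub_leftProb {w : ℕ → ℝ} (hw : ∀ n, 0 < w n) (a b : ℕ) :
    1 - leftProb w a b = w b / (w a + w b) := by
  have := hw a
  have := hw b
  unfold leftProb
  field_simp
  ring

theorem leftProb_lt_one {w : ℕ → ℝ} (hw : ∀ n, 0 < w n) (a b : ℕ) : leftProb w a b < 1 := by
  have := one_sub_leftProb hw a b
  have := div_pos (hw b) (add_pos (hw a) (hw b))
  linarith

theorem leftProb_mono {w : ℕ → ℝ} (hw : ∀ n, 0 < w n) (hm : Monotone w) {a a' b b' : ℕ}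
    (ha : a ≤ a') (hb : b' ≤ b) : leftProb w a b ≤ leftProb w a' b' := by
  have h1 := hm ha
  have h2 := hm hb
  have := hw a
  have := hw b
  have := hw b'
  have := hw a'
  unfold leftProb
  rw [div_le_div_iff₀ (by positivity) (by positivity)]
  nlinarith [mul_le_mul h1 h2 (hw b').le (hw a').le]

/-- Labels driving the walk: `u (x, k)` decides the departure of rank `k` from `x`. -/
abbrev Labels := ℤ × ℕ → unitInterval

/-- Position of the driven walk, together with the number of earlier visits to each site. -/
noncomputable def drivenState (w : ℕ → ℝ) (u : Labels) : ℕ → ℤ × (ℤ → ℕ)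
  | 0 => (0, fun _ => 0)
  | n + 1 =>
    let s := drivenState w u n
    (if (u (s.1, s.2 s.1) : ℝ) < leftProb w (s.2 (s.1 - 1)) (s.2 (s.1 + 1)) then s.1 - 1
      else s.1 + 1, fun y => s.2 y + if s.1 = y then 1 else 0)

/-- The vertex reinforced walk driven by the labels `u`. -/
noncomputable def drivenWalk (w : ℕ → ℝ) (u : Labels) (n : ℕ) : ℤ := (drivenState w u n).1

theorem drivenState_snd (w : ℕ → ℝ) (u : Labels) (n : ℕ) (y : ℤ) :
    (drivenState w u n).2 y = visitsBefore (drivenWalk w u) n y := by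
  induction n with
  | zero => simp [drivenState, visitsBefore_zero]
  | succ n ih => rw [visitsBefore_succ, ← ih]; rfl

theorem drivenWalk_zero (w : ℕ → ℝ) (u : Labels) : drivenWalk w u 0 = 0 := rfl

/-- Visits are counted strictly before time `n`, whereas local time includes time `n`; the two agree
at the neighbours of the current position. -/
theorem drivenWalk_succ (w : ℕ → ℝ) (u : Labels) (n : ℕ) :
    drivenWalk w u (n + 1) =
      if (u (drivenWalk w u n, visitsBefore (drivenWalk w u) n (drivenWalk w u n)) : ℝ) <
        leftProb w (visitsBefore (drivenWalk w u) n (drivenWalk w u n - 1))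
          (visitsBefore (drivenWalk w u) n (drivenWalk w u n + 1))
      then drivenWalk w u n - 1 else drivenWalk w u n + 1 := by
  simp only [← drivenState_snd]
  rfl

theorem drivenWalk_nearestNeighbor (w : ℕ → ℝ) (u : Labels) :
    IsNearestNeighbor (drivenWalk w u) := by
  intro n
  rw [drivenWalk_succ]
  split_ifs <;> simp

/-- Lower labels and a more favourable environment both help the inequality that decides for a left
step. Monotonicity of `w` enters through `leftProb_mono`. -/
theorem isLeftCoupling_drivenWalk {w : ℕ → ℝ} (hw : ∀ n, 0 < w n) (hm : Monotone w)
    {u u' : Labels} (h : u' ≤ u) : IsLeftCoupling (drivenWalk w u) (drivenWalk w u') where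
  nnA := drivenWalk_nearestNeighbor w u
  nnB := drivenWalk_nearestNeighbor w u'
  start := rfl
  step := by
    intro s t h1 h2 h3 h4 h5
    rw [drivenWalk_succ] at h5
    split_ifs at h5 with h6
    · rw [drivenWalk_succ, ← h1, if_pos]
      rw [← h2]
      refine lt_of_le_of_lt ?_ (h6.trans_le (leftProb_mono hw hm h3 h4))
      exact_mod_cast h _
    · omega

theorem visitsBefore_congr {X Y : ℕ → ℤ} {m : ℕ} (h : ∀ j < m, X j = Y j) (y : ℤ) :
    visitsBefore X m y = visitsBefore Y m y := by
  unfold visitsBefore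
  congr 1
  apply Finset.filter_congr
  intro t ht
  rw [h t (Finset.mem_range.1 ht)]

theorem drivenWalk_congr {w : ℕ → ℝ} {u u' : Labels} {m : ℕ}
    (h : ∀ j < m, u' (drivenWalk w u j, visitsBefore (drivenWalk w u) j (drivenWalk w u j)) =
      u (drivenWalk w u j, visitsBefore (drivenWalk w u) j (drivenWalk w u j))) :
    ∀ j ≤ m, drivenWalk w u' j = drivenWalk w u j := by
  intro j
  induction j using Nat.strong_induction_on with
  | _ j ih =>
  intro hj
  cases j with
  | zero => rfl
  | succ j =>
    have h1 := ih j (by omega) (by omega)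
    have h2 : ∀ y, visitsBefore (drivenWalk w u') j y = visitsBefore (drivenWalk w u) j y :=
      visitsBefore_congr fun k hk => ih k (by omega) (by omega)
    rw [drivenWalk_succ, drivenWalk_succ, h1, h2, h2, h2, h j (by omega)]

/-- The label used at time `m` has no influence on the walk up to time `m`. -/
theorem drivenWalk_update {w : ℕ → ℝ} (u : Labels) {m : ℕ} {x : ℤ} {k : ℕ}
    (hk : visitsBefore (drivenWalk w u) m x = k) (t : unitInterval) :
    ∀ j ≤ m, drivenWalk w (Function.update u (x, k) t) j = drivenWalk w u j := by
  apply drivenWalk_congr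
  intro j hj
  apply Function.update_of_ne
  intro he
  rw [Prod.mk.injEq] at he
  have := visitsBefore_lt_of_visit he.1 hj
  rw [he.1] at he
  omega

theorem measurable_visitsBefore {Ω : Type*} [MeasurableSpace Ω] {X : ℕ → Ω → ℤ} {n : ℕ}
    {Y : Ω → ℤ} (hX : ∀ k < n, Measurable (X k)) (hY : Measurable Y) :
    Measurable fun ω => visitsBefore (fun k => X k ω) n (Y ω) := by
  have : (fun ω => visitsBefore (fun k => X k ω) n (Y ω)) =
      fun ω => ∑ k ∈ Finset.range n, if X k ω = Y ω then 1 else 0 := by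
    ext ω
    simp [visitsBefore]
  rw [this]
  refine Finset.measurable_fun_sum _ fun k hk => ?_
  exact Measurable.ite (measurableSet_eq_fun (hX k (Finset.mem_range.1 hk)) hY)
    measurable_const measurable_const

theorem measurable_leftProb {Ω : Type*} [MeasurableSpace Ω] (w : ℕ → ℝ) {f g : Ω → ℕ}
    (hf : Measurable f) (hg : Measurable g) : Measurable fun ω => leftProb w (f ω) (g ω) := by
  have hw : Measurable w := measurable_of_countable w
  exact (hw.comp hf).div ((hw.comp hf).add (hw.comp hg))

theorem measurable_drivenWalk (w : ℕ → ℝ) (n : ℕ) : Measurable fun u => drivenWalk w u n := by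
  induction n using Nat.strong_induction_on with
  | _ n ih =>
  cases n with
  | zero => exact measurable_const
  | succ n =>
    have hn := ih n (by omega)
    have hv : ∀ Y : Labels → ℤ, Measurable Y →
        Measurable fun u => visitsBefore (drivenWalk w u) n (Y u) := fun Y hY =>
      measurable_visitsBefore (X := fun k u => drivenWalk w u k) (fun k hk => ih k (by omega)) hY
    simp only [drivenWalk_succ]
    refine Measurable.ite (measurableSet_lt ?_ (measurable_leftProb w (hv _ (by fun_prop))
      (hv _ (by fun_prop)))) (by fun_prop) (by fun_prop)
    -- Evaluation at a random index is measurable because the index set is countable.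
    have he : Measurable fun q : (ℤ × ℕ) × Labels => ((q.2 q.1 : unitInterval) : ℝ) :=
      measurable_from_prod_countable_right fun i => by fun_prop
    exact he.comp ((hn.prodMk (hv _ hn)).prodMk measurable_id)

/-! ### Independent labels and the resampling of one of them. -/

/-- The law of independent uniform labels. -/
noncomputable def labelMeasure : Measure Labels :=
  Measure.infinitePi fun _ => (volume : Measure unitInterval)

instance : IsProbabilityMeasure labelMeasure := by
  unfold labelMeasure; infer_instance

theorem measurable_update_label (i : ℤ × ℕ) :
    Measurable fun q : Labels × unitInterval => Function.update q.1 i q.2 := by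
  rw [measurable_pi_iff]
  intro j
  by_cases h : j = i
  · subst h; simpa using measurable_snd
  · simp only [Function.update_of_ne h]; fun_prop

/-- A fresh independent uniform label in one place leaves the product law unchanged; it suffices to
check finite boxes. -/
theorem map_update_labelMeasure (i : ℤ × ℕ) :
    (labelMeasure.prod volume).map (fun q : Labels × unitInterval => Function.update q.1 i q.2) =
      labelMeasure := by
  refine Measure.eq_infinitePi _ fun s t ht => ?_
  rw [Measure.map_apply (measurable_update_label i)
    (MeasurableSet.pi s.countable_toSet fun j _ => ht j)]
  have hpre : (fun q : Labels × unitInterval => Function.update q.1 i q.2) ⁻¹'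
      (Set.pi (s : Set (ℤ × ℕ)) t) =
      (Set.pi ((s.erase i : Finset (ℤ × ℕ)) : Set (ℤ × ℕ)) t) ×ˢ
        (if i ∈ s then t i else Set.univ) := by
    ext ⟨u, τ⟩
    simp only [Set.mem_preimage, Set.mem_pi, Finset.mem_coe, Set.mem_prod, Finset.mem_erase]
    constructor
    · intro h
      refine ⟨fun j hj => by simpa [Function.update_of_ne hj.1] using h j hj.2, ?_⟩
      split_ifs with hi
      · simpa using h i hi
      · trivial
    · rintro ⟨h1, h2⟩ j hj
      by_cases hji : j = i
      · subst hji; rw [if_pos hj] at h2; simpa using h2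
      · simpa [Function.update_of_ne hji] using h1 j ⟨hji, hj⟩
  rw [hpre, Measure.prod_prod]
  have h1 : labelMeasure (Set.pi ((s.erase i : Finset (ℤ × ℕ)) : Set (ℤ × ℕ)) t) =
      ∏ j ∈ s.erase i, volume (t j) := Measure.infinitePi_pi _ fun j _ => ht j
  rw [h1]
  by_cases hi : i ∈ s
  · rw [if_pos hi, mul_comm, Finset.mul_prod_erase s (fun j => volume (t j)) hi]
  · rw [if_neg hi, measure_univ, mul_one, Finset.erase_eq_of_notMem hi]

theorem integrable_of_measurable_of_bound {Ω : Type*} [MeasurableSpace Ω] {μ : Measure Ω}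
    [IsFiniteMeasure μ] {f : Ω → ℝ} (hf : Measurable f) {C : ℝ} (hC : ∀ x, |f x| ≤ C) :
    Integrable f μ :=
  Integrable.of_bound hf.aestronglyMeasurable C (Eventually.of_forall hC)

/-- Resampling a single label. -/
theorem integral_update_label (i : ℤ × ℕ) {F : Labels → ℝ} (hF : Measurable F) {C : ℝ}
    (hC : ∀ u, |F u| ≤ C) :
    ∫ u, F u ∂labelMeasure =
      ∫ u, (∫ t : unitInterval, F (Function.update u i t)) ∂labelMeasure := by
  conv_lhs => rw [← map_update_labelMeasure i]
  rw [integral_map (measurable_update_label i).aemeasurable hF.aestronglyMeasurable]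
  exact integral_prod _ (integrable_of_measurable_of_bound
    (hF.comp (measurable_update_label i)) fun q => hC _)

/-! ### Signed steps: centring and positive correlation. -/

/-- Signed reinforcement of the step at time `m`: positive for steps to the left. -/
noncomputable def signedStep (w : ℕ → ℝ) (X : ℕ → ℤ) (m : ℕ) : ℝ :=
  if X (m + 1) = X m - 1 then 1 / w (visitsBefore X m (X m - 1))
  else -(1 / w (visitsBefore X m (X m + 1)))

theorem measurable_signedStep (w : ℕ → ℝ) (m : ℕ) :
    Measurable fun u => signedStep w (drivenWalk w u) m := by
  have hX := measurable_drivenWalk w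
  have hw : Measurable w := measurable_of_countable w
  have hv : ∀ Y : Labels → ℤ, Measurable Y →
      Measurable fun u => visitsBefore (drivenWalk w u) m (Y u) := fun Y hY =>
    measurable_visitsBefore (X := fun k u => drivenWalk w u k) (fun k _ => hX k) hY
  unfold signedStep
  refine Measurable.ite (measurableSet_eq_fun (hX _) ((hX m).sub_const 1)) ?_ ?_
  · exact ((hw.comp (hv _ ((hX m).sub_const 1)))).const_div 1
  · exact ((hw.comp (hv _ ((hX m).add_const 1)))).const_div 1 |>.neg

theorem abs_signedStep_le {w : ℕ → ℝ} (hw : ∀ n, 0 < w n) (X : ℕ → ℤ) (m : ℕ) :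
    |signedStep w X m| ≤ ∑ k ∈ Finset.range (m + 1), 1 / w k := by
  have hb : ∀ y, visitsBefore X m y ∈ Finset.range (m + 1) := by
    intro y
    rw [Finset.mem_range, Nat.lt_succ_iff]
    exact (Finset.card_filter_le _ _).trans (by simp)
  have hpos : ∀ k, 0 < 1 / w k := fun k => one_div_pos.2 (hw k)
  have h : ∀ y, 1 / w (visitsBefore X m y) ≤ ∑ k ∈ Finset.range (m + 1), 1 / w k := fun y =>
    Finset.single_le_sum (f := fun k => 1 / w k) (fun k _ => (hpos k).le) (hb y)
  unfold signedStep
  split_ifs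
  · rw [abs_of_pos (hpos _)]; exact h _
  · rw [abs_neg, abs_of_pos (hpos _)]; exact h _

theorem integral_threshold (p : unitInterval) (α β : ℝ) :
    ∫ t : unitInterval, (if t < p then α else β) = α * p + β * (1 - p) := by
  have h1 : (fun t : unitInterval => if t < p then α else β) =
      fun t => (Set.Iio p).indicator (fun _ => α) t + (Set.Ici p).indicator (fun _ => β) t := by
    ext t
    by_cases h : t < p
    · simp [h]
    · simp [h, not_lt.1 h]
  rw [h1, integral_add, integral_indicator measurableSet_Iio, integral_indicator measurableSet_Ici]
  · have hp := p.2.1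
    have hp' : (0 : ℝ) ≤ 1 - p := sub_nonneg.2 p.2.2
    simp [Measure.real, unitInterval.volume_Iio, unitInterval.volume_Ici, ENNReal.toReal_ofReal hp,
      ENNReal.toReal_ofReal hp', mul_comm]
  · exact (integrable_const α).indicator measurableSet_Iio
  · exact (integrable_const β).indicator measurableSet_Ici

/-- One-variable form of the correlation inequality. The threshold function is centred and changes
sign only at `p`, so `f` may be replaced by its value `f p` at the cost of decreasing the integral.
-/
theorem integral_threshold_nonneg {f : unitInterval → ℝ} (hf : Antitone f) (p : unitInterval)
    {α β : ℝ} (hα : 0 ≤ α) (hβ : 0 ≤ β) (h0 : α * p = β * (1 - p)) :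
    0 ≤ ∫ t : unitInterval, f t * if t < p then α else -β := by
  have hint : Integrable fun t : unitInterval => f t * if t < p then α else -β := by
    refine integrable_of_measurable_of_bound (C := (|f 0| + |f 1|) * (α + β))
      (hf.measurable.mul (Measurable.ite measurableSet_Iio measurable_const measurable_const)) ?_
    intro t
    rw [abs_mul]
    have h1 : |f t| ≤ |f 0| + |f 1| := by
      rw [abs_le]
      constructor
      · have h2 : f 1 ≤ f t := hf unitInterval.le_one'
        have := neg_abs_le (f 1)
        have := abs_nonneg (f 0)
        linarith
      · have h2 : f t ≤ f 0 := hf unitInterval.nonneg'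
        have := le_abs_self (f 0)
        have := abs_nonneg (f 1)
        linarith
    refine mul_le_mul h1 ?_ (abs_nonneg _) (by positivity)
    split_ifs
    · rw [abs_of_nonneg hα]; linarith
    · rw [abs_neg, abs_of_nonneg hβ]; linarith
  have hc : ∫ t : unitInterval, f p * (if t < p then α else -β) = 0 := by
    rw [integral_const_mul, integral_threshold]
    have : α * (p : ℝ) + -β * (1 - p) = 0 := by linarith
    rw [this, mul_zero]
  rw [← hc]
  refine integral_mono ?_ hint ?_
  · exact (integrable_of_measurable_of_bound (C := α + β)
      (Measurable.ite measurableSet_Iio measurable_const measurable_const) fun t => by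
        split_ifs
        · rw [abs_of_nonneg hα]; linarith
        · rw [abs_neg, abs_of_nonneg hβ]; linarith).const_mul _
  · intro t
    simp only
    split_ifs with ht
    · exact mul_le_mul_of_nonneg_right (hf ht.le) hα
    · have := hf (not_lt.1 ht)
      nlinarith

/-- A functional of the labels that depends only on the walk up to time `m`. -/
def DependsUpTo (w : ℕ → ℝ) (m : ℕ) {β : Type*} (g : Labels → β) : Prop :=
  ∀ u u', (∀ j ≤ m, drivenWalk w u j = drivenWalk w u' j) → g u = g u'

theorem abs_drivenWalk_le (w : ℕ → ℝ) (u : Labels) (m : ℕ) : |drivenWalk w u m| ≤ m := by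
  induction m with
  | zero => simp [drivenWalk_zero]
  | succ m ih =>
    rw [abs_le] at ih ⊢
    push_cast
    rcases drivenWalk_nearestNeighbor w u m with h | h <;> constructor <;> omega

/-- Positive correlation of the signed step with functionals that favour the left. -/
theorem integral_signedStep_nonneg {w : ℕ → ℝ} (hw : ∀ n, 0 < w n) (m : ℕ) {g F : Labels → ℝ}
    (hg : DependsUpTo w m g) (hgm : Measurable g) {Cg : ℝ} (hgC : ∀ u, |g u| ≤ Cg)
    (hg0 : ∀ u, 0 ≤ g u) (hF : Antitone F) (hFm : Measurable F) {CF : ℝ}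
    (hFC : ∀ u, |F u| ≤ CF) :
    0 ≤ ∫ u, g u * (F u * signedStep w (drivenWalk w u) m) ∂labelMeasure := by
  classical
  set D : ℝ := ∑ k ∈ Finset.range (m + 1), 1 / w k with hD
  have hX := measurable_drivenWalk w
  set H : Labels → ℝ := fun u => g u * (F u * signedStep w (drivenWalk w u) m) with hH
  have hHm : Measurable H := hgm.mul (hFm.mul (measurable_signedStep w m))
  have hHC : ∀ u, |H u| ≤ Cg * (CF * D) := fun u => by
    rw [hH]
    simp only [abs_mul]
    have h1 := abs_signedStep_le hw (drivenWalk w u) m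
    have h2 : 0 ≤ Cg := (abs_nonneg _).trans (hgC u)
    have h3 : 0 ≤ CF := (abs_nonneg _).trans (hFC u)
    exact mul_le_mul (hgC u) (mul_le_mul (hFC u) h1 (abs_nonneg _) h3) (by positivity) h2
  -- Split according to which label, given by site and rank, decides the step at time `m`. Only
  -- finitely many are possible.
  let ev : ℤ × ℕ → Set Labels := fun i =>
    {u | drivenWalk w u m = i.1 ∧ visitsBefore (drivenWalk w u) m i.1 = i.2}
  have hev : ∀ i, MeasurableSet (ev i) := fun i =>
    (measurableSet_eq_fun (hX m) measurable_const).inter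
      (measurableSet_eq_fun (measurable_visitsBefore (X := fun k u => drivenWalk w u k)
        (fun k _ => hX k) measurable_const) measurable_const)
  let I : Finset (ℤ × ℕ) := Finset.Icc (-(m : ℤ)) m ×ˢ Finset.range (m + 1)
  have hsum : ∀ u, H u = ∑ i ∈ I, (ev i).indicator H u := by
    intro u
    have hmem : (drivenWalk w u m, visitsBefore (drivenWalk w u) m (drivenWalk w u m)) ∈ I := by
      have h1 := abs_le.1 (abs_drivenWalk_le w u m)
      have h2 : visitsBefore (drivenWalk w u) m (drivenWalk w u m) ≤ m :=
        (Finset.card_filter_le _ _).trans (by simp)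
      simp only [I, Finset.mem_product, Finset.mem_Icc, Finset.mem_range]
      omega
    rw [Finset.sum_eq_single_of_mem _ hmem, Set.indicator_of_mem]
    · exact ⟨rfl, rfl⟩
    · rintro ⟨x, k⟩ _ hne
      apply Set.indicator_of_notMem
      rintro ⟨h1, h2⟩
      simp only at h1 h2
      apply hne
      rw [h1, h2]
  have hint : ∀ i, ∀ u, |(ev i).indicator H u| ≤ Cg * (CF * D) := fun i u => by
    by_cases hu : u ∈ ev i
    · rw [Set.indicator_of_mem hu]; exact hHC u
    · rw [Set.indicator_of_notMem hu, abs_zero]; exact (abs_nonneg _).trans (hHC u)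
  rw [integral_congr_ae (Eventually.of_forall hsum), integral_finsetSum _ fun i _ =>
    integrable_of_measurable_of_bound (hHm.indicator (hev i)) (hint i)]
  refine Finset.sum_nonneg fun i _ => ?_
  -- Resample the deciding label. It does not influence the walk up to time `m`, so `g` stays
  -- constant, `F` is antitone in it, and the signed step is a centred threshold function of it.
  rw [integral_update_label i (hHm.indicator (hev i)) (hint i)]
  refine integral_nonneg fun u => ?_
  obtain ⟨x, k⟩ := i
  by_cases hk : visitsBefore (drivenWalk w u) m x = k
  swap
  · refine integral_nonneg fun t => ?_
    simp only [Pi.zero_apply]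
    rw [Set.indicator_of_notMem]
    rintro ⟨h1, h2⟩
    simp only at h1 h2
    -- Restoring the original label changes nothing up to time `m`, so the rank found after the
    -- update is also the rank for `u`.
    have h3 := drivenWalk_update (Function.update u (x, k) t) h2 (u (x, k))
    rw [Function.update_idem, Function.update_eq_self] at h3
    rw [visitsBefore_congr fun j hj => (h3 j hj.le).symm] at h2
    exact hk h2
  have hupd := fun t => drivenWalk_update u hk t
  by_cases hx : drivenWalk w u m = x
  swap
  · refine integral_nonneg fun t => ?_
    simp only [Pi.zero_apply]
    rw [Set.indicator_of_notMem]
    rintro ⟨h1, _⟩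
    exact hx ((hupd t m le_rfl).symm.trans h1)
  set a := visitsBefore (drivenWalk w u) m (x - 1) with ha
  set b := visitsBefore (drivenWalk w u) m (x + 1) with hb
  have hp : leftProb w a b ∈ unitInterval :=
    ⟨(leftProb_pos hw a b).le, (leftProb_lt_one hw a b).le⟩
  have hv : ∀ t y, visitsBefore (drivenWalk w (Function.update u (x, k) t)) m y =
      visitsBefore (drivenWalk w u) m y := fun t y =>
    visitsBefore_congr (fun j hj => hupd t j hj.le) y
  have hval : ∀ t : unitInterval, (ev (x, k)).indicator H (Function.update u (x, k) t) =
      g u * (F (Function.update u (x, k) t) *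
        if t < ⟨leftProb w a b, hp⟩ then 1 / w a else -(1 / w b)) := by
    intro t
    have h1 : drivenWalk w (Function.update u (x, k) t) m = x := (hupd t m le_rfl).trans hx
    rw [Set.indicator_of_mem]
    · simp only [hH]
      rw [hg _ u (hupd t)]
      congr 2
      unfold signedStep
      rw [drivenWalk_succ]
      simp only [h1, hv, hk, ← ha, ← hb, Function.update_self, ← Subtype.coe_lt_coe]
      split_ifs <;> first | rfl | omega
    · exact ⟨h1, (hv t x).trans hk⟩
  simp only [Pi.zero_apply]
  rw [integral_congr_ae (Eventually.of_forall hval), integral_const_mul]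
  refine mul_nonneg (hg0 u) (integral_threshold_nonneg ?_ _ ?_ ?_ ?_)
  · intro t t' htt
    exact hF (update_le_update_iff'.2 htt)
  · exact (one_div_pos.2 (hw a)).le
  · exact (one_div_pos.2 (hw b)).le
  · rw [one_sub_leftProb hw]
    have := hw a
    have := hw b
    simp only [leftProb]
    field_simp

/-- The constants `1` and `-1` are both antitone, so the correlation inequality holds in both
directions. A signed `g` is first shifted by `Cg` to become nonnegative. -/
theorem integral_signedStep_eq_zero {w : ℕ → ℝ} (hw : ∀ n, 0 < w n) (m : ℕ) {g : Labels → ℝ}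
    (hg : DependsUpTo w m g) (hgm : Measurable g) {Cg : ℝ} (hgC : ∀ u, |g u| ≤ Cg) :
    ∫ u, g u * signedStep w (drivenWalk w u) m ∂labelMeasure = 0 := by
  have key : ∀ {f : Labels → ℝ}, DependsUpTo w m f → Measurable f → ∀ {C : ℝ},
      (∀ u, |f u| ≤ C) → (∀ u, 0 ≤ f u) →
      ∫ u, f u * signedStep w (drivenWalk w u) m ∂labelMeasure = 0 := by
    intro f hf hfm C hC h0
    have h1 := integral_signedStep_nonneg hw m hf hfm hC h0 (F := fun _ => 1) (CF := 1)
      antitone_const measurable_const (by simp)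
    have h2 := integral_signedStep_nonneg hw m hf hfm hC h0 (F := fun _ => -1) (CF := 1)
      antitone_const measurable_const (by simp)
    simp only [one_mul, neg_mul, mul_neg, integral_neg] at h1 h2
    linarith
  have hC0 : 0 ≤ Cg := (abs_nonneg _).trans (hgC fun _ => 0)
  have h1 := key (f := fun u => g u + Cg) (fun u u' h => by simp only [hg u u' h])
    (hgm.add_const _) (C := Cg + Cg)
    (fun u => (abs_add_le _ _).trans (add_le_add (hgC u) (abs_of_nonneg hC0).le))
    (fun u => by have := (abs_le.1 (hgC u)).1; linarith)
  have h2 := key (f := fun _ => Cg) (fun u u' h => rfl) measurable_const (C := Cg)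
    (fun u => (abs_of_nonneg hC0).le) (fun u => hC0)
  have hint : ∀ {f : Labels → ℝ}, Measurable f → ∀ {C : ℝ}, (∀ u, |f u| ≤ C) →
      Integrable (fun u => f u * signedStep w (drivenWalk w u) m) labelMeasure := by
    intro f hfm C hC
    refine integrable_of_measurable_of_bound (hfm.mul (measurable_signedStep w m))
      (C := C * ∑ k ∈ Finset.range (m + 1), 1 / w k) fun u => ?_
    rw [abs_mul]
    exact mul_le_mul (hC u) (abs_signedStep_le hw _ m) (abs_nonneg _)
      ((abs_nonneg _).trans (hC u))
  simp only [add_mul] at h1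
  rw [integral_add (hint hgm hgC) (hint measurable_const (C := Cg)
    fun _ => (abs_of_nonneg hC0).le), h2, add_zero] at h1
  exact h1

/-! ### Tail sums and the potential of an interval. -/

/-- Tail sums of a series. -/
noncomputable def tailSum (f : ℕ → ℝ) (m : ℕ) : ℝ := ∑' j, f (j + m)

theorem tailSum_eq_add {f : ℕ → ℝ} (hf : Summable f) (m : ℕ) :
    tailSum f m = f m + tailSum f (m + 1) := by
  unfold tailSum
  rw [((summable_nat_add_iff m).2 hf).tsum_eq_zero_add]
  simp only [zero_add]
  congr 2
  ext j
  congr 1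
  omega

theorem tailSum_nonneg {f : ℕ → ℝ} (h0 : ∀ n, 0 ≤ f n) (m : ℕ) : 0 ≤ tailSum f m :=
  tsum_nonneg fun _ => h0 _

theorem tailSum_le {f : ℕ → ℝ} (hf : Summable f) (h0 : ∀ n, 0 ≤ f n) (m : ℕ) :
    tailSum f m ≤ tailSum f 0 := by
  induction m with
  | zero => rfl
  | succ m ih => have := tailSum_eq_add hf m; have := h0 m; linarith

theorem tendsto_tailSum (f : ℕ → ℝ) : Tendsto (tailSum f) atTop (nhds 0) :=
  tendsto_sum_nat_add f

/-- Total tail mass still available at the sites of `[a, b]` at time `k`. -/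
noncomputable def potential (f : ℕ → ℝ) (a b : ℤ) (X : ℕ → ℤ) (k : ℕ) : ℝ :=
  ∑ y ∈ Finset.Icc a b, tailSum f (visitsBefore X (k + 1) y)

theorem potential_nonneg {f : ℕ → ℝ} (h0 : ∀ n, 0 ≤ f n) (a b : ℤ) (X : ℕ → ℤ) (k : ℕ) :
    0 ≤ potential f a b X k :=
  Finset.sum_nonneg fun _ _ => tailSum_nonneg h0 _

theorem potential_le {f : ℕ → ℝ} (hf : Summable f) (h0 : ∀ n, 0 ≤ f n) (a b : ℤ) (X : ℕ → ℤ)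
    (k : ℕ) : potential f a b X k ≤ (Finset.Icc a b).card * tailSum f 0 := by
  unfold potential
  refine (Finset.sum_le_card_nsmul _ _ _ fun y _ => tailSum_le hf h0 _).trans ?_
  rw [nsmul_eq_mul]

/-- Each arrival in `[a, b]` uses up the first term of the tail at the site reached. With `1 / w`
for `f` this bounds the total variation of the interior steps, and with `(1 / w) ^ 2` their
quadratic variation. -/
theorem potential_sub_succ {f : ℕ → ℝ} (hf : Summable f) (a b : ℤ) (X : ℕ → ℤ) (k : ℕ) :
    potential f a b X k - potential f a b X (k + 1) =
      if X (k + 1) ∈ Finset.Icc a b then f (visitsBefore X (k + 1) (X (k + 1))) else 0 := by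
  unfold potential
  rw [← Finset.sum_sub_distrib, ← Finset.sum_ite_eq (Finset.Icc a b) (X (k + 1))
    fun y => f (visitsBefore X (k + 1) y)]
  refine Finset.sum_congr rfl fun y _ => ?_
  rw [visitsBefore_succ X (k + 1)]
  split_ifs
  · have := tailSum_eq_add hf (visitsBefore X (k + 1) y); linarith
  · simp

theorem potential_succ_le {f : ℕ → ℝ} (hf : Summable f) (h0 : ∀ n, 0 ≤ f n) (a b : ℤ)
    (X : ℕ → ℤ) (k : ℕ) : potential f a b X (k + 1) ≤ potential f a b X k := by
  have := potential_sub_succ hf a b X k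
  split_ifs at this
  · have := h0 (visitsBefore X (k + 1) (X (k + 1))); linarith
  · linarith

theorem tendsto_potential (f : ℕ → ℝ) {a b : ℤ} {X : ℕ → ℤ}
    (h : ∀ y ∈ Finset.Icc a b, Tendsto (fun k => visitsBefore X k y) atTop atTop) :
    Tendsto (potential f a b X) atTop (nhds 0) := by
  have : Tendsto (fun k => ∑ y ∈ Finset.Icc a b, tailSum f (visitsBefore X (k + 1) y)) atTop
      (nhds (∑ y ∈ Finset.Icc a b, 0)) :=
    tendsto_finsetSum _ fun y hy =>
      (tendsto_tailSum f).comp ((h y hy).comp (tendsto_add_atTop_nat 1))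
  rw [Finset.sum_const_zero] at this
  exact this

/-! ### Interior steps and trapped paths. -/

/-- The signed step, restricted to departures from the interior of `[a, b]`. -/
noncomputable def interiorStep (w : ℕ → ℝ) (a b : ℤ) (X : ℕ → ℤ) (k : ℕ) : ℝ :=
  if a < X k ∧ X k < b then signedStep w X k else 0

theorem visitsBefore_succ_next {X : ℕ → ℤ} (hX : IsNearestNeighbor X) (k : ℕ) :
    visitsBefore X (k + 1) (X (k + 1)) = visitsBefore X k (X (k + 1)) := by
  rw [visitsBefore_succ, if_neg, add_zero]
  rcases hX k with h | h <;> omega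

theorem abs_signedStep {w : ℕ → ℝ} (hw : ∀ n, 0 < w n) {X : ℕ → ℤ} (hX : IsNearestNeighbor X)
    (k : ℕ) : |signedStep w X k| = 1 / w (visitsBefore X (k + 1) (X (k + 1))) := by
  have hpos : ∀ k, 0 < 1 / w k := fun k => one_div_pos.2 (hw k)
  rw [visitsBefore_succ_next hX]
  unfold signedStep
  rcases hX k with h | h
  · rw [if_pos h, abs_of_pos (hpos _), h]
  · rw [if_neg (by omega), abs_neg, abs_of_pos (hpos _), h]

theorem abs_interiorStep_le {w : ℕ → ℝ} (hw : ∀ n, 0 < w n) (hs : Summable fun k => 1 / w k)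
    {a b : ℤ} {X : ℕ → ℤ} (hX : IsNearestNeighbor X) (k : ℕ) :
    |interiorStep w a b X k| ≤
      potential (fun k => 1 / w k) a b X k - potential (fun k => 1 / w k) a b X (k + 1) := by
  unfold interiorStep
  split_ifs with h
  · rw [potential_sub_succ hs, if_pos, abs_signedStep hw hX]
    rw [Finset.mem_Icc]
    rcases hX k with h' | h' <;> omega
  · have := potential_succ_le hs (fun n => (one_div_pos.2 (hw n)).le) a b X k
    rw [abs_zero]
    linarith

theorem interiorStep_sq_le {w : ℕ → ℝ} (hw : ∀ n, 0 < w n)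
    (hs : Summable fun k => (1 / w k) ^ 2) {a b : ℤ} {X : ℕ → ℤ} (hX : IsNearestNeighbor X)
    (k : ℕ) :
    interiorStep w a b X k ^ 2 ≤
      potential (fun k => (1 / w k) ^ 2) a b X k -
        potential (fun k => (1 / w k) ^ 2) a b X (k + 1) := by
  unfold interiorStep
  split_ifs with h
  · rw [potential_sub_succ hs, if_pos, ← sq_abs, abs_signedStep hw hX]
    rw [Finset.mem_Icc]
    rcases hX k with h' | h' <;> omega
  · have := potential_succ_le hs (fun n => sq_nonneg _) a b X k
    simp only [ne_eq, OfNat.ofNat_ne_zero, not_false_eq_true, zero_pow]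
    linarith

theorem sum_abs_interiorStep_le {w : ℕ → ℝ} (hw : ∀ n, 0 < w n)
    (hs : Summable fun k => 1 / w k) {a b : ℤ} {X : ℕ → ℤ} (hX : IsNearestNeighbor X)
    (n m : ℕ) :
    ∑ i ∈ Finset.range m, |interiorStep w a b X (n + i)| ≤
      (Finset.Icc a b).card * tailSum (fun k => 1 / w k) 0 := by
  have h0 : ∀ k, 0 ≤ 1 / w k := fun k => (one_div_pos.2 (hw k)).le
  have h : ∑ i ∈ Finset.range m, |interiorStep w a b X (n + i)| ≤
      potential (fun k => 1 / w k) a b X n - potential (fun k => 1 / w k) a b X (n + m) := by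
    induction m with
    | zero => simp
    | succ m ih =>
      rw [Finset.sum_range_succ]
      have := abs_interiorStep_le (a := a) (b := b) hw hs hX (n + m)
      rw [← add_assoc]
      linarith
  have h1 := potential_le hs h0 a b X n
  have h2 := potential_nonneg h0 a b X (n + m)
  linarith

theorem summable_interiorStep {w : ℕ → ℝ} (hw : ∀ n, 0 < w n)
    (hs : Summable fun k => 1 / w k) (a b : ℤ) {X : ℕ → ℤ} (hX : IsNearestNeighbor X) (n : ℕ) :
    Summable fun i => interiorStep w a b X (n + i) :=
  Summable.of_abs (summable_of_sum_range_le (fun _ => abs_nonneg _)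
    (sum_abs_interiorStep_le hw hs hX n))

/-- From time `N` on the path stays in `[a, b]`, where it visits every site infinitely often, and
the end points are not visited more often than their neighbours. -/
def IsTrappedIn (a b : ℤ) (N : ℕ) (X : ℕ → ℤ) : Prop :=
  (∀ k ≥ N, a ≤ X k ∧ X k ≤ b ∧
    visitsBefore X (k + 1) a ≤ visitsBefore X (k + 1) (a + 1) + 1 ∧
    visitsBefore X (k + 1) b ≤ visitsBefore X (k + 1) (b - 1) + 1) ∧
  ∀ y ∈ Finset.Icc a b, ∀ m, ∃ k ≥ m, X k = y

theorem tendsto_visitsBefore {X : ℕ → ℤ} {y : ℤ} (h : ∀ m, ∃ k ≥ m, X k = y) :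
    Tendsto (fun k => visitsBefore X k y) atTop atTop := by
  refine tendsto_atTop_atTop_of_monotone (visitsBefore_mono X y) fun b => ?_
  by_contra! hb
  obtain ⟨T, hT⟩ := eventually_ne_of_visitsBefore_le fun t => (hb t).le
  obtain ⟨k, hk, hk'⟩ := h T
  exact hT k hk hk'

/-- Lower bound for the quadratic variation. On a trapped path the potential is entirely used up by
arrivals. Those coming from an end point are not interior steps, but each is charged to the interior
step that led to that end point, whence the factor `2`. Starting at `a + 1` ensures that the first
step is interior. -/
theorem IsTrappedIn.potential_le {w : ℕ → ℝ} (hw : ∀ n, 0 < w n) (hm : Monotone w)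
    (hs : Summable fun k => (1 / w k) ^ 2) {a b : ℤ} (hab : a + 2 ≤ b) {N : ℕ} {X : ℕ → ℤ}
    (hX : IsNearestNeighbor X) (h : IsTrappedIn a b N X) {n : ℕ} (hn : N ≤ n)
    (hXn : X n = a + 1) {A : ℝ}
    (hA : ∀ m, ∑ i ∈ Finset.range m, interiorStep w a b X (n + i) ^ 2 ≤ A) :
    potential (fun k => (1 / w k) ^ 2) a b X n ≤ 2 * A := by
  set f : ℕ → ℝ := fun k => (1 / w k) ^ 2 with hf
  have hfm : ∀ {i j}, i ≤ j → f j ≤ f i := fun {i j} hij =>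
    pow_le_pow_left₀ (one_div_pos.2 (hw j)).le (one_div_le_one_div_of_le (hw i) (hm hij)) 2
  have hsq : ∀ k, a < X k ∧ X k < b →
      interiorStep w a b X k ^ 2 = f (visitsBefore X (k + 1) (X (k + 1))) := by
    intro k hk
    unfold interiorStep
    rw [if_pos hk, ← sq_abs, abs_signedStep hw hX]
  have hstep0 : ∀ k ≥ N, potential f a b X k - potential f a b X (k + 1) =
      f (visitsBefore X (k + 1) (X (k + 1))) := by
    intro k hk
    rw [potential_sub_succ hs, if_pos]
    have := h.1 (k + 1) (by omega)
    rw [Finset.mem_Icc]; omega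
  have hstep : ∀ k ≥ n, potential f a b X (k + 1) - potential f a b X (k + 2) ≤
      interiorStep w a b X (k + 1) ^ 2 + interiorStep w a b X k ^ 2 := by
    intro k hk
    have h1 := h.1 (k + 1) (by omega)
    have h0 := h.1 k (by omega)
    rw [hstep0 (k + 1) (by omega)]
    by_cases hint : a < X (k + 1) ∧ X (k + 1) < b
    · rw [hsq _ hint]
      have := sq_nonneg (interiorStep w a b X k)
      linarith
    · have h2 := h.1 (k + 1 + 1) (by omega)
      have hk2 : a < X k ∧ X k < b := by rcases hX k with h' | h' <;> omega
      rw [hsq k hk2]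
      -- An end point has at most one more visit than its neighbour, and the latest arrival accounts
      -- for that one; `f` is decreasing since `w` is monotone.
      have hle : f (visitsBefore X (k + 1 + 1) (X (k + 1 + 1))) ≤
          f (visitsBefore X (k + 1) (X (k + 1))) := by
        apply hfm
        have hv := visitsBefore_succ X (k + 1) (X (k + 1))
        rw [if_pos rfl] at hv
        rcases (show X (k + 1) = a ∨ X (k + 1) = b by omega) with he | he
        · have hx : X (k + 1 + 1) = a + 1 := by rcases hX (k + 1) with h' | h' <;> omega
          rw [hx]
          rw [he] at hv ⊢
          omega
        · have hx : X (k + 1 + 1) = b - 1 := by rcases hX (k + 1) with h' | h' <;> omega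
          rw [hx]
          rw [he] at hv ⊢
          omega
      have := sq_nonneg (interiorStep w a b X (k + 1))
      linarith
  have hsum : ∀ m, potential f a b X n - potential f a b X (n + (m + 1)) ≤
      ∑ i ∈ Finset.range (m + 1), interiorStep w a b X (n + i) ^ 2 +
        ∑ i ∈ Finset.range m, interiorStep w a b X (n + i) ^ 2 := by
    intro m
    induction m with
    | zero =>
      simp only [zero_add, Finset.range_one, Finset.sum_singleton, add_zero, Finset.range_zero,
        Finset.sum_empty]
      rw [hstep0 n hn, hsq n (by omega)]
    | succ m ih =>
      rw [Finset.sum_range_succ, Finset.sum_range_succ (n := m)]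
      rw [Finset.sum_range_succ (n := m)] at ih
      have := hstep (n + m) (by omega)
      simp only [← add_assoc] at this ih ⊢
      linarith
  have hlim : Tendsto (fun m => potential f a b X n - potential f a b X (n + (m + 1))) atTop
      (nhds (potential f a b X n - 0)) :=
    tendsto_const_nhds.sub ((tendsto_potential f fun y hy => tendsto_visitsBefore (h.2 y hy)).comp
      (tendsto_atTop_mono (fun m => by simp only [id]; omega) tendsto_id))
  rw [sub_zero] at hlim
  refine le_of_tendsto' hlim fun m => (hsum m).trans ?_
  have := hA m
  have := hA (m + 1)
  linarith

/-! ### Interior steps expressed through arrivals and departures. -/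

/-- Total weight of the departures from `y` to the left, from rank `m` on. -/
noncomputable def leftWeight (w : ℕ → ℝ) (X : ℕ → ℤ) (y : ℤ) (m : ℕ) : ℝ :=
  open Classical in ∑' i, if DepartsLeft X y (i + m) then 1 / w (i + m) else 0

theorem summable_leftWeight {w : ℕ → ℝ} (hw : ∀ n, 0 < w n) (hs : Summable fun k => 1 / w k)
    (X : ℕ → ℤ) (y : ℤ) (m : ℕ) [DecidablePred fun i => DepartsLeft X y (i + m)] :
    Summable fun i => if DepartsLeft X y (i + m) then 1 / w (i + m) else 0 := by
  refine Summable.of_nonneg_of_le (fun i => ?_) (fun i => ?_) ((summable_nat_add_iff m).2 hs)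
  · split_ifs
    · exact (one_div_pos.2 (hw _)).le
    · exact le_rfl
  · split_ifs
    · exact le_rfl
    · exact (one_div_pos.2 (hw _)).le

theorem IsLeftCoupling.leftWeight_le {w : ℕ → ℝ} (hw : ∀ n, 0 < w n)
    (hs : Summable fun k => 1 / w k) {A B : ℕ → ℤ} (h : IsLeftCoupling A B) (y : ℤ) {m : ℕ}
    (hm : 1 ≤ m) : leftWeight w A y m ≤ leftWeight w B y m := by
  classical
  unfold leftWeight
  refine (summable_leftWeight hw hs A y m).tsum_le_tsum (fun i => ?_)
    (summable_leftWeight hw hs B y m)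
  by_cases hA : DepartsLeft A y (i + m)
  · rw [if_pos hA, if_pos (h.departsLeft (by omega) hA)]
  · rw [if_neg hA]
    split_ifs
    · exact (one_div_pos.2 (hw _)).le
    · exact le_rfl

/-- Between a departure from `y` and the next arrival the path stays on one side, so an arrival
comes from the side of the preceding departure. Arrivals thereby inherit the monotonicity of
departures. -/
theorem IsNearestNeighbor.departsLeft_iff {X : ℕ → ℤ} (hX : IsNearestNeighbor X) {k : ℕ} {y : ℤ}
    (hk : X (k + 1) = y) : DepartsLeft X y (visitsBefore X k y) ↔ X k = y - 1 := by
  constructor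
  · rintro ⟨T, hT, hv, h⟩
    have hne : X k ≠ y := by rcases hX k with h' | h' <;> omega
    have hTk : T ≤ k := by
      by_contra! hlt
      rcases (show T = k + 1 ∨ k + 1 < T by omega) with h' | h'
      · rw [h'] at hT; omega
      · have := visitsBefore_lt_of_visit hk h'
        have h3 := visitsBefore_succ X k y
        omega
    have h' := h.resolve_right fun hf => by have := hf (k + 1) (by omega); omega
    have := hX.lt_of_visitsBefore_eq hTk hT h' hne
    rcases hX k with h' | h' <;> omega
  · intro h
    exact ⟨k, by omega, le_rfl, Or.inl rfl⟩

/-- Weight of the arrivals at `y` from the left during the `m` steps following time `n`. -/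
noncomputable def leftArrivals (w : ℕ → ℝ) (X : ℕ → ℤ) (y : ℤ) (n m : ℕ) : ℝ :=
  ∑ i ∈ Finset.range m,
    if X (n + i) = y - 1 ∧ X (n + i + 1) = y then 1 / w (visitsBefore X (n + i + 1) y) else 0

/-- Weight of the arrivals at `y` from the right during the `m` steps following time `n`. -/
noncomputable def rightArrivals (w : ℕ → ℝ) (X : ℕ → ℤ) (y : ℤ) (n m : ℕ) : ℝ :=
  ∑ i ∈ Finset.range m,
    if X (n + i) = y + 1 ∧ X (n + i + 1) = y then 1 / w (visitsBefore X (n + i + 1) y) else 0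

/-- Group the steps by target. A left step from the interior lands in `[a, b - 2]` and a right step
in `[a + 2, b]`, and conversely such arrivals from the stated side start in the interior. -/
theorem sum_interiorStep (w : ℕ → ℝ) (a b : ℤ) {X : ℕ → ℤ} (hX : IsNearestNeighbor X)
    (n m : ℕ) :
    ∑ i ∈ Finset.range m, interiorStep w a b X (n + i) =
      ∑ y ∈ Finset.Icc a (b - 2), rightArrivals w X y n m -
        ∑ y ∈ Finset.Icc (a + 2) b, leftArrivals w X y n m := by
  unfold leftArrivals rightArrivals
  rw [Finset.sum_comm, Finset.sum_comm (s := Finset.Icc (a + 2) b), ← Finset.sum_sub_distrib]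
  refine Finset.sum_congr rfl fun i _ => ?_
  set k := n + i
  have h1 : ∑ y ∈ Finset.Icc a (b - 2),
      (if X k = y + 1 ∧ X (k + 1) = y then 1 / w (visitsBefore X (k + 1) y) else 0) =
      if X (k + 1) ∈ Finset.Icc a (b - 2) then
        (if X k = X (k + 1) + 1 then 1 / w (visitsBefore X (k + 1) (X (k + 1))) else 0)
      else 0 := by
    rw [← Finset.sum_ite_eq (Finset.Icc a (b - 2)) (X (k + 1)) fun y =>
      if X k = y + 1 then 1 / w (visitsBefore X (k + 1) y) else 0]
    refine Finset.sum_congr rfl fun y _ => ?_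
    by_cases hy : X (k + 1) = y
    · subst hy; simp
    · simp [hy]
  have h2 : ∑ y ∈ Finset.Icc (a + 2) b,
      (if X k = y - 1 ∧ X (k + 1) = y then 1 / w (visitsBefore X (k + 1) y) else 0) =
      if X (k + 1) ∈ Finset.Icc (a + 2) b then
        (if X k = X (k + 1) - 1 then 1 / w (visitsBefore X (k + 1) (X (k + 1))) else 0)
      else 0 := by
    rw [← Finset.sum_ite_eq (Finset.Icc (a + 2) b) (X (k + 1)) fun y =>
      if X k = y - 1 then 1 / w (visitsBefore X (k + 1) y) else 0]
    refine Finset.sum_congr rfl fun y _ => ?_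
    by_cases hy : X (k + 1) = y
    · subst hy; simp
    · simp [hy]
  rw [h1, h2, visitsBefore_succ_next hX]
  unfold interiorStep signedStep
  simp only [Finset.mem_Icc]
  rcases hX k with h | h
  · have e1 : ¬ X k = X (k + 1) - 1 := by omega
    have e2 : X k = X (k + 1) + 1 := by omega
    rw [if_neg e1, if_pos e2, if_pos h, ite_self, sub_zero, ← h]
    refine if_congr ?_ rfl rfl
    omega
  · have e1 : X k = X (k + 1) - 1 := by omega
    have e2 : ¬ X k = X (k + 1) + 1 := by omega
    have e3 : ¬ X (k + 1) = X k - 1 := by omega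
    rw [if_pos e1, if_neg e2, if_neg e3, ite_self, zero_sub, ← h]
    have : (a < X k ∧ X k < b) ↔ (a + 2 ≤ X (k + 1) ∧ X (k + 1) ≤ b) := by omega
    rw [if_congr this rfl rfl]
    split_ifs <;> simp

/-- All arrivals together use up a segment of the tail, so arrivals from the right are what those
from the left leave over. This expresses the whole sum through left arrivals alone. -/
theorem rightArrivals_eq {w : ℕ → ℝ} (hs : Summable fun k => 1 / w k) {X : ℕ → ℤ}
    (hX : IsNearestNeighbor X) (y : ℤ) (n m : ℕ) :
    rightArrivals w X y n m = tailSum (fun k => 1 / w k) (visitsBefore X (n + 1) y) -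
      tailSum (fun k => 1 / w k) (visitsBefore X (n + m + 1) y) - leftArrivals w X y n m := by
  unfold rightArrivals leftArrivals
  induction m with
  | zero => simp
  | succ m ih =>
    rw [Finset.sum_range_succ, Finset.sum_range_succ, ih, ← add_assoc,
      visitsBefore_succ X (n + m + 1)]
    have ht := tailSum_eq_add hs (visitsBefore X (n + m + 1) y)
    by_cases hy : X (n + m + 1) = y
    · rcases hX (n + m) with h | h
      · have e1 : X (n + m) = y + 1 := by omega
        have e2 : ¬ X (n + m) = y - 1 := by omega
        rw [if_pos (⟨e1, hy⟩ : X (n + m) = y + 1 ∧ X (n + m + 1) = y),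
          if_neg (fun h' : X (n + m) = y - 1 ∧ X (n + m + 1) = y => e2 h'.1), if_pos hy, ht]
        ring
      · have e1 : ¬ X (n + m) = y + 1 := by omega
        have e2 : X (n + m) = y - 1 := by omega
        rw [if_neg (fun h' : X (n + m) = y + 1 ∧ X (n + m + 1) = y => e1 h'.1),
          if_pos (⟨e2, hy⟩ : X (n + m) = y - 1 ∧ X (n + m + 1) = y), if_pos hy, ht]
        ring
    · simp only [hy, and_false, if_false, add_zero]

-- Reindexing by rank: successive arrivals at `y` carry consecutive ranks, and whether each comes
-- from the left is read off from `DepartsLeft`.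
open Classical in
theorem leftArrivals_eq (w : ℕ → ℝ) {X : ℕ → ℤ} (hX : IsNearestNeighbor X) (y : ℤ) (n m : ℕ) :
    leftArrivals w X y n m =
      ∑ i ∈ Finset.range (visitsBefore X (n + m + 1) y - visitsBefore X (n + 1) y),
        if DepartsLeft X y (i + visitsBefore X (n + 1) y) then
          1 / w (i + visitsBefore X (n + 1) y) else 0 := by
  unfold leftArrivals
  induction m with
  | zero => simp
  | succ m ih =>
    have hle := visitsBefore_mono X y (show n + 1 ≤ n + m + 1 by omega)
    simp only at hle
    rw [Finset.sum_range_succ, ih, ← add_assoc, visitsBefore_succ X (n + m + 1)]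
    by_cases hy : X (n + m + 1) = y
    · have hne : X (n + m) ≠ y := by rcases hX (n + m) with h | h <;> omega
      have hd := hX.departsLeft_iff hy
      have hv := visitsBefore_succ X (n + m) y
      rw [if_neg hne, add_zero] at hv
      rw [if_pos hy, Nat.sub_add_comm hle, Finset.sum_range_succ, Nat.sub_add_cancel hle]
      congr 1
      rw [← hv] at hd
      exact if_congr (by rw [hd]; exact and_iff_left hy) rfl rfl
    · rw [if_neg hy, add_zero, if_neg (by omega), add_zero]

theorem tendsto_leftArrivals {w : ℕ → ℝ} (hw : ∀ n, 0 < w n) (hs : Summable fun k => 1 / w k)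
    {X : ℕ → ℤ} (hX : IsNearestNeighbor X) {y : ℤ} (h : ∀ m, ∃ k ≥ m, X k = y) (n : ℕ) :
    Tendsto (leftArrivals w X y n) atTop
      (nhds (leftWeight w X y (visitsBefore X (n + 1) y))) := by
  classical
  have h1 := (summable_leftWeight hw hs X y (visitsBefore X (n + 1) y)).hasSum.tendsto_sum_nat
  have h2 : Tendsto (fun m => visitsBefore X (n + m + 1) y - visitsBefore X (n + 1) y)
      atTop atTop := by
    refine (tendsto_sub_atTop_nat _).comp ((tendsto_visitsBefore h).comp ?_)
    exact tendsto_atTop_mono (fun m => by simp only [id]; omega) tendsto_id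
  have h3 := h1.comp h2
  unfold leftWeight
  refine h3.congr fun m => ?_
  rw [leftArrivals_eq w hX]
  rfl

/-- Total left weight of the sites of `[a, b]`, from the ranks `m` on. -/
noncomputable def totalLeftWeight (w : ℕ → ℝ) (a b : ℤ) (m : ℤ → ℕ) (X : ℕ → ℤ) : ℝ :=
  ∑ y ∈ Finset.Icc a (b - 2), leftWeight w X y (m y) +
    ∑ y ∈ Finset.Icc (a + 2) b, leftWeight w X y (m y)

/-- On trapped paths the sum of the interior steps is a decreasing function of the total left
weight. -/
theorem IsTrappedIn.tsum_interiorStep {w : ℕ → ℝ} (hw : ∀ n, 0 < w n)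
    (hs : Summable fun k => 1 / w k) {a b : ℤ} {N : ℕ} {X : ℕ → ℤ} (hX : IsNearestNeighbor X)
    (h : IsTrappedIn a b N X) (n : ℕ) :
    ∑' i, interiorStep w a b X (n + i) =
      ∑ y ∈ Finset.Icc a (b - 2), tailSum (fun k => 1 / w k) (visitsBefore X (n + 1) y) -
        totalLeftWeight w a b (visitsBefore X (n + 1)) X := by
  have h1 := (summable_interiorStep hw hs a b hX n).hasSum.tendsto_sum_nat
  have hmem1 : ∀ y ∈ Finset.Icc a (b - 2), y ∈ Finset.Icc a b := fun y hy => by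
    rw [Finset.mem_Icc] at *; omega
  have hmem2 : ∀ y ∈ Finset.Icc (a + 2) b, y ∈ Finset.Icc a b := fun y hy => by
    rw [Finset.mem_Icc] at *; omega
  have h2 : Tendsto (fun m => ∑ y ∈ Finset.Icc a (b - 2), rightArrivals w X y n m -
      ∑ y ∈ Finset.Icc (a + 2) b, leftArrivals w X y n m) atTop
      (nhds (∑ y ∈ Finset.Icc a (b - 2),
        (tailSum (fun k => 1 / w k) (visitsBefore X (n + 1) y) - 0 -
          leftWeight w X y (visitsBefore X (n + 1) y)) -
        ∑ y ∈ Finset.Icc (a + 2) b, leftWeight w X y (visitsBefore X (n + 1) y))) := by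
    refine Tendsto.sub (tendsto_finsetSum _ fun y hy => ?_) (tendsto_finsetSum _ fun y hy =>
      tendsto_leftArrivals hw hs hX (h.2 y (hmem2 y hy)) n)
    have hy' := h.2 y (hmem1 y hy)
    refine Tendsto.congr (fun m => (rightArrivals_eq hs hX y n m).symm) ?_
    refine Tendsto.sub (tendsto_const_nhds.sub ((tendsto_tailSum _).comp
      ((tendsto_visitsBefore hy').comp ?_))) (tendsto_leftArrivals hw hs hX hy' n)
    exact tendsto_atTop_mono (fun m => by simp only [id]; omega) tendsto_id
  have h3 := tendsto_nhds_unique (h1.congr fun m => sum_interiorStep w a b hX n m) h2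
  rw [h3]
  simp only [sub_zero, Finset.sum_sub_distrib, totalLeftWeight]
  ring

/-! ### The moment contradiction. -/

/-- A centred function whose fourth moment is comparable to the square of its second moment cannot
be negative on nearly all of a set where it has a nonnegative integral. -/
theorem measureReal_eq_zero_of_moments {Ω : Type*} [MeasurableSpace Ω] {ν : Measure Ω}
    [IsFiniteMeasure ν] {M : Ω → ℝ} (hM : Measurable M) {C : ℝ} (hC : ∀ x, |M x| ≤ C)
    {E L : Set Ω} (hE : MeasurableSet E) (hL : MeasurableSet L) {σ : ℝ} (hσ : 0 < σ)
    (h1 : ∫ x, M x ∂ν = 0)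
    (h4 : ∫ x, M x ^ 4 ∂ν ≤ 35 * σ ^ 2 * ν.real Set.univ)
    (hlow : σ / 2 * ν.real E ≤ ∫ x, M x ^ 2 ∂ν) (hpos : 0 ≤ ∫ x in L, M x ∂ν)
    (hEL : ∀ᵐ x ∂ν, x ∈ E → (x ∈ L ↔ M x < 0))
    (hsmall : ν.real Eᶜ ≤ 1 / 10 ^ 6 * ν.real Set.univ) : ν.real Set.univ = 0 := by
  classical
  set q := ν.real Set.univ with hq
  set r := Real.sqrt σ with hr
  have hr0 : 0 < r := Real.sqrt_pos.2 hσ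
  have hrr : r ^ 2 = σ := Real.sq_sqrt hσ.le
  have iM : Integrable M ν := integrable_of_measurable_of_bound hM hC
  have iP : ∀ k : ℕ, Integrable (fun x => M x ^ k) ν := fun k =>
    integrable_of_measurable_of_bound (hM.pow_const k) (C := C ^ k) fun x => by
      rw [abs_pow]; exact pow_le_pow_left₀ (abs_nonneg _) (hC x) k
  have iL : Integrable (L.indicator M) ν := iM.indicator hL
  have iE : Integrable (Eᶜ.indicator fun _ => (1 : ℝ)) ν :=
    (integrable_const (1 : ℝ)).indicator hE.compl
  have hpt : ∀ᵐ x ∂ν, M x ^ 2 ≤ 20 * r * M x - 40 * r * L.indicator M x + 8 / 100 * M x ^ 2 +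
      80000 * σ * Eᶜ.indicator (fun _ => (1 : ℝ)) x + 1 / (400 * σ) * M x ^ 4 := by
    filter_upwards [hEL] with x hx
    -- Truncation at `20 * √σ`: beyond it the second power is dominated by the fourth.
    have p1 : M x ^ 2 ≤ 20 * r * |M x| + 1 / (400 * σ) * M x ^ 4 := by
      rw [← sq_abs, ← (show Even 4 by decide).pow_abs, ← hrr]
      set z := |M x|
      have hz : 0 ≤ z := abs_nonneg _
      have hz4 : 0 ≤ 1 / (400 * r ^ 2) * z ^ 4 := by positivity
      by_cases hzr : z ≤ 20 * r
      · nlinarith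
      · have h5 : 1 / (400 * r ^ 2) * z ^ 4 = (z ^ 2) * (z ^ 2 / (400 * r ^ 2)) := by field_simp
        have h6 : 1 ≤ z ^ 2 / (400 * r ^ 2) := by
          rw [le_div_iff₀ (by positivity)]; nlinarith
        have h7 : 0 ≤ 20 * r * z := by positivity
        nlinarith [sq_nonneg z]
    -- On `E` the set `L` is where `M` is negative, so `|M|` equals `M` minus twice its part on `L`;
    -- the last term pays for the points outside `E`.
    have p2 : |M x| ≤ M x - 2 * L.indicator M x +
        4 * (|M x| * Eᶜ.indicator (fun _ => (1 : ℝ)) x) := by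
      by_cases hxE : x ∈ E
      · rw [Set.indicator_of_notMem (s := Eᶜ) (by simpa using hxE)]
        by_cases hxL : x ∈ L
        · rw [Set.indicator_of_mem hxL, abs_of_neg ((hx hxE).1 hxL)]; linarith
        · rw [Set.indicator_of_notMem hxL, abs_of_nonneg (not_lt.1 (mt (hx hxE).2 hxL))]; linarith
      · rw [Set.indicator_of_mem (s := Eᶜ) (by simpa using hxE)]
        have a1 := neg_abs_le (M x)
        have a2 := le_abs_self (M x)
        by_cases hxL : x ∈ L
        · rw [Set.indicator_of_mem hxL]; linarith
        · rw [Set.indicator_of_notMem hxL]; linarith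
    -- Young's inequality, so that the exceptional set enters only through its measure; a part of
    -- the second moment is absorbed on the left later.
    have p3 : 4 * (20 * r) * (|M x| * Eᶜ.indicator (fun _ => (1 : ℝ)) x) ≤
        8 / 100 * M x ^ 2 + 80000 * σ * Eᶜ.indicator (fun _ => (1 : ℝ)) x := by
      rw [← sq_abs (M x), ← hrr]
      set z := |M x|
      by_cases hxE : x ∈ Eᶜ
      · rw [Set.indicator_of_mem hxE]
        nlinarith [sq_nonneg (z - 1000 * r), sq_nonneg z, sq_nonneg r]
      · rw [Set.indicator_of_notMem hxE]
        nlinarith [sq_nonneg z]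
    have p4 := mul_le_mul_of_nonneg_left p2 (show 0 ≤ 20 * r by positivity)
    linarith
  have hint : ∫ x, M x ^ 2 ∂ν ≤ 20 * r * 0 - 40 * r * ∫ x in L, M x ∂ν +
      8 / 100 * ∫ x, M x ^ 2 ∂ν + 80000 * σ * ν.real Eᶜ + 1 / (400 * σ) * ∫ x, M x ^ 4 ∂ν := by
    refine (integral_mono_ae (iP 2) ?_ hpt).trans_eq ?_
    · exact ((((iM.const_mul _).sub (iL.const_mul _)).add ((iP 2).const_mul _)).add
        (iE.const_mul _)).add ((iP 4).const_mul _)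
    · rw [integral_add, integral_add, integral_add, integral_sub, integral_const_mul,
        integral_const_mul, integral_const_mul, integral_const_mul, integral_const_mul, h1,
        integral_indicator hL, integral_indicator hE.compl]
      · simp
      · exact iM.const_mul _
      · exact iL.const_mul _
      · exact (iM.const_mul _).sub (iL.const_mul _)
      · exact (iP 2).const_mul _
      · exact ((iM.const_mul _).sub (iL.const_mul _)).add ((iP 2).const_mul _)
      · exact iE.const_mul _
      · exact (((iM.const_mul _).sub (iL.const_mul _)).add ((iP 2).const_mul _)).add
          (iE.const_mul _)
      · exact (iP 4).const_mul _
  have hq0 : 0 ≤ q := measureReal_nonneg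
  have hcompl : ν.real E = q - ν.real Eᶜ := by
    have := measureReal_add_measureReal_compl (μ := ν) hE
    linarith
  have h4' : 1 / (400 * σ) * ∫ x, M x ^ 4 ∂ν ≤ 35 / 400 * (σ * q) := by
    calc 1 / (400 * σ) * ∫ x, M x ^ 4 ∂ν ≤ 1 / (400 * σ) * (35 * σ ^ 2 * q) :=
          mul_le_mul_of_nonneg_left h4 (by positivity)
      _ = 35 / 400 * (σ * q) := by field_simp
  have h5 : 80000 * σ * ν.real Eᶜ ≤ 8 / 100 * (σ * q) := by
    have := mul_le_mul_of_nonneg_left hsmall (show 0 ≤ 80000 * σ by positivity)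
    linarith
  have h6 : 0 ≤ 40 * r * ∫ x in L, M x ∂ν := by positivity
  have h7 : σ / 2 * ν.real Eᶜ ≤ σ / 2 * (1 / 10 ^ 6 * q) :=
    mul_le_mul_of_nonneg_left hsmall (by positivity)
  rw [hcompl] at hlow
  -- After absorption the left side is about `0.92 * (1 / 2) * σ * q`, while the right side is at
  -- most `(8 / 100 + 35 / 400) * σ * q`.
  have h8 : σ * q ≤ 0 := by nlinarith
  have h9 : q ≤ 0 := by
    by_contra! hlt
    have := mul_pos hσ hlt
    linarith
  linarith

/-! ### The martingale of interior steps and its moments. -/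

theorem DependsUpTo.mono {w : ℕ → ℝ} {m m' : ℕ} (hmm : m ≤ m') {β : Type*} {g : Labels → β}
    (hg : DependsUpTo w m g) : DependsUpTo w m' g :=
  fun u u' h => hg u u' fun j hj => h j (by omega)

theorem measurable_potential (w f : ℕ → ℝ) (a b : ℤ) (k : ℕ) :
    Measurable fun u => potential f a b (drivenWalk w u) k := by
  unfold potential
  refine Finset.measurable_fun_sum _ fun y _ => ?_
  exact (measurable_of_countable (tailSum f)).comp
    (measurable_visitsBefore (X := fun k u => drivenWalk w u k)
      (fun k _ => measurable_drivenWalk w k) measurable_const)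

theorem dependsUpTo_potential (w f : ℕ → ℝ) (a b : ℤ) (k : ℕ) :
    DependsUpTo w k fun u => potential f a b (drivenWalk w u) k := by
  intro u u' h
  unfold potential
  refine Finset.sum_congr rfl fun y _ => ?_
  rw [visitsBefore_congr fun j hj => h j (by omega)]

theorem measurable_interior (w : ℕ → ℝ) (a b : ℤ) (k : ℕ) :
    MeasurableSet {u : Labels | a < drivenWalk w u k ∧ drivenWalk w u k < b} :=
  (measurableSet_lt measurable_const (measurable_drivenWalk w k)).inter
    (measurableSet_lt (measurable_drivenWalk w k) measurable_const)

theorem measurable_interiorStep (w : ℕ → ℝ) (a b : ℤ) (k : ℕ) :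
    Measurable fun u => interiorStep w a b (drivenWalk w u) k :=
  Measurable.ite (measurable_interior w a b k) (measurable_signedStep w k) measurable_const

theorem dependsUpTo_interiorStep (w : ℕ → ℝ) (a b : ℤ) (k : ℕ) :
    DependsUpTo w (k + 1) fun u => interiorStep w a b (drivenWalk w u) k := by
  intro u u' h
  simp only [interiorStep, signedStep]
  rw [h k (by omega), h (k + 1) le_rfl, visitsBefore_congr fun j hj => h j (by omega),
    visitsBefore_congr fun j hj => h j (by omega)]

theorem mul_interiorStep_eq (w : ℕ → ℝ) (a b : ℤ) (X : ℕ → ℤ) (k : ℕ) (c : ℝ) :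
    c * interiorStep w a b X k = (if a < X k ∧ X k < b then c else 0) * signedStep w X k := by
  unfold interiorStep
  split_ifs <;> simp

theorem integral_interiorStep_eq_zero {w : ℕ → ℝ} (hw : ∀ n, 0 < w n) (a b : ℤ) (m : ℕ)
    {g : Labels → ℝ} (hg : DependsUpTo w m g) (hgm : Measurable g) {C : ℝ}
    (hC : ∀ u, |g u| ≤ C) :
    ∫ u, g u * interiorStep w a b (drivenWalk w u) m ∂labelMeasure = 0 := by
  simp only [mul_interiorStep_eq]
  refine integral_signedStep_eq_zero hw m (fun u u' h => ?_)
    (Measurable.ite (measurable_interior w a b m) hgm measurable_const) (Cg := C) fun u => ?_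
  · rw [hg u u' h, h m le_rfl]
  · split_ifs
    · exact hC u
    · rw [abs_zero]; exact (abs_nonneg _).trans (hC u)

theorem integral_interiorStep_nonneg {w : ℕ → ℝ} (hw : ∀ n, 0 < w n) (a b : ℤ) (m : ℕ)
    {g F : Labels → ℝ} (hg : DependsUpTo w m g) (hgm : Measurable g) {Cg : ℝ}
    (hgC : ∀ u, |g u| ≤ Cg) (hg0 : ∀ u, 0 ≤ g u) (hF : Antitone F) (hFm : Measurable F) {CF : ℝ}
    (hFC : ∀ u, |F u| ≤ CF) :
    0 ≤ ∫ u, g u * (F u * interiorStep w a b (drivenWalk w u) m) ∂labelMeasure := by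
  have : ∀ u, g u * (F u * interiorStep w a b (drivenWalk w u) m) =
      (if a < drivenWalk w u m ∧ drivenWalk w u m < b then g u else 0) *
        (F u * signedStep w (drivenWalk w u) m) := fun u => by
    unfold interiorStep; split_ifs <;> simp
  simp only [this]
  refine integral_signedStep_nonneg hw m (fun u u' h => ?_)
    (Measurable.ite (measurable_interior w a b m) hgm measurable_const) (Cg := Cg) (fun u => ?_)
    (fun u => ?_) hF hFm hFC
  · rw [hg u u' h, h m le_rfl]
  · split_ifs
    · exact hgC u
    · rw [abs_zero]; exact (abs_nonneg _).trans (hgC u)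
  · split_ifs
    · exact hg0 u
    · exact le_rfl

/-- The martingale of interior steps after time `n`. -/
noncomputable def stepSum (w : ℕ → ℝ) (a b : ℤ) (n m : ℕ) (u : Labels) : ℝ :=
  ∑ i ∈ Finset.range m, interiorStep w a b (drivenWalk w u) (n + i)

theorem stepSum_succ (w : ℕ → ℝ) (a b : ℤ) (n m : ℕ) (u : Labels) :
    stepSum w a b n (m + 1) u =
      stepSum w a b n m u + interiorStep w a b (drivenWalk w u) (n + m) :=
  Finset.sum_range_succ _ _

theorem measurable_stepSum (w : ℕ → ℝ) (a b : ℤ) (n m : ℕ) : Measurable (stepSum w a b n m) :=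
  Finset.measurable_fun_sum _ fun _ _ => measurable_interiorStep w a b _

theorem dependsUpTo_stepSum (w : ℕ → ℝ) (a b : ℤ) (n m : ℕ) :
    DependsUpTo w (n + m) (stepSum w a b n m) := by
  intro u u' h
  refine Finset.sum_congr rfl fun i hi => ?_
  rw [Finset.mem_range] at hi
  exact dependsUpTo_interiorStep w a b (n + i) u u' fun j hj => h j (by omega)

/-- Uniform bound for the interior steps. -/
noncomputable def stepBound (w : ℕ → ℝ) (a b : ℤ) : ℝ :=
  (Finset.Icc a b).card * tailSum (fun k => 1 / w k) 0

theorem abs_stepSum_le {w : ℕ → ℝ} (hw : ∀ n, 0 < w n) (hs : Summable fun k => 1 / w k)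
    (a b : ℤ) (n m : ℕ) (u : Labels) : |stepSum w a b n m u| ≤ stepBound w a b :=
  (Finset.abs_sum_le_sum_abs _ _).trans
    (sum_abs_interiorStep_le hw hs (drivenWalk_nearestNeighbor w u) n m)

theorem abs_interiorStep_le_stepBound {w : ℕ → ℝ} (hw : ∀ n, 0 < w n)
    (hs : Summable fun k => 1 / w k) (a b : ℤ) (k : ℕ) (u : Labels) :
    |interiorStep w a b (drivenWalk w u) k| ≤ stepBound w a b := by
  have := sum_abs_interiorStep_le (a := a) (b := b) hw hs (drivenWalk_nearestNeighbor w u) k 1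
  simpa [stepBound] using this

theorem measurable_indicator_one {α : Type*} [MeasurableSpace α] {s : Set α}
    (hs : MeasurableSet s) : Measurable (s.indicator fun _ => (1 : ℝ)) :=
  measurable_const.indicator hs

theorem abs_indicator_one_le {α : Type*} (s : Set α) (x : α) :
    |s.indicator (fun _ => (1 : ℝ)) x| ≤ 1 := by
  by_cases h : x ∈ s <;> simp [h]

theorem dependsUpTo_indicator {w : ℕ → ℝ} {n : ℕ} {η : Set Labels}
    (hη : DependsUpTo w n (· ∈ η)) : DependsUpTo w n (η.indicator fun _ => (1 : ℝ)) := by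
  classical
  intro u u' h
  have := hη u u' h
  simp only [Set.indicator_apply]
  simp only at this
  rw [this]

theorem setIntegral_eq_integral_indicator_mul {α : Type*} [MeasurableSpace α] {μ : Measure α}
    {s : Set α} (hs : MeasurableSet s) (f : α → ℝ) :
    ∫ x in s, f x ∂μ = ∫ x, s.indicator (fun _ => (1 : ℝ)) x * f x ∂μ := by
  rw [← integral_indicator hs]
  congr 1
  ext x
  by_cases h : x ∈ s <;> simp [h]

theorem setIntegral_mul_interiorStep_eq_zero {w : ℕ → ℝ} (hw : ∀ n, 0 < w n) (a b : ℤ) {m : ℕ}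
    {η : Set Labels} (hη : DependsUpTo w m (· ∈ η)) (hηm : MeasurableSet η)
    {g : Labels → ℝ} (hg : DependsUpTo w m g) (hgm : Measurable g) {C : ℝ}
    (hC : ∀ u, |g u| ≤ C) :
    ∫ u in η, g u * interiorStep w a b (drivenWalk w u) m ∂labelMeasure = 0 := by
  rw [setIntegral_eq_integral_indicator_mul hηm]
  simp only [← mul_assoc]
  refine integral_interiorStep_eq_zero hw a b m (C := 1 * C) (fun u u' h => ?_)
    ((measurable_indicator_one hηm).mul hgm) fun u => ?_
  · rw [hg u u' h, dependsUpTo_indicator hη u u' h]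
  · rw [abs_mul]
    exact mul_le_mul (abs_indicator_one_le η u) (hC u) (abs_nonneg _) zero_le_one

theorem integrable_stepSum_pow {w : ℕ → ℝ} (hw : ∀ n, 0 < w n) (hs : Summable fun k => 1 / w k) (a b : ℤ)
    (n m k : ℕ) (ν : Measure Labels) [IsFiniteMeasure ν] :
    Integrable (fun u => stepSum w a b n m u ^ k) ν :=
  integrable_of_measurable_of_bound ((measurable_stepSum w a b n m).pow_const k)
    (C := stepBound w a b ^ k) fun u => by
      rw [abs_pow]; exact pow_le_pow_left₀ (abs_nonneg _) (abs_stepSum_le hw hs a b n m u) k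

theorem integrable_interiorStep_pow {w : ℕ → ℝ} (hw : ∀ n, 0 < w n) (hs : Summable fun k => 1 / w k) (a b : ℤ)
    (m k : ℕ) (ν : Measure Labels) [IsFiniteMeasure ν] :
    Integrable (fun u => interiorStep w a b (drivenWalk w u) m ^ k) ν :=
  integrable_of_measurable_of_bound ((measurable_interiorStep w a b m).pow_const k)
    (C := stepBound w a b ^ k) fun u => by
      rw [abs_pow]
      exact pow_le_pow_left₀ (abs_nonneg _) (abs_interiorStep_le_stepBound hw hs a b m u) k

theorem setIntegral_stepSum {w : ℕ → ℝ} (hw : ∀ n, 0 < w n) (hs : Summable fun k => 1 / w k)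
    (a b : ℤ) {n : ℕ} {η : Set Labels} (hη : DependsUpTo w n (· ∈ η)) (hηm : MeasurableSet η)
    (m : ℕ) :
    ∫ u in η, stepSum w a b n m u ∂labelMeasure = 0 := by
  unfold stepSum
  rw [integral_finsetSum]
  · refine Finset.sum_eq_zero fun i _ => ?_
    have := setIntegral_mul_interiorStep_eq_zero hw a b (m := n + i)
      (hη.mono (by omega)) hηm (g := fun _ => 1) (fun _ _ _ => rfl) measurable_const
      (C := 1) (by simp)
    simpa using this
  · intro i _
    simpa using integrable_interiorStep_pow hw hs a b (n + i) 1 (labelMeasure.restrict η)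

/-- Orthogonality of increments: in each cross term the earlier sum depends only on the walk up to
the time of the new step. -/
theorem setIntegral_stepSum_sq {w : ℕ → ℝ} (hw : ∀ n, 0 < w n) (hs : Summable fun k => 1 / w k)
    (a b : ℤ) {n : ℕ} {η : Set Labels} (hη : DependsUpTo w n (· ∈ η)) (hηm : MeasurableSet η)
    (m : ℕ) :
    ∫ u in η, stepSum w a b n m u ^ 2 ∂labelMeasure =
      ∫ u in η, ∑ i ∈ Finset.range m, interiorStep w a b (drivenWalk w u) (n + i) ^ 2
        ∂labelMeasure := by
  induction m with
  | zero => simp [stepSum]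
  | succ m ih =>
    have hz := setIntegral_mul_interiorStep_eq_zero hw a b (m := n + m) (hη.mono (by omega)) hηm
      (dependsUpTo_stepSum w a b n m) (measurable_stepSum w a b n m)
      (abs_stepSum_le hw hs a b n m)
    have hi : Integrable (fun u => stepSum w a b n m u *
        interiorStep w a b (drivenWalk w u) (n + m)) (labelMeasure.restrict η) :=
      integrable_of_measurable_of_bound
        ((measurable_stepSum w a b n m).mul (measurable_interiorStep w a b (n + m)))
        (C := stepBound w a b * stepBound w a b) fun u => by
          rw [abs_mul]
          exact mul_le_mul (abs_stepSum_le hw hs a b n m u)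
            (abs_interiorStep_le_stepBound hw hs a b _ u) (abs_nonneg _)
            ((abs_nonneg _).trans (abs_stepSum_le hw hs a b n m u))
    have he : ∀ u, stepSum w a b n (m + 1) u ^ 2 = stepSum w a b n m u ^ 2 +
        2 * (stepSum w a b n m u * interiorStep w a b (drivenWalk w u) (n + m)) +
        interiorStep w a b (drivenWalk w u) (n + m) ^ 2 := fun u => by
      rw [stepSum_succ]; ring
    simp only [he, Finset.sum_range_succ]
    have i1 := integrable_stepSum_pow hw hs a b n m 2 (labelMeasure.restrict η)
    have i2 := integrable_interiorStep_pow hw hs a b (n + m) 2 (labelMeasure.restrict η)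
    rw [integral_add (i1.fun_add (hi.const_mul 2)) i2, integral_add i1 (hi.const_mul 2),
      integral_const_mul, hz, mul_zero, add_zero, ih, integral_add _ i2]
    exact integrable_finsetSum _ fun i _ =>
      integrable_interiorStep_pow hw hs a b (n + i) 2 (labelMeasure.restrict η)

/-- With `d = S - S'`, which is at least `ξ ^ 2`, the losses in the terms containing `S` pay for all
terms of the expansion of order two or more in `ξ`. What remains is linear in `ξ` with a coefficient
known before the step, hence centred. -/
theorem fourth_moment_step {M ξ S S' : ℝ} (h1 : ξ ^ 2 ≤ S - S') (h2 : 0 ≤ S') :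
    (M + ξ) ^ 4 + 16 * (M + ξ) ^ 2 * S' + 35 * S' ^ 2 ≤
      M ^ 4 + 16 * M ^ 2 * S + 35 * S ^ 2 + (4 * M ^ 3 + 32 * M * S) * ξ := by
  obtain ⟨d, rfl⟩ : ∃ d, S' = S - d := ⟨S - S', by ring⟩
  have hd : ξ ^ 2 ≤ d := by linarith
  have hd0 : 0 ≤ d := (sq_nonneg ξ).trans hd
  have hS : d ≤ S := by linarith
  have e1 : 4 * M * ξ ^ 3 ≤ 2 * M ^ 2 * ξ ^ 2 + 2 * ξ ^ 4 := by
    nlinarith [sq_nonneg (M * ξ - ξ ^ 2)]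
  have e2 : -(32 * M * ξ * d) ≤ 8 * M ^ 2 * d + 32 * ξ ^ 2 * d := by
    nlinarith [mul_nonneg hd0 (sq_nonneg (M + 2 * ξ))]
  have e3 : M ^ 2 * ξ ^ 2 ≤ M ^ 2 * d := mul_le_mul_of_nonneg_left hd (sq_nonneg M)
  have e4 : ξ ^ 4 ≤ d * d := by nlinarith [sq_nonneg ξ]
  have e5 : ξ ^ 2 * d ≤ d * d := mul_le_mul_of_nonneg_right hd hd0
  have e6 : ξ ^ 2 * S ≤ d * S := mul_le_mul_of_nonneg_right hd (hd0.trans hS)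
  have e7 : d * d ≤ d * S := mul_le_mul_of_nonneg_left hS hd0
  nlinarith

/-- The process `M ^ 4 + 16 * M ^ 2 * S + 35 * S ^ 2`, with `S` the potential of `(1 / w) ^ 2`, has
decreasing expectation, and it starts at `35 * σ ^ 2`. -/
theorem setIntegral_stepSum_pow_four {w : ℕ → ℝ} (hw : ∀ n, 0 < w n) (hs : Summable fun k => 1 / w k)
    (a b : ℤ) {n : ℕ} {η : Set Labels} (hη : DependsUpTo w n (· ∈ η)) (hηm : MeasurableSet η)
    (hs2 : Summable fun k => (1 / w k) ^ 2) {σ : ℝ}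
    (hσ : ∀ u ∈ η, potential (fun k => (1 / w k) ^ 2) a b (drivenWalk w u) n = σ) (m : ℕ) :
    ∫ u in η, stepSum w a b n m u ^ 4 ∂labelMeasure ≤ 35 * σ ^ 2 * labelMeasure.real η := by
  set S : ℕ → Labels → ℝ :=
    fun k u => potential (fun k => (1 / w k) ^ 2) a b (drivenWalk w u) (n + k) with hS
  have hf0 : ∀ k, 0 ≤ (1 / w k) ^ 2 := fun k => sq_nonneg _
  set B := (Finset.Icc a b).card * tailSum (fun k => (1 / w k) ^ 2) 0 with hB
  have hSm : ∀ k, Measurable (S k) := fun k => measurable_potential w _ a b _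
  have hS0 : ∀ k u, 0 ≤ S k u := fun k u => potential_nonneg hf0 _ _ _ _
  have hSB : ∀ k u, |S k u| ≤ B := fun k u => by
    rw [abs_of_nonneg (hS0 k u)]; exact potential_le hs2 hf0 _ _ _ _
  have hB0 : 0 ≤ B := (abs_nonneg _).trans (hSB 0 fun _ => 0)
  set C := stepBound w a b
  have hMC := abs_stepSum_le hw hs a b n
  have hC0 : 0 ≤ C := (abs_nonneg _).trans (hMC 0 fun _ => 0)
  set ν := labelMeasure.restrict η with hν
  have iQ : ∀ m, Integrable (fun u => stepSum w a b n m u ^ 4 +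
      16 * stepSum w a b n m u ^ 2 * S m u + 35 * S m u ^ 2) ν := fun m => by
    refine ((integrable_stepSum_pow hw hs a b n m 4 ν).add ?_).add ?_
    · refine integrable_of_measurable_of_bound (C := 16 * C ^ 2 * B)
        ((((measurable_stepSum w a b n m).pow_const 2).const_mul 16).mul (hSm m)) fun u => ?_
      rw [abs_mul, abs_mul, abs_pow]
      have := pow_le_pow_left₀ (abs_nonneg _) (hMC m u) 2
      rw [abs_of_pos (by norm_num : (0 : ℝ) < 16)]
      exact mul_le_mul (mul_le_mul_of_nonneg_left this (by norm_num)) (hSB m u) (abs_nonneg _)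
        (by positivity)
    · refine integrable_of_measurable_of_bound (C := 35 * B ^ 2)
        (((hSm m).pow_const 2).const_mul 35) fun u => ?_
      rw [abs_mul, abs_pow, abs_of_pos (by norm_num : (0 : ℝ) < 35)]
      exact mul_le_mul_of_nonneg_left (pow_le_pow_left₀ (abs_nonneg _) (hSB m u) 2) (by norm_num)
  have hQ : ∀ m, ∫ u, (stepSum w a b n m u ^ 4 +
      16 * stepSum w a b n m u ^ 2 * S m u + 35 * S m u ^ 2) ∂ν ≤
      35 * σ ^ 2 * labelMeasure.real η := by
    intro m
    induction m with
    | zero =>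
      have : ∫ u, (stepSum w a b n 0 u ^ 4 + 16 * stepSum w a b n 0 u ^ 2 * S 0 u +
          35 * S 0 u ^ 2) ∂ν = ∫ u in η, 35 * σ ^ 2 ∂labelMeasure := by
        refine setIntegral_congr_fun hηm fun u hu => ?_
        have h0 : S 0 u = σ := hσ u hu
        simp only [h0, stepSum, Finset.range_zero, Finset.sum_empty]
        ring
      rw [this, setIntegral_const, smul_eq_mul, mul_comm]
    | succ m ih =>
      have hg : DependsUpTo w (n + m)
          fun u => 4 * stepSum w a b n m u ^ 3 + 32 * stepSum w a b n m u * S m u :=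
        fun u u' h => by
          have h1 := dependsUpTo_stepSum w a b n m u u' h
          have h2 := dependsUpTo_potential w (fun k => (1 / w k) ^ 2) a b (n + m) u u' h
          simp only [hS] at h2 ⊢
          rw [h1, h2]
      have hgm : Measurable
          fun u => 4 * stepSum w a b n m u ^ 3 + 32 * stepSum w a b n m u * S m u :=
        (((measurable_stepSum w a b n m).pow_const 3).const_mul 4).add
          (((measurable_stepSum w a b n m).const_mul 32).mul (hSm m))
      have hgC : ∀ u, |4 * stepSum w a b n m u ^ 3 + 32 * stepSum w a b n m u * S m u| ≤
          4 * C ^ 3 + 32 * C * B := fun u => by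
        refine (abs_add_le _ _).trans (add_le_add ?_ ?_)
        · rw [abs_mul, abs_pow, abs_of_pos (by norm_num : (0 : ℝ) < 4)]
          exact mul_le_mul_of_nonneg_left (pow_le_pow_left₀ (abs_nonneg _) (hMC m u) 3)
            (by norm_num)
        · rw [abs_mul, abs_mul, abs_of_pos (by norm_num : (0 : ℝ) < 32)]
          exact mul_le_mul (mul_le_mul_of_nonneg_left (hMC m u) (by norm_num)) (hSB m u)
            (abs_nonneg _) (by positivity)
      have hz := setIntegral_mul_interiorStep_eq_zero hw a b (m := n + m)
        (hη.mono (by omega)) hηm hg hgm hgC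
      have ig : Integrable (fun u => (4 * stepSum w a b n m u ^ 3 +
          32 * stepSum w a b n m u * S m u) * interiorStep w a b (drivenWalk w u) (n + m)) ν :=
        integrable_of_measurable_of_bound (hgm.mul (measurable_interiorStep w a b _))
          (C := (4 * C ^ 3 + 32 * C * B) * C) fun u => by
            rw [abs_mul]
            exact mul_le_mul (hgC u) (abs_interiorStep_le_stepBound hw hs a b _ u) (abs_nonneg _)
              (by positivity)
      refine le_trans ?_ ih
      refine (integral_mono (iQ (m + 1)) ((iQ m).add ig) fun u => ?_).trans_eq ?_
      · simp only [Pi.add_apply]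
        rw [stepSum_succ]
        exact fourth_moment_step
          (interiorStep_sq_le hw hs2 (drivenWalk_nearestNeighbor w u) (n + m)) (hS0 (m + 1) u)
      · rw [integral_add' (iQ m) ig, hz, add_zero]
  refine le_trans (integral_mono (integrable_stepSum_pow hw hs a b n m 4 ν) (iQ m) fun u => ?_)
    (hQ m)
  have h1 := hS0 m u
  have h2 : 0 ≤ 16 * stepSum w a b n m u ^ 2 * S m u := by positivity
  have h3 : 0 ≤ 35 * S m u ^ 2 := by positivity
  simp only
  linarith

/-- The indicator of a set that is stable under lowering labels is antitone, so every summand is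
covered by the correlation inequality. -/
theorem setIntegral_stepSum_nonneg {w : ℕ → ℝ} (hw : ∀ n, 0 < w n) (hs : Summable fun k => 1 / w k)
    (a b : ℤ) {n : ℕ} {η : Set Labels} (hη : DependsUpTo w n (· ∈ η)) (hηm : MeasurableSet η)
    {L : Set Labels} (hL : MeasurableSet L)
    (hLm : ∀ u u', u' ≤ u → u ∈ L → u' ∈ L) (m : ℕ) :
    0 ≤ ∫ u in L, stepSum w a b n m u ∂(labelMeasure.restrict η) := by
  unfold stepSum
  rw [integral_finsetSum]
  · refine Finset.sum_nonneg fun i _ => ?_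
    rw [setIntegral_eq_integral_indicator_mul hL, setIntegral_eq_integral_indicator_mul hηm]
    refine integral_interiorStep_nonneg hw a b (n + i)
      (dependsUpTo_indicator (hη.mono (by omega))) (measurable_indicator_one hηm)
      (abs_indicator_one_le η) (fun u => Set.indicator_nonneg (fun _ _ => zero_le_one) u) ?_
      (measurable_indicator_one hL) (abs_indicator_one_le L)
    intro u u' h
    by_cases hu : u' ∈ L
    · simp [hu, hLm u' u h hu]
    · rw [Set.indicator_of_notMem hu]
      exact Set.indicator_nonneg (fun _ _ => zero_le_one) u
  · intro i _
    simpa using integrable_interiorStep_pow hw hs a b (n + i) 1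
      ((labelMeasure.restrict η).restrict L)

/-! ### Atoms of the natural filtration and Lévy's zero-one law. -/

/-- The paths that agree with `X` at `ω` up to time `n`. -/
def pathAtom {Ω : Type*} (X : ℕ → Ω → ℤ) (n : ℕ) (ω : Ω) : Set Ω :=
  {ω' | ∀ j ≤ n, X j ω' = X j ω}

theorem measurableSet_pathAtom {Ω : Type*} [MeasurableSpace Ω] {X : ℕ → Ω → ℤ} {n : ℕ}
    (hX : ∀ j ≤ n, Measurable (X j)) (ω : Ω) : MeasurableSet (pathAtom X n ω) := by
  have : pathAtom X n ω = ⋂ j, ⋂ (_ : j ≤ n), X j ⁻¹' {X j ω} := by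
    ext; simp [pathAtom]
  rw [this]
  exact MeasurableSet.iInter fun j => MeasurableSet.iInter fun hj =>
    hX j hj (measurableSet_singleton _)

/-- There are only countably many atoms at each time, so the null ones have null union. -/
theorem ae_measure_pathAtom_ne_zero {Ω : Type*} [MeasurableSpace Ω] (μ : Measure Ω)
    (X : ℕ → Ω → ℤ) (n : ℕ) : ∀ᵐ ω ∂μ, μ (pathAtom X n ω) ≠ 0 := by
  have hsub : {ω | ¬ μ (pathAtom X n ω) ≠ 0} ⊆
      ⋃ c : Fin (n + 1) → ℤ, if μ {ω | ∀ j : Fin (n + 1), X j ω = c j} = 0 then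
        {ω | ∀ j : Fin (n + 1), X j ω = c j} else ∅ := by
    intro ω hω
    rw [Set.mem_iUnion]
    refine ⟨fun j => X j ω, ?_⟩
    have he : {ω' | ∀ j : Fin (n + 1), X j ω' = X j ω} = pathAtom X n ω := by
      ext ω'
      exact ⟨fun h j hj => h ⟨j, by omega⟩, fun h j => h j (by omega)⟩
    rw [he, if_pos (not_not.1 hω)]
    exact fun _ _ => rfl
  refine measure_mono_null hsub (measure_iUnion_null fun c => ?_)
  split_ifs with h
  · exact h
  · exact measure_empty

/-- Lévy's zero-one law, stated on the atoms of the natural filtration. -/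
theorem ae_eventually_pathAtom_diff_le {Ω : Type*} [MeasurableSpace Ω] (μ : Measure Ω)
    [IsProbabilityMeasure μ] {X : ℕ → Ω → ℤ} (hX : ∀ k, Measurable (X k)) {T : Set (ℕ → ℤ)}
    (hT : MeasurableSet T) {ε : ℝ} (hε : 0 < ε) :
    ∀ᵐ ω ∂μ, (fun k => X k ω) ∈ T → ∀ᶠ n in atTop,
      μ.real (pathAtom X n ω \ (fun ω k => X k ω) ⁻¹' T) ≤ ε * μ.real (pathAtom X n ω) := by
  set ℱ := Filtration.natural X fun k => (hX k).stronglyMeasurable with hℱ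
  set E : Set Ω := (fun ω k => X k ω) ⁻¹' T with hE
  have hadapt : ∀ n, ∀ j ≤ n, Measurable[ℱ n] (X j) := by
    intro n j hj
    have h1 : MeasurableSpace.comap (X j) inferInstance ≤ ℱ n :=
      le_iSup₂_of_le (f := fun j (_ : j ≤ n) => MeasurableSpace.comap (X j) inferInstance)
        j hj le_rfl
    exact (comap_measurable (X j)).mono h1 le_rfl
  have hEs : MeasurableSet[⨆ n, ℱ n] E := by
    have hm : Measurable[⨆ n, ℱ n] fun ω k => X k ω := by
      refine @measurable_pi_lambda _ _ _ (⨆ n, ℱ n) _ _ fun k => ?_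
      exact (hadapt k k le_rfl).mono (le_iSup (fun n => (ℱ n : MeasurableSpace Ω)) k) le_rfl
    exact hm hT
  have hEm : MeasurableSet E := (iSup_le fun n => ℱ.le n) E hEs
  set g : Ω → ℝ := E.indicator fun _ => 1 with hg
  have hgint : Integrable g μ := (integrable_const (1 : ℝ)).indicator hEm
  have hgs : StronglyMeasurable[⨆ n, ℱ n] g :=
    (@stronglyMeasurable_const _ _ (⨆ n, ℱ n) _ 1).indicator hEs
  filter_upwards [hgint.tendsto_ae_condExp hgs] with ω hω hωE
  have hg1 : g ω = 1 := Set.indicator_of_mem (show ω ∈ E from hωE) _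
  rw [hg1] at hω
  filter_upwards [hω.eventually (lt_mem_nhds (show 1 - ε < 1 by linarith))] with n hn
  set f := μ[g|ℱ n] with hf
  have hatom : MeasurableSet[ℱ n] (pathAtom X n ω) :=
    @measurableSet_pathAtom Ω (ℱ n) X n (hadapt n) ω
  have hatom' : MeasurableSet (pathAtom X n ω) := ℱ.le n _ hatom
  have hB : MeasurableSet[ℱ n] {x | 1 - ε < f x} :=
    (stronglyMeasurable_condExp (m := ℱ n) (μ := μ) (f := g)).measurable measurableSet_Ioi
  -- A set measurable up to time `n` contains the whole atom of each of its points.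
  have hsub : pathAtom X n ω ⊆ {x | 1 - ε < f x} := by
    have hB' := hB
    rw [hℱ, Filtration.natural_eq_comap] at hB'
    obtain ⟨t, _, ht⟩ := hB'
    intro ω' hω'
    have hfun : (fun j : Set.Iic n => X j ω') = fun j : Set.Iic n => X j ω :=
      funext fun j => hω' j j.2
    have hmem : ω ∈ (fun ω (j : Set.Iic n) => X j ω) ⁻¹' t := by rw [ht]; exact hn
    rw [← ht]
    change (fun j : Set.Iic n => X j ω') ∈ t
    rw [hfun]
    exact hmem
  have h1 : ∫ x in pathAtom X n ω, f x ∂μ = μ.real (E ∩ pathAtom X n ω) := by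
    rw [hf, setIntegral_condExp (ℱ.le n) hgint hatom, hg, integral_indicator hEm,
      Measure.restrict_restrict hEm]
    simp
  have h2 : (1 - ε) * μ.real (pathAtom X n ω) ≤ ∫ x in pathAtom X n ω, f x ∂μ := by
    have := setIntegral_mono_on (μ := μ) (f := fun _ => 1 - ε) (g := f)
      (integrable_const _).integrableOn integrable_condExp.integrableOn hatom'
      fun x hx => (hsub hx).le
    rw [setIntegral_const, smul_eq_mul, mul_comm] at this
    exact this
  have h3 := measureReal_inter_add_sdiff (μ := μ) (s := pathAtom X n ω) hEm
  rw [Set.inter_comm] at h3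
  linarith

/-! ### Trapping in three or more sites has probability zero. -/

theorem measurable_visitsBefore_path (k : ℕ) (y : ℤ) :
    Measurable fun x : ℕ → ℤ => visitsBefore x k y :=
  measurable_visitsBefore (X := fun k (x : ℕ → ℤ) => x k) (fun k _ => measurable_pi_apply k)
    measurable_const

theorem measurableSet_departsLeft (y : ℤ) (j : ℕ) :
    MeasurableSet {x : ℕ → ℤ | DepartsLeft x y j} := by
  have hv := fun T => measurable_visitsBefore_path T y
  have he : ∀ k : ℕ, Measurable fun x : ℕ → ℤ => x k := fun k => measurable_pi_apply k
  have hlt : ∀ k : ℕ, MeasurableSet {x : ℕ → ℤ | x k < y} := fun k =>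
    measurableSet_lt (he k) measurable_const
  have : {x : ℕ → ℤ | DepartsLeft x y j} = ⋃ T : ℕ, {x : ℕ → ℤ | x T < y} ∩
      ({x | visitsBefore x T y ≤ j} ∩ ({x | visitsBefore x T y = j} ∪
        ⋂ s, ⋂ (_ : s ≥ T), {x : ℕ → ℤ | x s < y})) := by
    ext x
    simp [DepartsLeft]
  rw [this]
  exact MeasurableSet.iUnion fun T => (hlt T).inter
    ((measurableSet_le (hv T) measurable_const).inter
      ((measurableSet_eq_fun (hv T) measurable_const).union
        (MeasurableSet.iInter fun s => MeasurableSet.iInter fun _ => hlt s)))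

theorem measurableSet_isTrappedIn (a b : ℤ) (N : ℕ) :
    MeasurableSet {x : ℕ → ℤ | IsTrappedIn a b N x} := by
  have hv := measurable_visitsBefore_path
  have he : ∀ k : ℕ, Measurable fun x : ℕ → ℤ => x k := fun k => measurable_pi_apply k
  have : {x : ℕ → ℤ | IsTrappedIn a b N x} =
      (⋂ k, ⋂ (_ : k ≥ N), {x : ℕ → ℤ | a ≤ x k} ∩ ({x : ℕ → ℤ | x k ≤ b} ∩
        ({x | visitsBefore x (k + 1) a ≤ visitsBefore x (k + 1) (a + 1) + 1} ∩
          {x | visitsBefore x (k + 1) b ≤ visitsBefore x (k + 1) (b - 1) + 1}))) ∩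
      ⋂ y, ⋂ (_ : y ∈ Finset.Icc a b), ⋂ m : ℕ, ⋃ k, ⋃ (_ : k ≥ m), {x : ℕ → ℤ | x k = y} := by
    ext x
    simp only [IsTrappedIn, Set.mem_ofPred_eq, Set.mem_inter_iff, Set.mem_iInter, Set.mem_iUnion,
      exists_prop]
  rw [this]
  refine MeasurableSet.inter (MeasurableSet.iInter fun k => MeasurableSet.iInter fun _ => ?_)
    (MeasurableSet.iInter fun y => MeasurableSet.iInter fun _ => MeasurableSet.iInter fun m =>
      MeasurableSet.iUnion fun k => MeasurableSet.iUnion fun _ =>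
        measurableSet_eq_fun (he k) measurable_const)
  exact (measurableSet_le measurable_const (he k)).inter
    ((measurableSet_le (he k) measurable_const).inter
      ((measurableSet_le (hv _ _) ((hv _ _).add_const 1)).inter
        (measurableSet_le (hv _ _) ((hv _ _).add_const 1))))

theorem measurable_leftWeight {w : ℕ → ℝ} (hw : ∀ n, 0 < w n) (hs : Summable fun k => 1 / w k)
    (y : ℤ) (m : ℕ) : Measurable fun x => leftWeight w x y m := by
  classical
  refine measurable_of_tendsto_metrizable (f := fun k (x : ℕ → ℤ) => ∑ i ∈ Finset.range k,
    if DepartsLeft x y (i + m) then 1 / w (i + m) else 0) (fun k => ?_) ?_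
  · exact Finset.measurable_fun_sum _ fun i _ =>
      Measurable.ite (measurableSet_departsLeft y _) measurable_const measurable_const
  · rw [tendsto_pi_nhds]
    intro x
    unfold leftWeight
    convert (summable_leftWeight hw hs x y m).hasSum.tendsto_sum_nat

theorem measurable_totalLeftWeight {w : ℕ → ℝ} (hw : ∀ n, 0 < w n)
    (hs : Summable fun k => 1 / w k) (a b : ℤ) (m : ℤ → ℕ) :
    Measurable fun x => totalLeftWeight w a b m x :=
  (Finset.measurable_fun_sum _ fun _ _ => measurable_leftWeight hw hs _ _).add
    (Finset.measurable_fun_sum _ fun _ _ => measurable_leftWeight hw hs _ _)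

theorem IsLeftCoupling.totalLeftWeight_le {w : ℕ → ℝ} (hw : ∀ n, 0 < w n)
    (hs : Summable fun k => 1 / w k) {A B : ℕ → ℤ} (h : IsLeftCoupling A B) {a b : ℤ}
    {m : ℤ → ℕ} (hm : ∀ y ∈ Finset.Icc a b, 1 ≤ m y) :
    totalLeftWeight w a b m A ≤ totalLeftWeight w a b m B := by
  refine add_le_add (Finset.sum_le_sum fun y hy => ?_) (Finset.sum_le_sum fun y hy => ?_) <;>
  · refine h.leftWeight_le hw hs y (hm y ?_)
    rw [Finset.mem_Icc] at *
    omega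

theorem measurable_drivenWalk_path (w : ℕ → ℝ) : Measurable (drivenWalk w) :=
  measurable_pi_lambda _ fun k => measurable_drivenWalk w k

theorem tsum_abs_stepSum_le {w : ℕ → ℝ} (hw : ∀ n, 0 < w n) (hs : Summable fun k => 1 / w k)
    (a b : ℤ) (n : ℕ) (u : Labels) :
    |∑' i, interiorStep w a b (drivenWalk w u) (n + i)| ≤ stepBound w a b := by
  have h := (summable_interiorStep hw hs a b
    (drivenWalk_nearestNeighbor w u) n).hasSum.tendsto_sum_nat
  exact le_of_tendsto' h.abs fun m => abs_stepSum_le hw hs a b n m u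

theorem tendsto_integral_stepSum {w : ℕ → ℝ} (hw : ∀ n, 0 < w n) (hs : Summable fun k => 1 / w k)
    (a b : ℤ) (n k : ℕ) (ν : Measure Labels) [IsFiniteMeasure ν] :
    Tendsto (fun m => ∫ u, stepSum w a b n m u ^ k ∂ν) atTop
      (nhds (∫ u, (∑' i, interiorStep w a b (drivenWalk w u) (n + i)) ^ k ∂ν)) := by
  refine tendsto_integral_of_dominated_convergence (fun _ => stepBound w a b ^ k)
    (fun m => ((measurable_stepSum w a b n m).pow_const k).aestronglyMeasurable)
    (integrable_const _) (fun m => Eventually.of_forall fun u => ?_)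
    (Eventually.of_forall fun u => ?_)
  · rw [Real.norm_eq_abs, abs_pow]
    exact pow_le_pow_left₀ (abs_nonneg _) (abs_stepSum_le hw hs a b n m u) k
  · exact (summable_interiorStep hw hs a b
      (drivenWalk_nearestNeighbor w u) n).hasSum.tendsto_sum_nat.pow k

theorem summable_sq_of_monotone {w : ℕ → ℝ} (hw : ∀ n, 0 < w n) (hm : Monotone w)
    (hs : Summable fun k => 1 / w k) : Summable fun k => (1 / w k) ^ 2 := by
  refine Summable.of_nonneg_of_le (fun k => sq_nonneg _) (fun k => ?_) (hs.mul_left (1 / w 0))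
  rw [sq]
  exact mul_le_mul_of_nonneg_right (one_div_le_one_div_of_le (hw 0) (hm (Nat.zero_le k)))
    (one_div_pos.2 (hw k)).le

/-- An atom of the natural filtration that is nearly filled by trapped paths is null. -/
theorem measure_eq_zero_of_nearly_trapped {w : ℕ → ℝ} (hw : ∀ n, 0 < w n) (hm : Monotone w)
    (hs : Summable fun k => 1 / w k) {a b : ℤ} (hab : a + 2 ≤ b) {N n : ℕ} (hNn : N ≤ n)
    {η : Set Labels} (hη : DependsUpTo w n (· ∈ η)) (hηm : MeasurableSet η) {v : ℤ → ℕ}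
    (hv : ∀ u ∈ η, visitsBefore (drivenWalk w u) (n + 1) = v)
    (hv1 : ∀ y ∈ Finset.Icc a b, 1 ≤ v y) (hx : ∀ u ∈ η, drivenWalk w u n = a + 1)
    (hsmall : labelMeasure.real (η \ {u | IsTrappedIn a b N (drivenWalk w u)}) ≤
      1 / 10 ^ 6 * labelMeasure.real η) : labelMeasure.real η = 0 := by
  have hs2 := summable_sq_of_monotone hw hm hs
  set E : Set Labels := {u | IsTrappedIn a b N (drivenWalk w u)} with hE
  have hEm : MeasurableSet E := measurable_drivenWalk_path w (measurableSet_isTrappedIn a b N)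
  set c := ∑ y ∈ Finset.Icc a (b - 2), tailSum (fun k => 1 / w k) (v y) with hc
  -- On trapped paths of `η` this is the event `M < 0`. Defined through the left weight, it is also
  -- stable under lowering labels, on all of label space.
  set L : Set Labels := {u | c < totalLeftWeight w a b v (drivenWalk w u)} with hL
  have hLm : MeasurableSet L := measurableSet_lt measurable_const
    ((measurable_totalLeftWeight hw hs a b v).comp (measurable_drivenWalk_path w))
  set M : Labels → ℝ := fun u => ∑' i, interiorStep w a b (drivenWalk w u) (n + i) with hM
  have hMm : Measurable M := by
    refine measurable_of_tendsto_metrizable (measurable_stepSum w a b n) ?_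
    rw [tendsto_pi_nhds]
    intro u
    exact (summable_interiorStep hw hs a b
      (drivenWalk_nearestNeighbor w u) n).hasSum.tendsto_sum_nat
  set σ := ∑ y ∈ Finset.Icc a b, tailSum (fun k => (1 / w k) ^ 2) (v y) with hσ
  have hσ' : ∀ u ∈ η, potential (fun k => (1 / w k) ^ 2) a b (drivenWalk w u) n = σ := by
    intro u hu
    unfold potential
    rw [hv u hu]
  have hσ0 : 0 < σ := by
    refine Finset.sum_pos (fun y _ => ?_) ⟨a, by rw [Finset.mem_Icc]; omega⟩
    rw [tailSum_eq_add hs2]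
    have := tailSum_nonneg (fun k => sq_nonneg (1 / w k)) (v y + 1)
    have := pow_pos (one_div_pos.2 (hw (v y))) 2
    linarith
  set ν := labelMeasure.restrict η with hν
  have huniv : ν.real Set.univ = labelMeasure.real η := by
    rw [hν, measureReal_restrict_apply_univ]
  rw [← huniv]
  have hsq : ∀ m u, u ∈ η → ∑ i ∈ Finset.range m,
      interiorStep w a b (drivenWalk w u) (n + i) ^ 2 ≤ σ := by
    intro m u hu
    rw [← hσ' u hu]
    have h : ∑ i ∈ Finset.range m, interiorStep w a b (drivenWalk w u) (n + i) ^ 2 ≤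
        potential (fun k => (1 / w k) ^ 2) a b (drivenWalk w u) n -
          potential (fun k => (1 / w k) ^ 2) a b (drivenWalk w u) (n + m) := by
      induction m with
      | zero => simp
      | succ m ih =>
        rw [Finset.sum_range_succ]
        have := interiorStep_sq_le (a := a) (b := b) hw hs2 (drivenWalk_nearestNeighbor w u) (n + m)
        rw [← add_assoc]
        linarith
    have := potential_nonneg (fun k => sq_nonneg (1 / w k)) a b (drivenWalk w u) (n + m)
    linarith
  refine measureReal_eq_zero_of_moments (ν := ν) hMm (tsum_abs_stepSum_le hw hs a b n) hEm hLm hσ0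
    ?_ ?_ ?_ ?_ ?_ ?_
  · have h := tendsto_integral_stepSum hw hs a b n 1 ν
    simp only [pow_one] at h
    refine tendsto_nhds_unique h ?_
    simp only [hν, setIntegral_stepSum hw hs a b hη hηm]
    exact tendsto_const_nhds
  · refine le_of_tendsto' (tendsto_integral_stepSum hw hs a b n 4 ν) fun m => ?_
    rw [huniv]
    exact setIntegral_stepSum_pow_four hw hs a b hη hηm hs2 hσ' m
  · have hsum : ∀ u ∈ η, Summable fun i => interiorStep w a b (drivenWalk w u) (n + i) ^ 2 :=
      fun u hu => summable_of_sum_range_le (fun _ => sq_nonneg _) fun m => hsq m u hu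
    have hlim : Tendsto (fun m => ∫ u, stepSum w a b n m u ^ 2 ∂ν) atTop
        (nhds (∫ u, (∑' i, interiorStep w a b (drivenWalk w u) (n + i) ^ 2) ∂ν)) := by
      simp only [hν, setIntegral_stepSum_sq hw hs a b hη hηm]
      refine tendsto_integral_of_dominated_convergence (fun _ => σ) (fun m => ?_)
        (integrable_const _) (fun m => ?_) ?_
      · exact (Finset.measurable_fun_sum _ fun i _ =>
          (measurable_interiorStep w a b (n + i)).pow_const 2).aestronglyMeasurable
      · refine (ae_restrict_iff' hηm).2 (Eventually.of_forall fun u hu => ?_)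
        rw [Real.norm_eq_abs, abs_of_nonneg (Finset.sum_nonneg fun _ _ => sq_nonneg _)]
        exact hsq m u hu
      · refine (ae_restrict_iff' hηm).2 (Eventually.of_forall fun u hu => ?_)
        exact (hsum u hu).hasSum.tendsto_sum_nat
    rw [tendsto_nhds_unique (tendsto_integral_stepSum hw hs a b n 2 ν) hlim]
    have hAi : Integrable (fun u => ∑' i, interiorStep w a b (drivenWalk w u) (n + i) ^ 2) ν := by
      refine Integrable.of_bound (aestronglyMeasurable_of_tendsto_ae atTop
        (f := fun m u => ∑ i ∈ Finset.range m, interiorStep w a b (drivenWalk w u) (n + i) ^ 2)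
        (fun m => (Finset.measurable_fun_sum _ fun i _ =>
          (measurable_interiorStep w a b (n + i)).pow_const 2).aestronglyMeasurable) ?_) σ ?_
      · exact (ae_restrict_iff' hηm).2 (Eventually.of_forall fun u hu =>
          (hsum u hu).hasSum.tendsto_sum_nat)
      · refine (ae_restrict_iff' hηm).2 (Eventually.of_forall fun u hu => ?_)
        rw [Real.norm_eq_abs, abs_of_nonneg (tsum_nonneg fun _ => sq_nonneg _)]
        exact (hsum u hu).tsum_le_of_sum_range_le fun m => hsq m u hu
    have hconst : σ / 2 * ν.real E = ∫ u, E.indicator (fun _ => σ / 2) u ∂ν := by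
      rw [integral_indicator hEm, setIntegral_const, smul_eq_mul, mul_comm]
    rw [hconst]
    refine integral_mono_ae ((integrable_const _).indicator hEm) hAi ?_
    refine (ae_restrict_iff' hηm).2 (Eventually.of_forall fun u hu => ?_)
    by_cases huE : u ∈ E
    · simp only [Set.indicator_of_mem huE]
      have := IsTrappedIn.potential_le hw hm hs2 hab (drivenWalk_nearestNeighbor w u) huE hNn
        (hx u hu) fun m => (hsum u hu).sum_le_tsum (Finset.range m) fun _ _ => sq_nonneg _
      rw [hσ' u hu] at this
      linarith
    · simp only [Set.indicator_of_notMem huE]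
      exact tsum_nonneg fun _ => sq_nonneg _
  · have h := tendsto_integral_stepSum hw hs a b n 1 (ν.restrict L)
    simp only [pow_one] at h
    refine ge_of_tendsto' h fun m => ?_
    refine setIntegral_stepSum_nonneg hw hs a b hη hηm hLm (fun u u' huu hu => ?_) m
    exact lt_of_lt_of_le hu
      ((isLeftCoupling_drivenWalk hw hm huu).totalLeftWeight_le hw hs hv1)
  · refine (ae_restrict_iff' hηm).2 (Eventually.of_forall fun u hu huE => ?_)
    have h := IsTrappedIn.tsum_interiorStep hw hs (drivenWalk_nearestNeighbor w u) huE n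
    rw [hv u hu] at h
    simp only [hL, hM, Set.mem_ofPred_eq, h, ← hc]
    constructor <;> intro h' <;> linarith
  · rw [huniv, hν, measureReal_restrict_apply hEm.compl, Set.inter_comm, ← Set.sdiff_eq]
    exact hsmall

/-- Almost surely the driven walk is not trapped in an interval with at least three sites. -/
theorem measure_isTrappedIn {w : ℕ → ℝ} (hw : ∀ n, 0 < w n) (hm : Monotone w)
    (hs : Summable fun k => 1 / w k) {a b : ℤ} (hab : a + 2 ≤ b) (N : ℕ) :
    ∀ᵐ u ∂labelMeasure, ¬ IsTrappedIn a b N (drivenWalk w u) := by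
  have h1 := ae_eventually_pathAtom_diff_le labelMeasure (X := fun k u => drivenWalk w u k)
    (measurable_drivenWalk w) (measurableSet_isTrappedIn a b N) (ε := 1 / 10 ^ 6) (by norm_num)
  have h2 := ae_all_iff.2 (ae_measure_pathAtom_ne_zero labelMeasure fun k u => drivenWalk w u k)
  filter_upwards [h1, h2] with u hu1 hu2 hE
  have hvis : ∀ᶠ n in atTop, ∀ y ∈ Finset.Icc a b,
      1 ≤ visitsBefore (drivenWalk w u) (n + 1) y := by
    rw [Filter.eventually_all_finset]
    intro y hy
    exact ((tendsto_visitsBefore (hE.2 y hy)).comp (tendsto_add_atTop_nat 1)).eventually_ge_atTop 1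
  obtain ⟨n0, hn0⟩ := eventually_atTop.1 ((hu1 hE).and (hvis.and (eventually_ge_atTop N)))
  -- The history is cut at a late visit to `a + 1`, as the quadratic variation bound requires. By
  -- then every site of `[a, b]` has been visited, so only ranks from `1` on occur.
  obtain ⟨n, hn, hxn⟩ := hE.2 (a + 1) (by rw [Finset.mem_Icc]; omega) n0
  obtain ⟨hn1, hn2, hn3⟩ := hn0 n hn
  apply hu2 n
  have hz := measure_eq_zero_of_nearly_trapped hw hm hs hab hn3
    (η := pathAtom (fun k u => drivenWalk w u k) n u)
    (v := visitsBefore (drivenWalk w u) (n + 1)) ?_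
    (measurableSet_pathAtom (fun j _ => measurable_drivenWalk w j) u) ?_ hn2 ?_ hn1
  · rwa [measureReal_eq_zero_iff] at hz
  · intro v v' h
    simp only [pathAtom, Set.mem_ofPred_eq, eq_iff_iff]
    exact forall₂_congr fun j hj => by rw [h j hj]
  · intro v hv
    funext y
    exact visitsBefore_congr (fun j hj => hv j (by omega)) y
  · intro v hv
    exact (hv n le_rfl).trans hxn

/-! ### Recurrent sites and boundedness of the walk. -/

/-- The sites which the path `X` visits infinitely often. -/
def recurrentSites (X : ℕ → ℤ) : Set ℤ := {x | ∃ᶠ k in atTop, X k = x}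

theorem mem_recurrentSites {X : ℕ → ℤ} {x : ℤ} :
    x ∈ recurrentSites X ↔ ∀ m, ∃ k ≥ m, X k = x := frequently_atTop

theorem notMem_recurrentSites {X : ℕ → ℤ} {x : ℤ} :
    x ∉ recurrentSites X ↔ ∀ᶠ k in atTop, X k ≠ x := not_frequently

theorem visitedInfinitelyOften_eq {Ω : Type*} (X : ℕ → Ω → ℤ) (ω : Ω) :
    visitedInfinitelyOften X ω = recurrentSites fun k => X k ω := by
  ext x
  simp only [visitedInfinitelyOften, Set.mem_ofPred_eq, localTime_eq_visitsBefore]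
  constructor
  · intro h
    by_contra hx
    obtain ⟨T, hT⟩ := eventually_atTop.1 (notMem_recurrentSites.1 hx)
    obtain ⟨n, hn, hn'⟩ := ((tendsto_atTop.1 h
      (visitsBefore (fun k => X k ω) T x + 1)).and (eventually_ge_atTop T)).exists
    have := visitsBefore_eq_of_ne hT (n + 1) (by omega)
    omega
  · intro h
    exact (tendsto_visitsBefore (mem_recurrentSites.1 h)).comp (tendsto_add_atTop_nat 1)

/-- A second Borel–Cantelli lemma for coordinates of a product measure. -/
theorem ae_frequently_mem_infinitePi {ι E : Type*} [MeasurableSpace E] (P : Measure E)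
    [IsProbabilityMeasure P] {f : ℕ → ι} (hf : Function.Injective f) {s : ℕ → Set E}
    (hs : ∀ n, MeasurableSet (s n)) (hsum : ∑' n, P (s n) = ⊤) :
    ∀ᵐ v ∂Measure.infinitePi (fun _ : ι => P), ∃ᶠ n in atTop, v (f n) ∈ s n := by
  have hm : ∀ n, MeasurableSet ((fun v : ι → E => v (f n)) ⁻¹' s n) := fun n =>
    measurable_pi_apply (f n) (hs n)
  have hP : ∀ n, Measure.infinitePi (fun _ : ι => P) ((fun v : ι → E => v (f n)) ⁻¹' s n) =
      P (s n) := by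
    intro n
    have h := Measure.infinitePi_map_eval (fun _ : ι => P) (f n)
    rw [← Measure.map_apply (measurable_pi_apply (f n)) (hs n)]
    exact congrArg (fun ν : Measure E => ν (s n)) h
  have hind : iIndepSet (fun n => (fun v : ι → E => v (f n)) ⁻¹' s n)
      (Measure.infinitePi fun _ : ι => P) := by
    rw [iIndepSet_iff_meas_biInter hm]
    intro t
    have h := (iIndepFun_infinitePi (P := fun _ : ι => P) (X := fun _ x => x)
      fun _ => measurable_id).precomp hf
    exact h.measure_inter_preimage_eq_mul t fun i _ => hs i
  have h1 := measure_limsup_eq_one hm hind (by simpa only [hP] using hsum)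
  have h2 := (mem_ae_iff_prob_eq_one (MeasurableSet.measurableSet_limsup hm)).2 h1
  filter_upwards [h2] with v hv
  exact mem_limsup_iff_frequently_mem.1 hv

/-- A row lies in the product of the `t j` with probability at least `exp (-∑ c)`, the same positive
bound for every row. Distinct rows are independent, so Borel–Cantelli applies. -/
theorem ae_exists_row_mem {t : ℕ → Set unitInterval} (ht : ∀ j, MeasurableSet (t j)) {c : ℕ → ℝ}
    (hc : ∀ j, 0 ≤ c j) (hs : Summable c) (hv : ∀ j, ENNReal.ofReal (Real.exp (-c j)) ≤ volume (t j))
    {f : ℕ → ℤ} (hf : Function.Injective f) :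
    ∀ᵐ u ∂labelMeasure, ∃ n, ∀ j, u (f n, j) ∈ t j := by
  set R : Measure (ℕ → unitInterval) := Measure.infinitePi fun _ => volume with hR
  set T : Set (ℕ → unitInterval) := Set.univ.pi t with hT
  have hTm : MeasurableSet T := MeasurableSet.univ_pi ht
  have hpos : ENNReal.ofReal (Real.exp (-∑' j, c j)) ≤ R T := by
    have hd : Antitone fun n : ℕ => Set.pi (Finset.range n : Set ℕ) t := by
      intro m n hmn
      exact Set.pi_mono' (fun _ _ => le_rfl) (by simpa using hmn)
    have hi : T = ⋂ n : ℕ, Set.pi (Finset.range n : Set ℕ) t := by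
      ext v
      simp only [hT, Set.mem_pi, Set.mem_univ, true_imp_iff, Set.mem_iInter, Finset.coe_range,
        Set.mem_Iio]
      exact ⟨fun h _ j _ => h j, fun h j => h (j + 1) j (by omega)⟩
    have hlim := tendsto_measure_iInter_atTop (μ := R)
      (s := fun n : ℕ => Set.pi (Finset.range n : Set ℕ) t)
      (fun n => (MeasurableSet.pi (Finset.countable_toSet _) fun j _ => ht j).nullMeasurableSet)
      hd ⟨0, measure_ne_top _ _⟩
    rw [← hi] at hlim
    refine ge_of_tendsto' hlim fun n => ?_
    rw [Function.comp_apply, hR, Measure.infinitePi_pi _ fun j _ => ht j]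
    calc ENNReal.ofReal (Real.exp (-∑' j, c j))
        ≤ ENNReal.ofReal (Real.exp (-∑ j ∈ Finset.range n, c j)) := by
          apply ENNReal.ofReal_le_ofReal
          rw [Real.exp_le_exp, neg_le_neg_iff]
          exact hs.sum_le_tsum _ fun j _ => hc j
      _ = ∏ j ∈ Finset.range n, ENNReal.ofReal (Real.exp (-c j)) := by
          rw [← Finset.sum_neg_distrib, Real.exp_sum,
            ENNReal.ofReal_prod_of_nonneg fun j _ => (Real.exp_pos _).le]
      _ ≤ _ := Finset.prod_le_prod' fun j _ => hv j
  have hne : R T ≠ 0 := by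
    intro h
    rw [h, nonpos_iff_eq_zero, ENNReal.ofReal_eq_zero] at hpos
    exact absurd (Real.exp_pos _) (not_lt.2 hpos)
  have h1 := ae_frequently_mem_infinitePi R hf (s := fun _ => T) (fun _ => hTm)
    (ENNReal.tsum_const_eq_top_of_ne_zero hne)
  -- Currying turns the array of labels into an independent sequence of rows.
  have h2 := Measure.infinitePi_map_curry fun (_ : ℤ) (_ : ℕ) => (volume : Measure unitInterval)
  rw [← h2] at h1
  filter_upwards [ae_of_ae_map (MeasurableEquiv.measurable _).aemeasurable h1] with u hu
  obtain ⟨n, hn⟩ := hu.exists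
  exact ⟨n, fun j => hn j trivial⟩

/-- As long as `x + d` is unvisited, every arrival at `x` comes from `x - d`, and the start is not
at `x`. -/
theorem visitsBefore_le_of_barrier {X : ℕ → ℤ} (hX : IsNearestNeighbor X) {x d : ℤ}
    (hd : d = 1 ∨ d = -1) (h0 : X 0 ≠ x) {m : ℕ} (h : ∀ k ≤ m, X k ≠ x + d) :
    visitsBefore X (m + 1) x ≤ visitsBefore X (m + 1) (x - d) ∧
      (X m = x - d → visitsBefore X (m + 1) x + 1 ≤ visitsBefore X (m + 1) (x - d)) := by
  induction m with
  | zero =>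
    rw [visitsBefore_succ, visitsBefore_succ, visitsBefore_zero, visitsBefore_zero, if_neg h0]
    refine ⟨by omega, fun h => ?_⟩
    rw [if_pos h]
  | succ m ih =>
    obtain ⟨h1, h2⟩ := ih fun k hk => h k (by omega)
    have h3 := hX m
    have h4 := h m (by omega)
    rw [visitsBefore_succ X (m + 1), visitsBefore_succ X (m + 1)]
    split_ifs <;> rcases hd with rfl | rfl <;> omega

/-- At the visit of rank `j` to `x`, with `x + 1` still unvisited, `x - 1` has at least `j + 1`
visits. So the left probability is at least `leftProb w (j + 1) 0`, and these labels turn the walk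
back every time. -/
theorem drivenWalk_le {w : ℕ → ℝ} (hw : ∀ n, 0 < w n) (hm : Monotone w) {u : Labels} {x : ℤ}
    (hx : 0 < x) (hu : ∀ j, (u (x, j) : ℝ) < leftProb w (j + 1) 0) (n : ℕ) :
    drivenWalk w u n ≤ x := by
  suffices ∀ k ≤ n, drivenWalk w u k ≤ x from this n le_rfl
  induction n with
  | zero => intro k hk; obtain rfl : k = 0 := by omega
            exact hx.le
  | succ n ih =>
    intro k hk
    rcases Nat.lt_or_ge k (n + 1) with hk' | hk'
    · exact ih k (by omega)
    obtain rfl : k = n + 1 := by omega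
    have hX := drivenWalk_nearestNeighbor w u
    by_contra hgt
    have hn : drivenWalk w u n = x := by
      have := ih n le_rfl
      have := hX n
      omega
    have hb := (visitsBefore_le_of_barrier hX (x := x) (d := 1) (Or.inl rfl)
      (by rw [drivenWalk_zero]; omega) fun k hk => by have := ih k hk; omega).1
    have h1 : visitsBefore (drivenWalk w u) n (x + 1) = 0 := by
      have : ∀ m ≤ n, visitsBefore (drivenWalk w u) m (x + 1) = 0 := by
        intro m hm
        induction m with
        | zero => exact visitsBefore_zero _ _
        | succ m ihm =>
          have := ih m (by omega)
          rw [visitsBefore_succ, ihm (by omega), if_neg (by omega)]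
      exact this n le_rfl
    rw [visitsBefore_succ, visitsBefore_succ, if_pos hn, if_neg (by omega)] at hb
    have h2 := drivenWalk_succ w u n
    rw [hn, if_pos] at h2
    · omega
    · rw [h1]
      exact (hu _).trans_le (leftProb_mono hw hm (by omega) le_rfl)

/-- Mirror image of `drivenWalk_le`. -/
theorem le_drivenWalk {w : ℕ → ℝ} (hw : ∀ n, 0 < w n) (hm : Monotone w) {u : Labels} {x : ℤ}
    (hx : x < 0) (hu : ∀ j, leftProb w 0 (j + 1) ≤ (u (x, j) : ℝ)) (n : ℕ) :
    x ≤ drivenWalk w u n := by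
  suffices ∀ k ≤ n, x ≤ drivenWalk w u k from this n le_rfl
  induction n with
  | zero => intro k hk; obtain rfl : k = 0 := by omega
            exact hx.le
  | succ n ih =>
    intro k hk
    rcases Nat.lt_or_ge k (n + 1) with hk' | hk'
    · exact ih k (by omega)
    obtain rfl : k = n + 1 := by omega
    have hX := drivenWalk_nearestNeighbor w u
    by_contra hgt
    have hn : drivenWalk w u n = x := by
      have := ih n le_rfl
      have := hX n
      omega
    have hb := (visitsBefore_le_of_barrier hX (x := x) (d := -1) (Or.inr rfl)
      (by rw [drivenWalk_zero]; omega) fun k hk => by have := ih k hk; omega).1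
    have h1 : visitsBefore (drivenWalk w u) n (x - 1) = 0 := by
      have : ∀ m ≤ n, visitsBefore (drivenWalk w u) m (x - 1) = 0 := by
        intro m hm
        induction m with
        | zero => exact visitsBefore_zero _ _
        | succ m ihm =>
          have := ih m (by omega)
          rw [visitsBefore_succ, ihm (by omega), if_neg (by omega)]
      exact this n le_rfl
    rw [visitsBefore_succ, visitsBefore_succ, if_pos hn, if_neg (by omega), sub_neg_eq_add] at hb
    have h2 := drivenWalk_succ w u n
    rw [hn, if_neg] at h2
    · omega
    · rw [h1, not_lt]
      exact (leftProb_mono hw hm le_rfl (by omega)).trans (hu _)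

/-- With `z = w 0 / w (j + 1)` this is `exp (-z) ≤ 1 / (1 + z)`; the exponents are summable. -/
theorem exp_neg_le_leftProb {w : ℕ → ℝ} (hw : ∀ n, 0 < w n) (j : ℕ) :
    Real.exp (-(w 0 * (1 / w (j + 1)))) ≤ leftProb w (j + 1) 0 := by
  have h0 := hw 0
  have h1 := hw (j + 1)
  have h : leftProb w (j + 1) 0 = (w 0 * (1 / w (j + 1)) + 1)⁻¹ := by
    unfold leftProb
    field_simp
    ring
  rw [h, Real.exp_neg]
  exact inv_anti₀ (by positivity) (Real.add_one_le_exp _)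

theorem ae_drivenWalk_bounded {w : ℕ → ℝ} (hw : ∀ n, 0 < w n) (hm : Monotone w)
    (hs : Summable fun k => 1 / w k) :
    ∀ᵐ u ∂labelMeasure, ∃ l r : ℤ, ∀ n, l ≤ drivenWalk w u n ∧ drivenWalk w u n ≤ r := by
  have hc : ∀ j, 0 ≤ w 0 * (1 / w (j + 1)) := fun j =>
    mul_nonneg (hw 0).le (one_div_pos.2 (hw _)).le
  have hs' : Summable fun j => w 0 * (1 / w (j + 1)) :=
    ((summable_nat_add_iff 1).2 hs).mul_left (w 0)
  have hp : ∀ j, leftProb w (j + 1) 0 ∈ unitInterval := fun j =>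
    ⟨(leftProb_pos hw _ _).le, (leftProb_lt_one hw _ _).le⟩
  have hq : ∀ j, leftProb w 0 (j + 1) ∈ unitInterval := fun j =>
    ⟨(leftProb_pos hw _ _).le, (leftProb_lt_one hw _ _).le⟩
  have hr := ae_exists_row_mem (t := fun j => Set.Iio ⟨_, hp j⟩) (fun j => measurableSet_Iio) hc hs'
    (fun j => by
      rw [unitInterval.volume_Iio]
      exact ENNReal.ofReal_le_ofReal (exp_neg_le_leftProb hw j))
    (f := fun n => (n : ℤ) + 1) (fun m n h => by simpa using h)
  have hl := ae_exists_row_mem (t := fun j => Set.Ici ⟨_, hq j⟩) (fun j => measurableSet_Ici) hc hs'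
    (fun j => by
      rw [unitInterval.volume_Ici]
      apply ENNReal.ofReal_le_ofReal
      refine (exp_neg_le_leftProb hw j).trans_eq ?_
      rw [one_sub_leftProb hw, leftProb, add_comm (w 0)])
    (f := fun n => -(n : ℤ) - 1) (fun m n h => by simpa using h)
  filter_upwards [hr, hl] with u ⟨r, hr⟩ ⟨l, hl⟩
  exact ⟨-(l : ℤ) - 1, (r : ℤ) + 1, fun n =>
    ⟨le_drivenWalk hw hm (by omega) (fun j => hl j) n, drivenWalk_le hw hm (by omega) (fun j => hr j) n⟩⟩

/-! ### Shape of the set of recurrent sites. -/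

/-- Once `a - d` is abandoned, every visit to `a` is matched by the visit to `a + d` before it, and
each return from `a + 2 * d` to `a + d` adds an unmatched one. There are infinitely many such
returns, so they outweigh any initial deficit. -/
theorem eventually_visitsBefore_le_of_barrier {X : ℕ → ℤ} (hX : IsNearestNeighbor X) {a d : ℤ}
    (hd : d = 1 ∨ d = -1) (h : ∀ᶠ k in atTop, X k ≠ a - d) (h0 : a ∈ recurrentSites X)
    (h2 : a + 2 * d ∈ recurrentSites X) :
    ∀ᶠ k in atTop, visitsBefore X (k + 1) a ≤ visitsBefore X (k + 1) (a + d) + 1 := by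
  obtain ⟨N, hN⟩ := eventually_atTop.1 h
  -- The indicator compensates for a visit to `a` whose following visit to `a + d` is still to come;
  -- it makes the excess monotone from time `N` on.
  set E : ℕ → ℤ := fun k => (visitsBefore X (k + 1) (a + d) : ℤ) - visitsBefore X (k + 1) a +
    if X k = a then 1 else 0 with hE
  have hstep : ∀ k ≥ N, E k + (if X k = a + 2 * d ∧ X (k + 1) = a + d then 1 else 0) ≤ E (k + 1) := by
    intro k hk
    have h1 := hX k
    have h3 := hN k hk
    have h4 := hN (k + 1) (by omega)
    simp only [hE]
    rw [visitsBefore_succ X (k + 1), visitsBefore_succ X (k + 1)]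
    push_cast
    split_ifs <;> rcases hd with rfl | rfl <;> omega
  have hmono : ∀ k ≥ N, ∀ l ≥ k, E k ≤ E l := by
    intro k hk l hl
    induction l, hl using Nat.le_induction with
    | base => rfl
    | succ l hl ih =>
      have := hstep l (by omega)
      split_ifs at this <;> omega
  have hio : ∀ m, ∃ k ≥ m, X k = a + 2 * d ∧ X (k + 1) = a + d := by
    intro m
    by_contra! hm
    obtain ⟨s, hs, hs'⟩ := mem_recurrentSites.1 h2 m
    have key : ∀ k ≥ s, 2 ≤ d * (X k - a) := by
      intro k hk
      induction k, hk using Nat.le_induction with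
      | base => rcases hd with rfl | rfl <;> omega
      | succ k hk ih =>
        have h1 := hX k
        have h3 := hm k (by omega)
        rcases hd with rfl | rfl <;> omega
    obtain ⟨k, hk, hk'⟩ := mem_recurrentSites.1 h0 s
    have := key k hk
    rw [hk'] at this
    simp at this
  have hunb : ∀ n : ℕ, ∃ k ≥ N, E N + n ≤ E k := by
    intro n
    induction n with
    | zero => exact ⟨N, le_rfl, by simp⟩
    | succ n ih =>
      obtain ⟨k, hk, hk'⟩ := ih
      obtain ⟨l, hl, hl'⟩ := hio k
      have h1 := hstep l (by omega)
      rw [if_pos hl'] at h1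
      have h3 := hmono k hk l hl
      exact ⟨l + 1, by omega, by push_cast; omega⟩
  obtain ⟨k, hk, hk'⟩ := hunb (E N).natAbs
  filter_upwards [eventually_ge_atTop k] with l hl
  have h1 := hmono k hk l hl
  have h3 : 0 ≤ E l := by omega
  simp only [hE] at h3
  split_ifs at h3 <;> omega

theorem recurrentSites_nonempty {X : ℕ → ℤ} {l r : ℤ} (h : ∀ n, l ≤ X n ∧ X n ≤ r) :
    (recurrentSites X).Nonempty := by
  by_contra hne
  have h1 : ∀ᶠ k in atTop, ∀ y ∈ Finset.Icc l r, X k ≠ y :=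
    (Finset.eventually_all _).2 fun y _ => notMem_recurrentSites.1 fun hy => hne ⟨y, hy⟩
  obtain ⟨k, hk⟩ := h1.exists
  exact hk _ (Finset.mem_Icc.2 (h k)) rfl

theorem recurrentSites_subset_Icc {X : ℕ → ℤ} {l r : ℤ} (h : ∀ n, l ≤ X n ∧ X n ≤ r) :
    recurrentSites X ⊆ Set.Icc l r := by
  intro y hy
  obtain ⟨k, -, rfl⟩ := mem_recurrentSites.1 hy 0
  exact h k

theorem IsNearestNeighbor.ordConnected_recurrentSites {X : ℕ → ℤ} (hX : IsNearestNeighbor X)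
    {a b y : ℤ} (ha : a ∈ recurrentSites X) (hb : b ∈ recurrentSites X) (hay : a ≤ y)
    (hyb : y ≤ b) : y ∈ recurrentSites X := by
  by_contra hy
  obtain ⟨T, hT⟩ := eventually_atTop.1 (notMem_recurrentSites.1 hy)
  rcases hX.lt_or_gt hT with h | h
  · obtain ⟨k, hk, hk'⟩ := mem_recurrentSites.1 hb T
    have := h k hk
    omega
  · obtain ⟨k, hk, hk'⟩ := mem_recurrentSites.1 ha T
    have := h k hk
    omega

theorem IsNearestNeighbor.exists_neighbor_mem_recurrentSites {X : ℕ → ℤ}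
    (hX : IsNearestNeighbor X) {x : ℤ} (hx : x ∈ recurrentSites X) :
    x - 1 ∈ recurrentSites X ∨ x + 1 ∈ recurrentSites X := by
  by_contra! h
  obtain ⟨T, hT⟩ := eventually_atTop.1
    ((notMem_recurrentSites.1 h.1).and (notMem_recurrentSites.1 h.2))
  obtain ⟨k, hk, hk'⟩ := mem_recurrentSites.1 hx T
  have := hT (k + 1) (by omega)
  have := hX k
  omega

/-- The recurrent sites form an interval with at least two points, since each has a recurrent
neighbour. If it had a third, its end points would be barriers and the path would be trapped in it.
-/
theorem IsNearestNeighbor.encard_recurrentSites_of_not_isTrappedIn {X : ℕ → ℤ}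
    (hX : IsNearestNeighbor X) {l r : ℤ} (h : ∀ n, l ≤ X n ∧ X n ≤ r)
    (ht : ∀ a b : ℤ, a + 2 ≤ b → ∀ N, ¬ IsTrappedIn a b N X) : (recurrentSites X).encard = 2 := by
  classical
  have hsub := recurrentSites_subset_Icc h
  obtain ⟨a, ha⟩ : ∃ a, IsLeast (recurrentSites X) a :=
    ⟨_, Int.isLeast_coe_leastOfBdd l (fun z hz => (hsub hz).1) (recurrentSites_nonempty h)⟩
  obtain ⟨b, hb⟩ : ∃ b, IsGreatest (recurrentSites X) b :=
    ⟨_, Int.isGreatest_coe_greatestOfBdd r (fun z hz => (hsub hz).2) (recurrentSites_nonempty h)⟩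
  have hab := ha.2 hb.1
  have hIcc : ∀ y, y ∈ recurrentSites X ↔ a ≤ y ∧ y ≤ b := fun y =>
    ⟨fun hy => ⟨ha.2 hy, hb.2 hy⟩, fun hy => hX.ordConnected_recurrentSites ha.1 hb.1 hy.1 hy.2⟩
  have h1 := hX.exists_neighbor_mem_recurrentSites ha.1
  rw [hIcc, hIcc] at h1
  by_cases hlt : a + 2 ≤ b
  · exfalso
    have e1 : ∀ᶠ k in atTop, ∀ y ∈ Finset.Icc l r, y ∉ recurrentSites X → X k ≠ y := by
      refine (Finset.eventually_all _).2 fun y _ => ?_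
      by_cases hy : y ∈ recurrentSites X
      · exact Eventually.of_forall fun k hk => absurd hy hk
      · filter_upwards [notMem_recurrentSites.1 hy] with k hk _ using hk
    have e2 : ∀ᶠ k in atTop, a ≤ X k ∧ X k ≤ b := by
      filter_upwards [e1] with k hk
      rw [← hIcc]
      by_contra hn
      exact hk _ (Finset.mem_Icc.2 (h k)) hn rfl
    have e3 := eventually_visitsBefore_le_of_barrier hX (a := a) (d := 1) (Or.inl rfl)
      (e2.mono fun k hk => by omega) ha.1 ((hIcc _).2 (by omega))
    have e4 := eventually_visitsBefore_le_of_barrier hX (a := b) (d := -1) (Or.inr rfl)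
      (e2.mono fun k hk => by omega) hb.1 ((hIcc _).2 (by omega))
    obtain ⟨N, hN⟩ := eventually_atTop.1 (e2.and (e3.and e4))
    refine ht a b hlt N ⟨fun k hk => ?_, fun y hy => ?_⟩
    · obtain ⟨⟨f1, f2⟩, f3, f4⟩ := hN k hk
      exact ⟨f1, f2, f3, f4⟩
    · exact mem_recurrentSites.1 ((hIcc y).2 (Finset.mem_Icc.1 hy))
  · have : recurrentSites X = {a, a + 1} := by
      ext y
      rw [hIcc]
      simp only [Set.mem_insert_iff, Set.mem_singleton_iff]
      omega
    rw [this, Set.encard_pair (by omega)]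

theorem ae_encard_recurrentSites_eq_two {w : ℕ → ℝ} (hw : ∀ n, 0 < w n) (hm : Monotone w)
    (hs : Summable fun k => 1 / w k) :
    ∀ᵐ u ∂labelMeasure, (recurrentSites (drivenWalk w u)).encard = 2 := by
  have h : ∀ᵐ u ∂labelMeasure, ∀ a b : ℤ, a + 2 ≤ b → ∀ N, ¬ IsTrappedIn a b N (drivenWalk w u) := by
    simp only [ae_all_iff]
    exact fun a b hab N => measure_isTrappedIn hw hm hs hab N
  filter_upwards [h, ae_drivenWalk_bounded hw hm hs] with u hu ⟨l, r, hlr⟩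
  exact (drivenWalk_nearestNeighbor w u).encard_recurrentSites_of_not_isTrappedIn hlr hu

/-! ### The divergent case. -/

/-- If these probabilities were summable they would eventually be below `1 / 2`, so that `w a < w (c
+ i)` and the probability is at least `w a / (2 * w (c + i))`. -/
theorem not_summable_leftProb {w : ℕ → ℝ} (hw : ∀ n, 0 < w n) (hs : ¬ Summable fun k => 1 / w k)
    (a c : ℕ) : ¬ Summable fun i => leftProb w a (c + i) := by
  intro h
  apply hs
  rw [← summable_nat_add_iff c]
  have ha := hw a
  have hlim := h.tendsto_atTop_zero.eventually (gt_mem_nhds (show (0 : ℝ) < 1 / 2 by norm_num))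
  refine Summable.of_norm_bounded_eventually_nat (h.mul_left (2 / w a)) ?_
  filter_upwards [hlim] with i hi
  have hi' := hw (c + i)
  rw [add_comm i c, Real.norm_of_nonneg (one_div_pos.2 hi').le]
  unfold leftProb at hi ⊢
  rw [div_lt_div_iff₀ (by positivity) (by norm_num)] at hi
  rw [div_mul_div_comm, div_le_div_iff₀ hi' (by positivity)]
  nlinarith

theorem ae_exists_label_lt {w : ℕ → ℝ} (hw : ∀ n, 0 < w n) (hs : ¬ Summable fun k => 1 / w k)
    (x : ℤ) (a b c : ℕ) :
    ∀ᵐ u ∂labelMeasure, ∃ i, (u (x, b + i) : ℝ) < leftProb w a (c + i) := by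
  have hp : ∀ i, leftProb w a (c + i) ∈ unitInterval := fun i =>
    ⟨(leftProb_pos hw _ _).le, (leftProb_lt_one hw _ _).le⟩
  have h := ae_frequently_mem_infinitePi (ι := ℤ × ℕ) (volume : Measure unitInterval)
    (f := fun i => (x, b + i)) (fun i j hij => by simpa using hij)
    (s := fun i => Set.Iio ⟨_, hp i⟩) (fun i => measurableSet_Iio) ?_
  · filter_upwards [h] with u hu
    obtain ⟨i, hi⟩ := hu.exists
    exact ⟨i, hi⟩
  · by_contra hne
    apply not_summable_leftProb hw hs a c
    refine (ENNReal.summable_toReal hne).congr fun i => ?_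
    rw [unitInterval.volume_Iio, ENNReal.toReal_ofReal (hp i).1]

theorem IsNearestNeighbor.exists_recurrentSites_eq_pair {X : ℕ → ℤ} (hX : IsNearestNeighbor X)
    (h : (recurrentSites X).encard = 2) : ∃ x, recurrentSites X = {x, x + 1} := by
  obtain ⟨x, y, hxy, hR⟩ := Set.encard_eq_two.1 h
  have hn := hX.exists_neighbor_mem_recurrentSites (x := x) (by simp [hR])
  simp only [hR, Set.mem_insert_iff, Set.mem_singleton_iff] at hn
  rcases hn with hn | hn
  · exact ⟨y, by rw [hR, Set.pair_comm, show x = y + 1 by omega]⟩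
  · exact ⟨x, by rw [hR, show y = x + 1 by omega]⟩

theorem IsNearestNeighbor.alternates_of_recurrentSites_eq_pair {X : ℕ → ℤ}
    (hX : IsNearestNeighbor X) {x : ℤ} (h : recurrentSites X = {x, x + 1}) :
    ∃ n, ∀ i, X (n + 2 * i) = x ∧ X (n + 2 * i + 1) = x + 1 := by
  have h1 : x - 1 ∉ recurrentSites X := by simp [h]; omega
  have h2 : x + 2 ∉ recurrentSites X := by simp [h]
  have h3 : x ∈ recurrentSites X := by simp [h]
  obtain ⟨T, hT⟩ := eventually_atTop.1
    ((notMem_recurrentSites.1 h1).and (notMem_recurrentSites.1 h2))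
  obtain ⟨n, hn, hn'⟩ := mem_recurrentSites.1 h3 T
  refine ⟨n, fun i => ?_⟩
  induction i with
  | zero =>
    have := hX n
    have := hT (n + 1) (by omega)
    simp only [mul_zero, add_zero]
    omega
  | succ i ih =>
    have e1 := hX (n + 2 * i + 1)
    have e2 := hT (n + 2 * i + 1 + 1) (by omega)
    have e3 := hX (n + 2 * i + 1 + 1)
    have e4 := hT (n + 2 * i + 1 + 1 + 1) (by omega)
    rw [show n + 2 * (i + 1) = n + 2 * i + 1 + 1 by ring]
    omega

theorem visitsBefore_of_alternates {X : ℕ → ℤ} {x : ℤ} {n : ℕ}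
    (h : ∀ i, X (n + 2 * i) = x ∧ X (n + 2 * i + 1) = x + 1) (i : ℕ) :
    visitsBefore X (n + 2 * i) (x - 1) = visitsBefore X n (x - 1) ∧
      visitsBefore X (n + 2 * i) x = visitsBefore X n x + i ∧
      visitsBefore X (n + 2 * i) (x + 1) = visitsBefore X n (x + 1) + i := by
  induction i with
  | zero => simp
  | succ i ih =>
    obtain ⟨h1, h2⟩ := h i
    rw [show n + 2 * (i + 1) = n + 2 * i + 1 + 1 by ring]
    simp only [visitsBefore_succ, h1, h2]
    split_ifs <;> omega

theorem ae_encard_recurrentSites_ne_two {w : ℕ → ℝ} (hw : ∀ n, 0 < w n)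
    (hs : ¬ Summable fun k => 1 / w k) :
    ∀ᵐ u ∂labelMeasure, (recurrentSites (drivenWalk w u)).encard ≠ 2 := by
  -- The site and the counts at which the alternation begins are random, so all of the countably
  -- many possibilities are treated at once.
  have h : ∀ᵐ u ∂labelMeasure, ∀ (x : ℤ) (a b c : ℕ),
      ∃ i, (u (x, b + i) : ℝ) < leftProb w a (c + i) := by
    simp only [ae_all_iff]
    exact ae_exists_label_lt hw hs
  filter_upwards [h] with u hu h2
  have hX := drivenWalk_nearestNeighbor w u
  obtain ⟨x, hx⟩ := hX.exists_recurrentSites_eq_pair h2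
  obtain ⟨n, hn⟩ := hX.alternates_of_recurrentSites_eq_pair hx
  obtain ⟨i, hi⟩ := hu x (visitsBefore (drivenWalk w u) n (x - 1))
    (visitsBefore (drivenWalk w u) n x) (visitsBefore (drivenWalk w u) n (x + 1))
  obtain ⟨e1, e2, e3⟩ := visitsBefore_of_alternates hn i
  obtain ⟨h3, h4⟩ := hn i
  rw [drivenWalk_succ, h3, e1, e2, e3, if_pos hi] at h4
  omega

/-! ### Uniqueness in law and transfer to an arbitrary vertex reinforced walk. -/

/-- The paths that agree with `c` up to time `n`. -/
def pathCylinder (n : ℕ) (c : ℕ → ℤ) : Set (ℕ → ℤ) := {x | ∀ k ≤ n, x k = c k}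

theorem measurableSet_pathCylinder (n : ℕ) (c : ℕ → ℤ) : MeasurableSet (pathCylinder n c) :=
  measurableSet_pathAtom (X := fun k (x : ℕ → ℤ) => x k) (fun k _ => measurable_pi_apply k) c

theorem pathCylinder_succ (n : ℕ) (c : ℕ → ℤ) :
    pathCylinder (n + 1) c = pathCylinder n c ∩ {x | x (n + 1) = c (n + 1)} := by
  ext x
  simp only [pathCylinder, Set.mem_ofPred_eq, Set.mem_inter_iff]
  refine ⟨fun h => ⟨fun k hk => h k (by omega), h _ le_rfl⟩, fun h k hk => ?_⟩
  rcases Nat.lt_or_ge k (n + 1) with h' | h'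
  · exact h.1 k (by omega)
  · obtain rfl : k = n + 1 := by omega
    exact h.2

theorem measurableSet_coord_eq (n : ℕ) (y : ℤ) : MeasurableSet {x : ℕ → ℤ | x n = y} :=
  measurableSet_eq_fun (measurable_pi_apply n) measurable_const

/-- `leftProb` after the first `n + 1` positions of the path `c`. -/
noncomputable def pathLeftProb (w : ℕ → ℝ) (n : ℕ) (c : ℕ → ℤ) : ℝ :=
  leftProb w (visitsBefore c (n + 1) (c n - 1)) (visitsBefore c (n + 1) (c n + 1))

/-- A law on paths whose steps are those of the vertex reinforced random walk with weights `w`. -/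
structure HasReinforcedSteps (w : ℕ → ℝ) (ν : Measure (ℕ → ℤ)) : Prop where
  start : ∀ᵐ x ∂ν, x 0 = 0
  left : ∀ n c, ν.real (pathCylinder n c ∩ {x | x (n + 1) = c n - 1}) =
    pathLeftProb w n c * ν.real (pathCylinder n c)
  right : ∀ n c, ν.real (pathCylinder n c ∩ {x | x (n + 1) = c n + 1}) =
    (1 - pathLeftProb w n c) * ν.real (pathCylinder n c)

/-- The left and right probabilities add up to one and leave no mass for other steps. -/
theorem HasReinforcedSteps.measureReal_eq_zero {w : ℕ → ℝ} {ν : Measure (ℕ → ℤ)}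
    [IsProbabilityMeasure ν] (h : HasReinforcedSteps w ν) {n : ℕ} {c : ℕ → ℤ}
    (h1 : c (n + 1) ≠ c n - 1) (h2 : c (n + 1) ≠ c n + 1) :
    ν.real (pathCylinder (n + 1) c) = 0 := by
  have m := measurableSet_pathCylinder n c
  have e : ν.real (pathCylinder n c ∩ {x | x (n + 1) = c (n + 1)}) +
      ν.real (pathCylinder n c ∩ {x | x (n + 1) = c n - 1}) +
      ν.real (pathCylinder n c ∩ {x | x (n + 1) = c n + 1}) ≤ ν.real (pathCylinder n c) := by
    rw [← measureReal_union _ (m.inter (measurableSet_coord_eq _ _)),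
      ← measureReal_union _ (m.inter (measurableSet_coord_eq _ _))]
    · refine measureReal_mono ?_
      rintro x ((hx | hx) | hx) <;> exact hx.1
    · rw [Set.disjoint_left]
      rintro x (⟨-, hx⟩ | ⟨-, hx⟩) ⟨-, hx'⟩ <;> simp only [Set.mem_ofPred_eq] at hx hx' <;> omega
    · rw [Set.disjoint_left]
      rintro x ⟨-, hx⟩ ⟨-, hx'⟩
      simp only [Set.mem_ofPred_eq] at hx hx'
      omega
  rw [h.left, h.right, ← pathCylinder_succ] at e
  have := measureReal_nonneg (μ := ν) (s := pathCylinder (n + 1) c)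
  linarith

theorem HasReinforcedSteps.measureReal_pathCylinder {w : ℕ → ℝ} {ν ν' : Measure (ℕ → ℤ)}
    [IsProbabilityMeasure ν] [IsProbabilityMeasure ν'] (h : HasReinforcedSteps w ν)
    (h' : HasReinforcedSteps w ν') (n : ℕ) (c : ℕ → ℤ) :
    ν.real (pathCylinder n c) = ν'.real (pathCylinder n c) := by
  induction n with
  | zero =>
    have key : ∀ {ρ : Measure (ℕ → ℤ)} [IsProbabilityMeasure ρ], HasReinforcedSteps w ρ →
        ρ.real (pathCylinder 0 c) = if c 0 = 0 then 1 else 0 := by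
      intro ρ _ hρ
      have e : pathCylinder 0 c = {x | x 0 = c 0} := by ext x; simp [pathCylinder]
      rw [e]
      split_ifs with h0
      · have h1 : {x : ℕ → ℤ | x 0 = c 0} =ᵐ[ρ] Set.univ := by
          filter_upwards [hρ.start] with x hx
          exact propext ⟨fun _ => trivial, fun _ => hx.trans h0.symm⟩
        rw [measureReal_congr h1, probReal_univ]
      · have h1 : {x : ℕ → ℤ | x 0 = c 0} =ᵐ[ρ] (∅ : Set (ℕ → ℤ)) := by
          filter_upwards [hρ.start] with x hx
          exact propext ⟨fun hx' => h0 (hx'.symm.trans hx), fun hx' => hx'.elim⟩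
        rw [measureReal_congr h1, measureReal_empty]
    rw [key h, key h']
  | succ n ih =>
    by_cases h1 : c (n + 1) = c n - 1
    · rw [pathCylinder_succ, h1, h.left, h'.left, ih]
    by_cases h2 : c (n + 1) = c n + 1
    · rw [pathCylinder_succ, h2, h.right, h'.right, ih]
    rw [h.measureReal_eq_zero h1 h2, h'.measureReal_eq_zero h1 h2]

/-- Finitely many integer coordinates take countably many values, so cylinders determine the
marginals, and these determine the law. -/
theorem measure_ext_of_pathCylinder {ν ν' : Measure (ℕ → ℤ)} [IsFiniteMeasure ν] [IsFiniteMeasure ν']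
    (h : ∀ n c, ν.real (pathCylinder n c) = ν'.real (pathCylinder n c)) : ν = ν' := by
  have hr : ∀ n, ν.map (Finset.range (n + 1)).restrict = ν'.map (Finset.range (n + 1)).restrict := by
    intro n
    refine Measure.ext_of_singleton fun s => ?_
    have hm := Finset.measurable_restrict (X := fun _ : ℕ => ℤ) (Finset.range (n + 1))
    rw [Measure.map_apply hm (measurableSet_singleton s),
      Measure.map_apply hm (measurableSet_singleton s)]
    have he : (Finset.range (n + 1)).restrict (π := fun _ : ℕ => ℤ) ⁻¹' {s} =
        -- The value `0` beyond time `n` is arbitrary: the cylinder does not look there.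
        pathCylinder n fun k => if hk : k ∈ Finset.range (n + 1) then s ⟨k, hk⟩ else 0 := by
      ext x
      simp only [Set.mem_preimage, Set.mem_singleton_iff, pathCylinder, Set.mem_ofPred_eq]
      constructor
      · rintro rfl k hk
        rw [dif_pos (Finset.mem_range.2 (by omega))]
        rfl
      · intro hx
        ext ⟨k, hk⟩
        have := hx k (by rw [Finset.mem_range] at hk; omega)
        rwa [dif_pos hk] at this
    rw [he]
    exact (measureReal_eq_measureReal_iff).1 (h n _)
  have hI : ∀ I : Finset ℕ, ν.map I.restrict = ν'.map I.restrict := by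
    intro I
    obtain ⟨n, hn⟩ := I.exists_nat_subset_range
    have hsub : I ⊆ Finset.range (n + 1) := hn.trans (Finset.range_mono (by omega))
    have hc : I.restrict (π := fun _ : ℕ => ℤ) =
        Finset.restrict₂ hsub ∘ (Finset.range (n + 1)).restrict := rfl
    rw [hc, ← Measure.map_map (Finset.measurable_restrict₂ hsub) (Finset.measurable_restrict _),
      hr n, Measure.map_map (Finset.measurable_restrict₂ hsub) (Finset.measurable_restrict _)]
  exact IsProjectiveLimit.unique (P := fun I => ν'.map I.restrict) hI fun _ => rfl

theorem HasReinforcedSteps.unique {w : ℕ → ℝ} {ν ν' : Measure (ℕ → ℤ)}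
    [IsProbabilityMeasure ν] [IsProbabilityMeasure ν'] (h : HasReinforcedSteps w ν)
    (h' : HasReinforcedSteps w ν') : ν = ν' :=
  measure_ext_of_pathCylinder (h.measureReal_pathCylinder h')

theorem measurable_path {Ω : Type*} [MeasurableSpace Ω] {X : ℕ → Ω → ℤ}
    (hX : ∀ n, Measurable (X n)) : Measurable fun ω k => X k ω :=
  measurable_pi_lambda _ hX

/-- Integrate the conditional probability over `A`, where it is constant. With `A` a cylinder event
this turns the definition by conditional expectations into cylinder probabilities. -/
theorem measureReal_inter_of_condExp_eq {Ω : Type*} {m m0 : MeasurableSpace Ω} {μ : Measure Ω}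
    [IsProbabilityMeasure μ] (hm : m ≤ m0) {A E : Set Ω} (hA : MeasurableSet[m] A)
    (hE : MeasurableSet E) {r : Ω → ℝ} (hr : μ⟦E | m⟧ =ᵐ[μ] r) {p : ℝ} (hp : ∀ ω ∈ A, r ω = p) :
    μ.real (A ∩ E) = p * μ.real A := by
  have h1 : ∫ ω in A, (μ⟦E | m⟧) ω ∂μ = μ.real (A ∩ E) := by
    rw [setIntegral_condExp hm ((integrable_const _).indicator hE) hA, integral_indicator hE,
      Measure.restrict_restrict hE, Set.inter_comm]
    simp
  have h2 : ∫ ω in A, (μ⟦E | m⟧) ω ∂μ = ∫ ω in A, p ∂μ := by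
    refine setIntegral_congr_ae (hm A hA) ?_
    filter_upwards [hr] with ω hω hωA
    rw [hω, hp ω hωA]
  rw [← h1, h2, setIntegral_const, smul_eq_mul, mul_comm]

theorem IsVRRW.hasReinforcedSteps {Ω : Type*} [MeasurableSpace Ω] {μ : Measure Ω}
    [IsProbabilityMeasure μ] {w : ℕ → ℝ} (hw : ∀ n, 0 < w n) {X : ℕ → Ω → ℤ} (hX : IsVRRW w X μ) :
    HasReinforcedSteps w (μ.map fun ω k => X k ω) := by
  have hm := measurable_path hX.measurable
  set ℱ := Filtration.natural X fun k => (hX.measurable k).stronglyMeasurable with hℱ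
  have hadapt : ∀ n, ∀ j ≤ n, Measurable[ℱ n] (X j) := by
    intro n j hj
    have h1 : MeasurableSpace.comap (X j) inferInstance ≤ ℱ n :=
      le_iSup₂_of_le (f := fun j (_ : j ≤ n) => MeasurableSpace.comap (X j) inferInstance)
        j hj le_rfl
    exact (comap_measurable (X j)).mono h1 le_rfl
  have hA : ∀ n c, MeasurableSet[ℱ n] ((fun ω k => X k ω) ⁻¹' pathCylinder n c) := by
    intro n c
    have : (fun ω k => X k ω) ⁻¹' pathCylinder n c = ⋂ j, ⋂ (_ : j ≤ n), X j ⁻¹' {c j} := by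
      ext; simp [pathCylinder]
    rw [this]
    exact MeasurableSet.iInter fun j => MeasurableSet.iInter fun hj =>
      hadapt n j hj (measurableSet_singleton _)
  have hv : ∀ n c, ∀ ω ∈ (fun ω k => X k ω) ⁻¹' pathCylinder n c, X n ω = c n ∧
      ∀ y, localTime X n y ω = visitsBefore c (n + 1) y := by
    intro n c ω hω
    refine ⟨hω n le_rfl, fun y => ?_⟩
    rw [localTime_eq_visitsBefore]
    exact visitsBefore_congr (fun j hj => hω j (by omega)) y
  have key : ∀ n c y, (μ.map fun ω k => X k ω).real (pathCylinder n c ∩ {x | x (n + 1) = c n + y}) =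
      μ.real ((fun ω k => X k ω) ⁻¹' pathCylinder n c ∩ {ω | X (n + 1) ω = X n ω + y}) := by
    intro n c y
    rw [map_measureReal_apply hm ((measurableSet_pathCylinder n c).inter (measurableSet_coord_eq _ _)),
      Set.preimage_inter]
    congr 1
    ext ω
    refine and_congr_right fun hω => ?_
    simp only [Set.mem_preimage, Set.mem_ofPred_eq, (hv n c ω hω).1]
  refine ⟨?_, fun n c => ?_, fun n c => ?_⟩
  · rw [ae_map_iff hm.aemeasurable (measurableSet_coord_eq 0 0)]
    exact hX.start
  · have h := key n c (-1)
    simp only [← sub_eq_add_neg] at h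
    rw [h, map_measureReal_apply hm (measurableSet_pathCylinder n c)]
    refine measureReal_inter_of_condExp_eq (ℱ.le n) (hA n c)
      (measurableSet_eq_fun (hX.measurable _) ((hX.measurable n).sub_const 1)) (hX.left n) ?_
    intro ω hω
    obtain ⟨h1, h2⟩ := hv n c ω hω
    rw [h1, h2, h2, pathLeftProb, leftProb, add_comm (w _)]
  · rw [key n c 1, map_measureReal_apply hm (measurableSet_pathCylinder n c)]
    refine measureReal_inter_of_condExp_eq (ℱ.le n) (hA n c)
      (measurableSet_eq_fun (hX.measurable _) ((hX.measurable n).add_const 1)) (hX.right n) ?_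
    intro ω hω
    obtain ⟨h1, h2⟩ := hv n c ω hω
    rw [h1, h2, h2, pathLeftProb, one_sub_leftProb hw, add_comm (w _)]

theorem drivenWalk_mem_pathCylinder_update (w : ℕ → ℝ) (u : Labels) (n : ℕ) (c : ℕ → ℤ)
    (t : unitInterval) :
    drivenWalk w (Function.update u (c n, visitsBefore c n (c n)) t) ∈ pathCylinder n c ↔
      drivenWalk w u ∈ pathCylinder n c := by
  have key : ∀ (v : Labels) (s : unitInterval), drivenWalk w v ∈ pathCylinder n c →
      drivenWalk w (Function.update v (c n, visitsBefore c n (c n)) s) ∈ pathCylinder n c := by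
    intro v s hv k hk
    rw [drivenWalk_update v (m := n) (visitsBefore_congr (fun j hj => hv j hj.le) _) s k hk]
    exact hv k hk
  refine ⟨fun h => ?_, key u t⟩
  have := key _ (u (c n, visitsBefore c n (c n))) h
  rwa [Function.update_idem, Function.update_eq_self] at this

/-- Resample the label that decides the departure after the cylinder. Membership in the cylinder
does not depend on it, and the step goes left exactly when it falls below `pathLeftProb w n c`. -/
theorem measureReal_drivenWalk_left {w : ℕ → ℝ} (hw : ∀ n, 0 < w n) (n : ℕ) (c : ℕ → ℤ) :
    (labelMeasure.map (drivenWalk w)).real (pathCylinder n c ∩ {x | x (n + 1) = c n - 1}) =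
      pathLeftProb w n c * (labelMeasure.map (drivenWalk w)).real (pathCylinder n c) := by
  have hm := measurable_drivenWalk_path w
  have m1 := measurableSet_pathCylinder n c
  have m2 := m1.inter (measurableSet_coord_eq (n + 1) (c n - 1))
  have hp : pathLeftProb w n c ∈ unitInterval :=
    ⟨(leftProb_pos hw _ _).le, (leftProb_lt_one hw _ _).le⟩
  set A : Set Labels := drivenWalk w ⁻¹' pathCylinder n c with hA
  set B : Set Labels := drivenWalk w ⁻¹' (pathCylinder n c ∩ {x | x (n + 1) = c n - 1}) with hB
  rw [map_measureReal_apply hm m2, map_measureReal_apply hm m1,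
    ← integral_indicator_one (hm m2), ← integral_indicator_one (hm m1), ← integral_const_mul,
    integral_update_label (c n, visitsBefore c n (c n)) (measurable_one.indicator (hm m2)) (C := 1)]
  · refine integral_congr_ae (Eventually.of_forall fun u => ?_)
    simp only
    by_cases hu : u ∈ A
    · have h1 : ∀ t : unitInterval,
          B.indicator (1 : Labels → ℝ) (Function.update u (c n, visitsBefore c n (c n)) t) =
            if t < ⟨_, hp⟩ then 1 else 0 := by
        intro t
        have ht : drivenWalk w (Function.update u (c n, visitsBefore c n (c n)) t) ∈ pathCylinder n c :=
          (drivenWalk_mem_pathCylinder_update w u n c t).2 hu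
        have hiff : Function.update u (c n, visitsBefore c n (c n)) t ∈ B ↔
            t < ⟨pathLeftProb w n c, hp⟩ := by
          have hv : ∀ y, visitsBefore (drivenWalk w
              (Function.update u (c n, visitsBefore c n (c n)) t)) n y = visitsBefore c n y :=
            visitsBefore_congr fun j hj => ht j hj.le
          have hstep := drivenWalk_succ w (Function.update u (c n, visitsBefore c n (c n)) t) n
          rw [ht n le_rfl, hv, hv, hv, Function.update_self] at hstep
          have hpe : pathLeftProb w n c =
              leftProb w (visitsBefore c n (c n - 1)) (visitsBefore c n (c n + 1)) := by
            rw [pathLeftProb, visitsBefore_succ, visitsBefore_succ, if_neg (by omega),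
              if_neg (by omega), add_zero, add_zero]
          rw [← hpe] at hstep
          rw [hB, Set.mem_preimage, Set.mem_inter_iff, Set.mem_ofPred_eq, hstep, ← Subtype.coe_lt_coe]
          split_ifs with hlt
          · exact ⟨fun _ => hlt, fun _ => ⟨ht, rfl⟩⟩
          · exact ⟨fun h => by have := h.2; omega, fun h => absurd h hlt⟩
        by_cases hlt : t < ⟨pathLeftProb w n c, hp⟩
        · rw [if_pos hlt, Set.indicator_of_mem (hiff.2 hlt), Pi.one_apply]
        · rw [if_neg hlt, Set.indicator_of_notMem (fun h => hlt (hiff.1 h))]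
      rw [integral_congr_ae (Eventually.of_forall h1), integral_threshold, Set.indicator_of_mem hu]
      simp
    · have h1 : ∀ t : unitInterval,
          B.indicator (1 : Labels → ℝ) (Function.update u (c n, visitsBefore c n (c n)) t) = 0 := by
        intro t
        refine Set.indicator_of_notMem (fun h => hu ?_) _
        exact (drivenWalk_mem_pathCylinder_update w u n c t).1 h.1
      rw [integral_congr_ae (Eventually.of_forall h1), Set.indicator_of_notMem hu]
      simp
  · intro u
    by_cases hu : u ∈ B
    · rw [Set.indicator_of_mem hu, Pi.one_apply, abs_one]
    · rw [Set.indicator_of_notMem hu, abs_zero]; exact zero_le_one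

theorem hasReinforcedSteps_drivenWalk {w : ℕ → ℝ} (hw : ∀ n, 0 < w n) :
    HasReinforcedSteps w (labelMeasure.map (drivenWalk w)) := by
  have hm := measurable_drivenWalk_path w
  have := Measure.isProbabilityMeasure_map (μ := labelMeasure) hm.aemeasurable
  refine ⟨?_, measureReal_drivenWalk_left hw, fun n c => ?_⟩
  · rw [ae_map_iff hm.aemeasurable (measurableSet_coord_eq 0 0)]
    exact Eventually.of_forall fun u => drivenWalk_zero w u
  · have h1 := measureReal_drivenWalk_left hw n c
    have h2 := measureReal_inter_add_sdiff (μ := labelMeasure.map (drivenWalk w))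
      (s := pathCylinder n c) (measurableSet_coord_eq (n + 1) (c n - 1))
    have m1 := measurableSet_pathCylinder n c
    have h3 : (labelMeasure.map (drivenWalk w)).real (pathCylinder n c \ {x | x (n + 1) = c n - 1}) =
        (labelMeasure.map (drivenWalk w)).real (pathCylinder n c ∩ {x | x (n + 1) = c n + 1}) := by
      rw [map_measureReal_apply hm (m1.diff (measurableSet_coord_eq _ _)),
        map_measureReal_apply hm (m1.inter (measurableSet_coord_eq _ _))]
      congr 1
      ext u
      refine and_congr_right fun hu => ?_
      have h4 := drivenWalk_nearestNeighbor w u n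
      have h5 : drivenWalk w u n = c n := hu n le_rfl
      simp only [Set.mem_ofPred_eq]
      omega
    rw [h1, h3] at h2
    linarith

/-- All quantifiers range over `ℤ` or `ℕ`, hence over countable sets. Measurability in path space
allows the almost sure statements to be transferred through equality of laws. -/
theorem measurableSet_encard_recurrentSites :
    MeasurableSet {x : ℕ → ℤ | (recurrentSites x).encard = 2} := by
  have hmem : ∀ y : ℤ, Measurable fun x : ℕ → ℤ => y ∈ recurrentSites x := by
    intro y
    simp only [mem_recurrentSites]
    exact Measurable.forall fun m => Measurable.exists fun k =>
      measurable_const.and (measurableSet_setOfPred.1 (measurableSet_coord_eq k y))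
  have h : {x : ℕ → ℤ | (recurrentSites x).encard = 2} =
      {x | ∃ y z : ℤ, y ≠ z ∧ ∀ t : ℤ, t ∈ recurrentSites x ↔ (t = y ∨ t = z)} := by
    ext x
    simp only [Set.mem_ofPred_eq, Set.encard_eq_two, Set.ext_iff, Set.mem_insert_iff,
      Set.mem_singleton_iff]
  rw [h]
  refine measurableSet_setOfPred.2 (Measurable.exists fun y => Measurable.exists fun z => ?_)
  exact measurable_const.and (Measurable.forall fun t => (hmem t).iff measurable_const)

/-- A vertex reinforced random walk has the law of the walk driven by independent labels. -/
theorem IsVRRW.map_eq {Ω : Type*} [MeasurableSpace Ω] {μ : Measure Ω}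
    [IsProbabilityMeasure μ] {w : ℕ → ℝ} (hw : ∀ n, 0 < w n) {X : ℕ → Ω → ℤ} (hX : IsVRRW w X μ) :
    μ.map (fun ω k => X k ω) = labelMeasure.map (drivenWalk w) := by
  have := Measure.isProbabilityMeasure_map (μ := μ) (measurable_path hX.measurable).aemeasurable
  have := Measure.isProbabilityMeasure_map (μ := labelMeasure)
    (measurable_drivenWalk_path w).aemeasurable
  exact (hX.hasReinforcedSteps hw).unique (hasReinforcedSteps_drivenWalk hw)

theorem IsVRRW.ae_path_iff {Ω : Type*} [MeasurableSpace Ω] {μ : Measure Ω}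
    [IsProbabilityMeasure μ] {w : ℕ → ℝ} (hw : ∀ n, 0 < w n) {X : ℕ → Ω → ℤ} (hX : IsVRRW w X μ)
    {p : (ℕ → ℤ) → Prop} (hp : MeasurableSet {x | p x}) :
    (∀ᵐ ω ∂μ, p fun k => X k ω) ↔ ∀ᵐ u ∂labelMeasure, p (drivenWalk w u) := by
  rw [← ae_map_iff (measurable_path hX.measurable).aemeasurable hp, hX.map_eq hw,
    ae_map_iff (measurable_drivenWalk_path w).aemeasurable hp]

theorem mainTheorem3 {Ω : Type*} [MeasurableSpace Ω] (μ : Measure Ω) [IsProbabilityMeasure μ]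
    (w : ℕ → ℝ) (hw : ∀ n, 0 < w n) (X : ℕ → Ω → ℤ) (hX : IsVRRW w X μ) :
    ((¬ Summable fun k => 1 / w k) →
      ∀ᵐ ω ∂μ, (visitedInfinitelyOften X ω).encard ≠ 2) ∧
    ((Summable fun k => 1 / w k) → Monotone w →
      ∀ᵐ ω ∂μ, (visitedInfinitelyOften X ω).encard = 2) := by
  simp only [visitedInfinitelyOften_eq]
  refine ⟨fun hs => ?_, fun hs hm => ?_⟩
  · exact (hX.ae_path_iff hw measurableSet_encard_recurrentSites.compl).2
      (ae_encard_recurrentSites_ne_two hw hs)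
  · exact (hX.ae_path_iff hw measurableSet_encard_recurrentSites).2
      (ae_encard_recurrentSites_eq_two hw hm hs)
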